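/- Let $\mathfrak g$ be a finite-dimensional simple Lie algebra with Cartan matrix $C=(C_{i,j})_{i,j\in I}$, $C_{i,j}=\alpha_j(\alpha_i^\vee)$, let $d_i$ be the coprime positive integers with $d_iC_{i,j}=d_jC_{j,i}$, let $\omega_i$ and $\alpha_i=\sum_jC_{j,i}\omega_j$ be the fundamental weights and simple roots, $P=\bigoplus_i\mathbb Z\omega_i$, $Q^+=\bigoplus_i\mathbb Z_{\ge0}\alpha_i$, $W$ the Weyl group with simple reflections $s_i$ and length $l$, and $\Delta=\Delta_+\sqcup\Delta_-$ the roots. Let $q\in\mathbb C^\times$ not be a root of unity and $q_i=q^{d_i}$. **Rings.** Consider the free abelian group of monomials in $\Psi_{i,a}$ ($i\in I$, $a\in\mathbb C^\times$) and $[\lambda]$ ($\lambda\in P$, $[\lambda][\mu]=[\lambda+\mu]$); the weight of $\prod\Psi_{i,a}^{m_{i,a}}\cdot[\lambda]$ is $\lambda$. Put $Y_{i,a}=[\omega_i]\Psi_{i,aq_i^{-1}}\Psi_{i,aq_i}^{-1}$, and $$A_{i,a}=Y_{i,aq_i^{-1}}Y_{i,aq_i}\Bigl(\prod_{j:C_{j,i}=-1}Y_{j,a}\prod_{j:C_{j,i}=-2}Y_{j,aq^{-1}}Y_{j,aq}\prod_{j:C_{j,i}=-3}Y_{j,aq^{-2}}Y_{j,a}Y_{j,aq^2}\Bigr)^{-1}.$$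 For $v\in W$ write $\lambda\le_v\mu$ if $v(\mu)-v(\lambda)\in Q^+$. A formal $\mathbb Z$-linear combination of monomials is called $v$-convergent if the weights of its monomials lie in a finite union of cones $\{\mu:\mu\le_v\lambda\}$ and each weight occurs for only finitely many of them. Let $\widetilde{\mathcal Y}^v$ be the ring of $v$-convergent combinations of monomials in the $Y_{i,a}^{\pm1}$, let $\overline{\mathcal Y}'^v$ be the ring of finite sums of products $P\cdot R$ with $P$ a Laurent polynomial in the $\Psi_{i,a}$ and $R$ a $v$-convergent combination of monomials in the $Y_{i,a}^{\pm1}$ and $[\lambda]$, and set $\Pi=\bigoplus_{v\in W}\widetilde{\mathcal Y}^v\subset\overline\Pi'=\bigoplus_{v\in W}\overline{\mathcal Y}'^v$. Monomials are embedded diagonally. **Weyl group action.** Let $\Sigma^u_{i,a}\in\widetilde{\mathcal Y}^u$ be $\sum_{k\ge0}\prod_{0<j\le k}A^{-1}_{i,aq_i^{-2j+2}}$ if $l(us_i)>l(u)$, and $-\sum_{k\ge1}\prod_{0<j\le k}A_{i,aq_i^{2j}}$ if $l(us_i)<l(u)$. Let $\Theta_i:\Pi\to\Pi$ be the operator whose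 components $\widetilde{\mathcal Y}^v\to\widetilde{\mathcal Y}^{vs_i}$ are the continuous ring homomorphisms with $Y_{j,a}\mapsto Y_{j,a}$ for $j\ne i$ and $Y_{i,a}\mapsto Y_{i,a}A_{i,aq_i^{-1}}^{-1}\,\Sigma^{vs_i}_{i,aq_i^{-3}}/\Sigma^{vs_i}_{i,aq_i^{-1}}$, and let $\Theta_w=\Theta_{i_1}\cdots\Theta_{i_k}$ for a reduced decomposition $w=s_{i_1}\cdots s_{i_k}$. **The families.** Let $\tau_b$ be the shift $\Psi_{i,a}\mapsto\Psi_{i,ab}$, $[\lambda]\mapsto[\lambda]$; let $\varpi$ be the specialization $\Psi_{i,a}\mapsto1$, $[\lambda]\mapsto[\lambda]$, on each component of $\overline\Pi'$; and for $F\in\overline\Pi'$ write $\Lambda(F)=1$ if the component of $F$ in $\overline{\mathcal Y}'^e$ is $1$ plus a combination of monomials of weights $<0$. (a) There are unique families $\Psi_{w(\omega_i),a}$, of Laurent monomials in the $\Psi_{j,b}$, and $Q_{w(\omega_i),a}$, of invertible elements of $\overline\Pi'$, indexed by the weights $w(\omega_i)$ ($w\in W$, $i\in I$) and $a\in\mathbb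 C^\times$, such that $\Psi_{w(\omega_i),a}=\tau_a(\Psi_{w(\omega_i),1})$, $Q_{w(\omega_i),a}=\tau_a(Q_{w(\omega_i),1})$, $\Lambda(Q_{w(\omega_i),a})=1=\varpi(Q_{w(\omega_i),a})$, and $$\Theta_w(Y_{i,a})=[w(\omega_i)]\frac{\Psi_{w(\omega_i),aq_i^{-1}}Q_{w(\omega_i),aq_i^{-1}}}{\Psi_{w(\omega_i),aq_i}Q_{w(\omega_i),aq_i}}\qquad\text{for all }w,i,a.$$ (b) Let $(1-[-\alpha])^{-1}$, $\alpha\in\Delta$, stand for the inverse of $1-[-\alpha]$ in $\overline\Pi'$. There is a unique family $\chi_{w(\omega_i)}\in\mathbb Z[(1-[-\alpha])^{-1}]_{\alpha\in\Delta}\subset\overline\Pi'$, indexed by the weights $w(\omega_i)$, such that $\chi_{\omega_i}=1$ and $$\chi_{ws_i(\omega_i)}\chi_{w(\omega_i)}=(1-[-w(\alpha_i)])^{-1}\prod_{j\ne i}\chi_{w(\omega_j)}^{-C_{i,j}}\qquad\text{whenever }l(ws_i)=l(w)+1.$$ (c) Set $\mathcal Q_{w(\omega_i),a}=\chi_{w(\omega_i)}\Psi_{w(\omega_i),a}Q_{w(\omega_i),a}\in\overline\Pi'$.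 For all $i\in I$, $w\in W$, $a\in\mathbb C^\times$, the extended $QQ$-system holds in $\overline\Pi'$: $$\mathcal Q_{ws_i(\omega_i),aq_i}\mathcal Q_{w(\omega_i),aq_i^{-1}}-[-w(\alpha_i)]\,\mathcal Q_{ws_i(\omega_i),aq_i^{-1}}\mathcal Q_{w(\omega_i),aq_i}$$ $$=[-w(\alpha_i)]_+\prod_{j:C_{i,j}=-1}\mathcal Q_{w(\omega_j),a}\prod_{j:C_{i,j}=-2}\mathcal Q_{w(\omega_j),aq}\mathcal Q_{w(\omega_j),aq^{-1}}\prod_{j:C_{i,j}=-3}\mathcal Q_{w(\omega_j),aq^2}\mathcal Q_{w(\omega_j),a}\mathcal Q_{w(\omega_j),aq^{-2}},$$ where $[-w(\alpha_i)]_+=1$ if $w(\alpha_i)\in\Delta_+$ and $[-w(\alpha_i)]_+=-[-w(\alpha_i)]$ if $w(\alpha_i)\in\Delta_-$. -/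

import Mathlib

noncomputable section

/-- A Cartan matrix `C` (with the convention `C i j = ⟨α_j, α_i^∨⟩`), the coprime positive integers
`d i` that symmetrize it, and a nonzero complex number `q` that is not a root of unity.
That `C` comes from a simple Lie algebra is a hypothesis on top of this structure. -/
structure QDatum (I : Type*) [Fintype I] where
  C : Matrix I I ℤ
  C_diag : ∀ i, C i i = 2
  d : I → ℕ
  d_pos : ∀ i, 0 < d i
  d_coprime : Finset.univ.gcd d = 1
  d_symm : ∀ i j, (d i : ℤ) * C i j = (d j : ℤ) * C j i
  q : ℂˣ
  q_pow_ne_one : ∀ n : ℕ, 0 < n → q ^ n ≠ 1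

/-- The weight lattice `P`: a weight is the tuple of its coordinates in the basis of
fundamental weights. -/
abbrev Wt (I : Type*) : Type _ := I → ℤ

/-- The free abelian group on the symbols indexed by pairs `(i, a)`, written additively. -/
abbrev FreeMon (I : Type*) : Type _ := (I × ℂˣ) →₀ ℤ

namespace QDatum

set_option linter.unusedSectionVars false

variable {I : Type*} [Fintype I] [DecidableEq I] (D : QDatum I)

/-! ### Weights and the Weyl group -/

/-- `q_i = q ^ d_i`. -/
def qi (i : I) : ℂˣ := D.q ^ D.d i

/-- The fundamental weight `ω_i`. -/
def fundWt (_D : QDatum I) (i : I) : Wt I := Pi.single i 1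

/-- The simple root `α_i = ∑ j, C j i • ω_j`. -/
def simpleRoot (i : I) : Wt I := fun j => D.C j i

/-- The simple reflection `λ ↦ λ - ⟨λ, α_i^∨⟩ α_i` of `P`; it sends `ω_j` to `ω_j - δ_{ij} α_j`. -/
def refl (i : I) : Wt I ≃ₗ[ℤ] Wt I :=
  have key : ∀ x : Wt I, (x - x i • D.simpleRoot i) -
      (x - x i • D.simpleRoot i) i • D.simpleRoot i = x := by
    intro x
    have h : (x - x i • D.simpleRoot i) i = -x i := by
      simp [simpleRoot, D.C_diag]; ring
    rw [h]; simp
  { toFun := fun x => x - x i • D.simpleRoot i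
    invFun := fun x => x - x i • D.simpleRoot i
    left_inv := key
    right_inv := key
    map_add' := fun x y => by
      simp only [Pi.add_apply, add_smul]; abel
    map_smul' := fun c x => by
      simp only [Pi.smul_apply, smul_sub, smul_assoc, RingHom.id_apply] }

/-- The Weyl group, as the group of automorphisms of `P` generated by the simple reflections. -/
def weyl : Subgroup (Wt I ≃ₗ[ℤ] Wt I) := Subgroup.closure (Set.range D.refl)

/-- The Weyl group as a type. -/
abbrev W : Type _ := D.weyl

/-- The simple reflection `s_i` as an element of the Weyl group. -/
def s (i : I) : D.W := ⟨D.refl i, Subgroup.subset_closure ⟨i, rfl⟩⟩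

/-- The action of the Weyl group on weights. -/
def act (w : D.W) (x : Wt I) : Wt I := (w : Wt I ≃ₗ[ℤ] Wt I) x

/-- The element `s_{i_1} ⋯ s_{i_k}`. -/
def wordProd (l : List I) : D.W := (l.map D.s).prod

/-- The length of an element of the Weyl group. -/
def length (w : D.W) : ℕ := sInf {n | ∃ l : List I, l.length = n ∧ D.wordProd l = w}

/-- A chosen reduced decomposition of `w`. -/
def reducedWord (w : D.W) : List I :=
  Classical.epsilon fun l : List I => D.wordProd l = w ∧ l.length = D.length w

/-- The set `Δ` of roots. -/
def roots : Set (Wt I) := {x | ∃ w i, x = D.act w (D.simpleRoot i)}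

/-- The set `Δ_+` of positive roots: roots which are sums of simple roots. -/
def posRoots : Set (Wt I) :=
  {x | x ∈ D.roots ∧ ∃ n : I → ℕ, x = ∑ i, n i • D.simpleRoot i}

/-- The standard partial order on weights: `x ≤ y` iff `y - x ∈ Q^+`. -/
def wle (x y : Wt I) : Prop := ∃ n : I → ℕ, y - x = ∑ i, n i • D.simpleRoot i

/-- The strict order `<_v` on weights: `x <_v y` iff `v(x) < v(y)`. -/
def wlt (v : D.W) (x y : Wt I) : Prop :=
  D.wle (D.act v x) (D.act v y) ∧ ¬ D.wle (D.act v y) (D.act v x)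

/-- The weights `w(ω_i)`, `w ∈ W`, `i ∈ I`. -/
abbrev ExtWt : Type _ := {x : Wt I // ∃ w i, x = D.act w (D.fundWt i)}

/-- `w(ω_i)`. -/
def extWt (w : D.W) (i : I) : D.ExtWt := ⟨D.act w (D.fundWt i), w, i, rfl⟩

/-! ### Completions

For an abelian group `G` of monomials (written additively) with a weight homomorphism `G → P`, the
partial order `≺_v` on `G` is the pull-back of `<_v`. The completion of the group ring `ℤ[G]` with
respect to `≺_v` consists of the formal sums of monomials whose weights lie in a finite union of
cones `{x | x ≤_v λ}`, with finitely many monomials of each weight. A set of monomials is of this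
kind iff it is partially well-ordered for the reverse of `≺_v`; so the completion is the ring of
Hahn series for the reverse of `≺_v`. -/

/-- The group `G` of monomials, to be ordered by the reverse of `≺_v`. -/
def Graded {G : Type*} [AddCommGroup G] (_wt : G →+ Wt I) (_v : D.W) : Type _ := G

section Graded

variable {G : Type*} [AddCommGroup G] (wt : G →+ Wt I) (v : D.W)

instance : AddCommGroup (D.Graded wt v) := inferInstanceAs (AddCommGroup G)

/-- A monomial, viewed in the ordered group of monomials. -/
def gr : G ≃+ D.Graded wt v := AddEquiv.refl G

theorem wle_trans {x y z : Wt I} (h : D.wle x y) (h' : D.wle y z) : D.wle x z := by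
  obtain ⟨m, hm⟩ := h
  obtain ⟨n, hn⟩ := h'
  refine ⟨m + n, ?_⟩
  simp only [Pi.add_apply, add_smul, Finset.sum_add_distrib, ← hm, ← hn]
  abel

/-- `x ≤ y` iff `x = y` or `y ≺_v x`. -/
instance : PartialOrder (D.Graded wt v) where
  le x y := x = y ∨ D.wlt v (wt ((D.gr wt v).symm y)) (wt ((D.gr wt v).symm x))
  le_refl x := Or.inl rfl
  le_trans := by
    rintro x y z (rfl | h) (rfl | h')
    · exact Or.inl rfl
    · exact Or.inr h'
    · exact Or.inr h
    · exact Or.inr ⟨D.wle_trans h'.1 h.1, fun k => h.2 (D.wle_trans k h'.1)⟩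
  le_antisymm := by
    rintro x y (rfl | h) (h' | h')
    · rfl
    · rfl
    · exact h'.symm
    · exact absurd h'.1 h.2

theorem graded_le_iff (x y : D.Graded wt v) :
    x ≤ y ↔ x = y ∨ D.wlt v (wt ((D.gr wt v).symm y)) (wt ((D.gr wt v).symm x)) := Iff.rfl

theorem wlt_add_left (c x y : Wt I) : D.wlt v (c + x) (c + y) ↔ D.wlt v x y := by
  simp only [wlt, wle, act, map_add, add_sub_add_left_eq_sub]

theorem graded_add_le_iff (x y z : D.Graded wt v) : z + x ≤ z + y ↔ x ≤ y := by
  simp only [graded_le_iff, map_add, wlt_add_left, add_right_inj]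

instance : IsOrderedCancelAddMonoid (D.Graded wt v) where
  add_le_add_left x y h z := by
    rw [add_comm x, add_comm y]
    exact (D.graded_add_le_iff wt v x y z).2 h
  le_of_add_le_add_left z x y h := (D.graded_add_le_iff wt v x y z).1 h

/-- The formal sum with the given coefficients, as an element of the completion
(and `0` if it does not converge there). -/
def ofCoeff (f : D.Graded wt v → ℤ) : HahnSeries (D.Graded wt v) ℤ := by
  classical
  exact if h : (Function.support f).IsPWO then ⟨f, h⟩ else 0

end Graded

/-! ### The variables `Y_{i,a}`, the rings `𝒴̃^v` and `Π` -/

/-- The homomorphism `φ` from the group of monomials in the `Y_{i,a}` to `P`, `Y_{i,a} ↦ ω_i`. -/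
def phi : FreeMon I →+ Wt I :=
  Finsupp.liftAddHom fun p => (zmultiplesHom (Wt I)) (D.fundWt p.1)

/-- The monomials in the `Y_{i,a}^{±1}`, ordered for the completion `𝒴̃^v`. -/
abbrev YMon (v : D.W) : Type _ := D.Graded D.phi v

/-- The completion `𝒴̃^v` of `𝒴 = ℤ[Y_{i,a}^{±1}]`. -/
abbrev Ytilde (v : D.W) : Type _ := HahnSeries (D.YMon v) ℤ

/-- The ring `Π`; the Weyl group is finite, so that the direct sum is the product. -/
abbrev PiRing : Type _ := ∀ v : D.W, D.Ytilde v

/-- The monomial `Y_{i,a}`. -/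
def Y (_D : QDatum I) (i : I) (a : ℂˣ) : FreeMon I := Finsupp.single (i, a) 1

/-- The monomial `A_{i,a}`. -/
def A (i : I) (a : ℂˣ) : FreeMon I :=
  D.Y i (a * (D.qi i)⁻¹) + D.Y i (a * D.qi i)
    - ((∑ j with D.C j i = -1, D.Y j a)
      + (∑ j with D.C j i = -2, (D.Y j (a * D.q⁻¹) + D.Y j (a * D.q)))
      + (∑ j with D.C j i = -3, (D.Y j (a * (D.q ^ 2)⁻¹) + D.Y j a + D.Y j (a * D.q ^ 2))))

/-- A monomial as an element of `𝒴̃^v`. -/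
def yMonom (v : D.W) (m : FreeMon I) : D.Ytilde v := HahnSeries.single (D.gr D.phi v m) 1

/-- The monomial `∏_{0 < j ≤ k} A_{i, a q_i^{-2j+2}}^{-1}`. -/
def sigmaMonE (i : I) (a : ℂˣ) (k : ℕ) : FreeMon I :=
  -∑ j ∈ Finset.range k, D.A i (a * ((D.qi i) ^ (2 * j))⁻¹)

/-- The monomial `∏_{0 < j ≤ k + 1} A_{i, a q_i^{2j}}`. -/
def sigmaMonS (i : I) (a : ℂˣ) (k : ℕ) : FreeMon I :=
  ∑ j ∈ Finset.range (k + 1), D.A i (a * (D.qi i) ^ (2 * (j + 1)))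

open Classical in
/-- The series `Σ^u_{i,a} ∈ 𝒴̃^u`. If `l(u) < l(u s_i)`, it is
`Σ^e_{i,a} = 1 + A_{i,a}^{-1} (1 + A_{i,a q_i^{-2}}^{-1} (1 + ⋯))`, and otherwise it is
`Σ^{s_i}_{i,a} = -A_{i,a q_i^2} (1 + A_{i,a q_i^4} (1 + ⋯))`. -/
def Sigma (u : D.W) (i : I) (a : ℂˣ) : D.Ytilde u :=
  if D.length u < D.length (u * D.s i) then
    D.ofCoeff D.phi u fun m => if ∃ k, m = D.gr D.phi u (D.sigmaMonE i a k) then 1 else 0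
  else
    D.ofCoeff D.phi u fun m => if ∃ k, m = D.gr D.phi u (D.sigmaMonS i a k) then -1 else 0

/-! ### The operators `Θ_i` and `Θ_w` on `Π` -/

/-- Integer powers of an invertible element of a commutative ring. -/
def zpowUnit {R : Type*} [CommRing R] (x : R) (n : ℤ) : R :=
  if 0 ≤ n then x ^ n.toNat else (Ring.inverse x) ^ (-n).toNat

/-- `Θ_i(Y_{j,a}) ∈ 𝒴̃^u`, where `u = v s_i`: it is `Y_{j,a}` for `j ≠ i`, and
`Y_{i,a} A_{i,a q_i^{-1}}^{-1} Σ^u_{i,a q_i^{-3}} / Σ^u_{i,a q_i^{-1}}` for `j = i`. -/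
def thetaVar (u : D.W) (i : I) (p : I × ℂˣ) : D.Ytilde u :=
  if p.1 = i then
    D.yMonom u (D.Y i p.2 - D.A i (p.2 * (D.qi i)⁻¹))
      * D.Sigma u i (p.2 * ((D.qi i) ^ 3)⁻¹) * Ring.inverse (D.Sigma u i (p.2 * (D.qi i)⁻¹))
  else D.yMonom u (D.Y p.1 p.2)

/-- The image under `Θ_i` of a monomial, in `𝒴̃^u`. -/
def thetaMon (u : D.W) (i : I) (m : FreeMon I) : D.Ytilde u :=
  ∏ p ∈ m.support, zpowUnit (D.thetaVar u i p) (m p)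

/-- The component `𝒴̃^v → 𝒴̃^u`, `u = v s_i`, of `Θ_i`: it sends a formal sum `∑ c_m m` to
`∑ c_m Θ_i(m)`. -/
def thetaComp (i : I) (v u : D.W) (f : D.Ytilde v) : D.Ytilde u :=
  D.ofCoeff D.phi u fun m' =>
    ∑ᶠ m : FreeMon I, f.coeff (D.gr D.phi v m) * (D.thetaMon u i m).coeff m'

/-- The operator `Θ_i` on `Π`, which maps `𝒴̃^v` to `𝒴̃^{v s_i}`. -/
def theta (i : I) (F : D.PiRing) : D.PiRing :=
  fun u => D.thetaComp i (u * D.s i) u (F (u * D.s i))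

/-- The operator `Θ_w = Θ_{i_1} ⋯ Θ_{i_k}` on `Π`, for a reduced decomposition
`w = s_{i_1} ⋯ s_{i_k}`. -/
def Theta (w : D.W) (F : D.PiRing) : D.PiRing := (D.reducedWord w).foldr D.theta F

/-- `Y_{i,a}` as an element of `Π` (diagonally embedded). -/
def YPi (i : I) (a : ℂˣ) : D.PiRing := fun v => D.yMonom v (D.Y i a)

/-! ### The variables `Ψ_{i,a}` and `[λ]`, the rings `𝒴̄'^v` and `Π̄'` -/

/-- The monomials in the `Ψ_{i,a}^{±1}` and the `y_j^{±1}`, ordered for the completion labelled by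
`v`. The pair `(ψ, λ)` is `∏ Ψ_{i,a}^{ψ(i,a)} · [λ]`; its weight is `λ`. -/
abbrev PsiMon (v : D.W) : Type _ := D.Graded (AddMonoidHom.snd (FreeMon I) (Wt I)) v

/-- The monomial `(ψ, λ)` in the ordered group of monomials. -/
def pm (v : D.W) (m : FreeMon I) (l : Wt I) : D.PsiMon v :=
  D.gr (AddMonoidHom.snd (FreeMon I) (Wt I)) v (m, l)

/-- All formal sums of monomials in the `Ψ_{i,a}^{±1}` and the `y_j^{±1}` which converge for the
order labelled by `v`. -/
abbrev PsiSeries (v : D.W) : Type _ := HahnSeries (D.PsiMon v) ℤ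

/-- The embedding of monomials `Y_{i,a} ↦ [ω_i] Ψ_{i,a q_i^{-1}} Ψ_{i,a q_i}^{-1}`. -/
def yToPsi : FreeMon I →+ FreeMon I × Wt I :=
  Finsupp.liftAddHom fun p => (zmultiplesHom (FreeMon I × Wt I))
    (Finsupp.single (p.1, p.2 * (D.qi p.1)⁻¹) 1 - Finsupp.single (p.1, p.2 * D.qi p.1) 1,
      D.fundWt p.1)

theorem snd_yToPsi (m : FreeMon I) : (D.yToPsi m).2 = D.phi m := by
  have h : (AddMonoidHom.snd (FreeMon I) (Wt I)).comp D.yToPsi = D.phi := by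
    ext p : 2
    simp [yToPsi, phi]
  exact DFunLike.congr_fun h m

theorem fst_yToPsi (m : FreeMon I) (i : I) (a : ℂˣ) :
    (D.yToPsi m).1 (i, a) = m (i, a * D.qi i) - m (i, a * (D.qi i)⁻¹) := by
  let L : FreeMon I →+ ℤ := ((Finsupp.applyAddHom (i, a)).comp
    (AddMonoidHom.fst (FreeMon I) (Wt I))).comp D.yToPsi
  let R : FreeMon I →+ ℤ := (Finsupp.applyAddHom (i, a * D.qi i)) -
    (Finsupp.applyAddHom (i, a * (D.qi i)⁻¹))
  have h : L = R := by
    refine Finsupp.addHom_ext' fun p => ?_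
    ext
    obtain ⟨j, b⟩ := p
    have e1 : ((j, b * (D.qi j)⁻¹) = (i, a)) ↔ ((j, b) = (i, a * D.qi i)) := by
      simp only [Prod.mk.injEq]
      constructor
      · rintro ⟨rfl, rfl⟩; simp
      · rintro ⟨rfl, rfl⟩; simp
    have e2 : ((j, b * D.qi j) = (i, a)) ↔ ((j, b) = (i, a * (D.qi i)⁻¹)) := by
      simp only [Prod.mk.injEq]
      constructor
      · rintro ⟨rfl, rfl⟩; simp
      · rintro ⟨rfl, rfl⟩; simp
    simp [L, R, yToPsi, Finsupp.single_apply, e1, e2]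
  exact DFunLike.congr_fun h m

theorem yToPsi_injective : Function.Injective D.yToPsi := by
  rw [injective_iff_map_eq_zero]
  intro m hm
  have step : ∀ i a, m (i, a * (D.qi i) ^ 2) = m (i, a) := by
    intro i a
    have h := D.fst_yToPsi m i (a * D.qi i)
    rw [hm] at h
    simp only [Prod.fst_zero, Finsupp.coe_zero, Pi.zero_apply, mul_inv_cancel_right] at h
    rw [pow_two, ← mul_assoc]
    linarith
  ext ⟨i, a⟩
  by_contra hne
  have hall : ∀ n : ℕ, m (i, a * (D.qi i) ^ (2 * n)) = m (i, a) := by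
    intro n
    induction n with
    | zero => simp
    | succ n ih => rw [← ih, ← step i (a * (D.qi i) ^ (2 * n))]; rw [mul_assoc, ← pow_add]; rfl
  have hinj : Function.Injective fun n : ℕ => (i, a * (D.qi i) ^ (2 * n)) := by
    have key : ∀ n k : ℕ, (D.qi i) ^ (2 * n) = (D.qi i) ^ (2 * (n + k)) → k = 0 := by
      intro n k h
      by_contra hk
      have h1 : (D.qi i) ^ (2 * k) = 1 := by
        rw [mul_add, pow_add] at h
        exact (left_eq_mul.mp h)
      rw [qi, ← pow_mul] at h1
      exact D.q_pow_ne_one _ (Nat.mul_pos (D.d_pos i) (by omega)) h1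
    intro n k h
    simp only [Prod.mk.injEq, mul_right_inj, true_and] at h
    rcases le_total n k with hnk | hnk
    · obtain ⟨r, rfl⟩ := Nat.exists_eq_add_of_le hnk
      have := key n r h; omega
    · obtain ⟨r, rfl⟩ := Nat.exists_eq_add_of_le hnk
      have := key k r h.symm; omega
  refine Set.infinite_range_of_injective hinj ((Finsupp.hasFiniteSupport m).subset ?_)
  rintro _ ⟨n, rfl⟩
  simp only [Function.mem_support, hall n]
  exact hne

/-- The ring `𝒴̄'^v`: finite sums of products `P · R`, where `P` is a Laurent polynomial in the
`Ψ_{i,a}` and `R` is a convergent formal sum of monomials in the `Y_{i,a}^{±1}` and `y_j^{±1}`. -/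
def YbarSubring (v : D.W) : Subring (D.PsiSeries v) :=
  Subring.closure
    ({f | ∃ m : FreeMon I, f = HahnSeries.single (D.pm v m 0) 1} ∪
      {f | ∀ x : D.PsiMon v, f.coeff x ≠ 0 →
        ∃ (m : FreeMon I) (l : Wt I), x = D.pm v (D.yToPsi m).1 ((D.yToPsi m).2 + l)})

/-- The ring `𝒴̄'^v` as a type. -/
abbrev Ybar (v : D.W) : Type _ := D.YbarSubring v

/-- The ring `Π̄'`. -/
abbrev PiBar : Type _ := ∀ v : D.W, D.Ybar v

/-- The embedding of monomials, as a map of ordered groups. -/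
def yToPsiGr (v : D.W) : D.YMon v →+ D.PsiMon v :=
  (D.gr (AddMonoidHom.snd (FreeMon I) (Wt I)) v).toAddMonoidHom.comp
    (D.yToPsi.comp (D.gr D.phi v).symm.toAddMonoidHom)

theorem yToPsiGr_injective (v : D.W) : Function.Injective (D.yToPsiGr v) := fun _ _ h =>
  (D.gr D.phi v).symm.injective (D.yToPsi_injective
    ((D.gr (AddMonoidHom.snd (FreeMon I) (Wt I)) v).injective h))

theorem yToPsiGr_le (v : D.W) (x y : D.YMon v) :
    D.yToPsiGr v x ≤ D.yToPsiGr v y ↔ x ≤ y := by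
  have e : ∀ z : D.YMon v, AddMonoidHom.snd (FreeMon I) (Wt I)
      ((D.gr (AddMonoidHom.snd (FreeMon I) (Wt I)) v).symm (D.yToPsiGr v z)) =
        D.phi ((D.gr D.phi v).symm z) := fun z => D.snd_yToPsi ((D.gr D.phi v).symm z)
  rw [graded_le_iff, graded_le_iff, (D.yToPsiGr_injective v).eq_iff, e, e]

/-- The inclusion of `𝒴̃^v` into `𝒴̄'^v`. -/
def inclComp (v : D.W) : D.Ytilde v →+* D.Ybar v :=
  (HahnSeries.embDomainRingHom (D.yToPsiGr v) (D.yToPsiGr_injective v)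
    (D.yToPsiGr_le v)).codRestrict (D.YbarSubring v) (fun f => by
    refine Subring.subset_closure (Or.inr fun x hx => ?_)
    by_contra hcon
    refine hx (HahnSeries.embDomain_of_notMem_range ?_)
    rintro ⟨m, rfl⟩
    exact hcon ⟨(D.gr D.phi v).symm m, 0, by rw [add_zero]; rfl⟩)

/-- The inclusion of `Π` into `Π̄'`. -/
def incl (F : D.PiRing) : D.PiBar := fun v => D.inclComp v (F v)

/-- The monomial `∏ Ψ_{i,a}^{m(i,a)}` in `Π̄'`. -/
def psi (m : FreeMon I) : D.PiBar := fun v =>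
  ⟨HahnSeries.single (D.pm v m 0) 1, Subring.subset_closure (Or.inl ⟨m, rfl⟩)⟩

/-- The element `[λ]` of `Π̄'`. -/
def br (l : Wt I) : D.PiBar := fun v =>
  ⟨HahnSeries.single (D.pm v 0 l) 1, Subring.subset_closure (Or.inr fun x hx => by
    refine ⟨0, l, ?_⟩
    by_contra hne
    refine hx (HahnSeries.coeff_single_of_ne fun h => hne (h.trans ?_))
    simp)⟩

/-! ### The homomorphisms `τ_a`, `ϖ`, and the leading term -/

/-- `τ_b` on monomials, `Ψ_{i,a} ↦ Ψ_{i,ab}`. -/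
def shift (b : ℂˣ) (m : FreeMon I) : FreeMon I :=
  Finsupp.mapDomain (fun p : I × ℂˣ => (p.1, p.2 * b)) m

/-- `F' = τ_b(F)` for elements of `Π̄'`. -/
def IsShift (b : ℂˣ) (F F' : D.PiBar) : Prop :=
  ∀ (v : D.W) (m : FreeMon I) (l : Wt I),
    (F' v : D.PsiSeries v).coeff (D.pm v (shift b m) l) =
      (F v : D.PsiSeries v).coeff (D.pm v m l)

/-- The map `ϖ` on `𝒴̄'^v`, which sends every `Ψ_{i,a}` to `1` and fixes `[λ]`; the value is a formal
sum of weights, given by its coefficients. -/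
def varpi (v : D.W) (f : D.Ybar v) : Wt I → ℤ :=
  fun l => ∑ᶠ m : FreeMon I, (f : D.PsiSeries v).coeff (D.pm v m l)

/-- `ϖ(F) = 1`, for `F ∈ Π̄'`. -/
def VarpiEqOne (F : D.PiBar) : Prop := ∀ v : D.W, D.varpi v (F v) = Pi.single 0 1

/-- `Λ(F) = 1`, for `F ∈ Π̄'`: the component of `F` in `𝒴̄'^e` is `1` plus a sum of monomials
`M ≺_e 1`. -/
def LeadingEqOne (F : D.PiBar) : Prop :=
  (F 1 : D.PsiSeries 1).coeff 0 = 1 ∧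
    ∀ x : D.PsiMon 1, (F 1 : D.PsiSeries 1).coeff x ≠ 0 → 0 ≤ x

/-! ### The families `Ψ_{w(ω_i),a}`, `Q_{w(ω_i),a}` and `χ_{w(ω_i)}` -/

/-- The family `Ψ_{w(ω_i),a}` of `ℓ`-weights with `Ψ_{w(ω_i),a}(0) = 1` (that is, of Laurent
monomials in the `Ψ_{j,b}`) and the family `Q_{w(ω_i),a}` of invertible elements of `Π̄'` are
`ℂˣ`-equivariant and satisfy `Λ(Q_{w(ω_i),a}) = 1 = ϖ(Q_{w(ω_i),a})` and
`Θ_w(Y_{i,a}) = [w(ω_i)] Ψ_{w(ω_i),a q_i^{-1}} Q_{w(ω_i),a q_i^{-1}}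
  / (Ψ_{w(ω_i),a q_i} Q_{w(ω_i),a q_i})`. -/
structure IsPsiQFamily (Psi : D.ExtWt → ℂˣ → FreeMon I) (Q : D.ExtWt → ℂˣ → D.PiBar) : Prop where
  psi_equivariant : ∀ x a, Psi x a = shift a (Psi x 1)
  q_equivariant : ∀ x a, D.IsShift a (Q x 1) (Q x a)
  q_isUnit : ∀ x a, IsUnit (Q x a)
  q_leading : ∀ x a, D.LeadingEqOne (Q x a)
  q_varpi : ∀ x a, D.VarpiEqOne (Q x a)
  theta_eq : ∀ w i a,
    D.incl (D.Theta w (D.YPi i a))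
        * (D.psi (Psi (D.extWt w i) (a * D.qi i)) * Q (D.extWt w i) (a * D.qi i)) =
      D.br (D.act w (D.fundWt i))
        * (D.psi (Psi (D.extWt w i) (a * (D.qi i)⁻¹)) * Q (D.extWt w i) (a * (D.qi i)⁻¹))

/-- The element `(1 - [-β])^{-1}` of `Π̄'`; its component in `𝒴̄'^v` is the expansion of
`(1 - [-β])^{-1}` which converges there. -/
def invOneSub (b : Wt I) : D.PiBar := Ring.inverse (1 - D.br (-b))

/-- The family `χ_{w(ω_i)} ∈ ℤ[(1 - [-β])^{-1}]_{β ∈ Δ}`. -/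
structure IsChiFamily (chi : D.ExtWt → D.PiBar) : Prop where
  mem : ∀ x, chi x ∈ Subring.closure {F | ∃ b ∈ D.roots, F = D.invOneSub b}
  chi_fund : ∀ i, chi (D.extWt 1 i) = 1
  chi_mul : ∀ w i, D.length (w * D.s i) = D.length w + 1 →
    chi (D.extWt (w * D.s i) i) * chi (D.extWt w i) =
      D.invOneSub (D.act w (D.simpleRoot i))
        * ∏ j with j ≠ i, chi (D.extWt w j) ^ (-D.C i j).toNat

/-- `𝒬_{x,a} = χ_x Ψ_{x,a} Q_{x,a}`, for `x` a weight of the form `w(ω_i)`. -/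
def calQ (Psi : D.ExtWt → ℂˣ → FreeMon I) (Q : D.ExtWt → ℂˣ → D.PiBar)
    (chi : D.ExtWt → D.PiBar) (x : D.ExtWt) (a : ℂˣ) : D.PiBar :=
  chi x * (D.psi (Psi x a) * Q x a)

open Classical in
/-- `[-β]_+` for a root `β`: it is `1` if `β ∈ Δ_+`, and `-[-β]` if `β ∈ Δ_-`. -/
def brPlusNeg (b : Wt I) : D.PiBar := if b ∈ D.posRoots then 1 else -D.br (-b)

end QDatum

end

/-! Everything rests on one functional equation, valid in every component: Σ_{i,a} = 1 + A_{i,a}⁻¹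
Σ_{i,aq_i⁻²} (`Sigma_eq`).

Put X_{w,i}(a) = Ψ_{w(ω_i),a} Q_{w(ω_i),a}. This function is characterized (`IsSol`) by shift
equivariance, invertibility, ϖ = 1, a leading Ψ-monomial at the component of e, and the difference
equation Θ_w(Y_{i,a}) = [w(ω_i)] X(aq_i⁻¹)/X(aq_i). The quotient of two solutions is invariant under
the shift by q_i². Convergence allows finitely many monomials of each weight and q is not a root of
unity, so such a quotient contains no Ψ, and ϖ = 1 forces it to be 1 (`eq_one_of_tau_eq`). Existence
is an induction on length: if w(α_i) > 0, then X_{w,i}(aq_i⁻²)⁻¹ · (neighbours) · Θ_w(Σ_{i,aq_i⁻²})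
· (1 - [-w(α_i)]) is the solution for ws_i (`isSol_stepSol`). Applying Θ_w to the functional
equation and inserting this formula gives the QQ-relation with an extra factor 1 - [-w(α_i)] on the
right (`qq_of_isSol`). The recursion for χ is designed to remove that factor. The case w(α_i) < 0 is
the positive case for ws_i, rescaled (`extended_qq`).

For this, Θ_w must be multiplicative in w and Θ_w(Y_{i,a}) must depend only on w(ω_i); hence the Θ_i
must satisfy the Coxeter relations. Ring homomorphisms compatible with the filtration by height are
determined, at a given component, by their values on elements whose leading monomials generate all
monomials (`rigidity`). For Θ_i² = 1 the test elements are Y_{i,a}(1 + A_{i,aq_i}⁻¹), invariant by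
the functional equation. For the braid relation of i and j they are the q-characters of fundamental
representations in rank two, invariant under Θ_i and Θ_j (`hasInvariants`). These settle the
components v with v(α_i), v(α_j) > 0, and conjugation carries the result to the others
(`braid_of_hasInvariants`). Matsumoto's theorem and the stabilizers of fundamental weights
(`stabilizer`) do the rest.

The family χ is an explicit product over positive roots β, the exponent of (1 - [-β])⁻¹ in
χ_{w(ω_i)} being the negative part of the α_i-coefficient of w⁻¹(β) (`chiExp_add`). The root system
enters only through the properties in `FiniteType`, which are verified in `finiteType`. -/

noncomputable section

namespace QDatum

set_option linter.unusedSectionVars false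

variable {I : Type*} [Fintype I] [DecidableEq I] (D : QDatum I)

/-! ### Root combinatorics -/

/-- The properties of the Cartan matrix of an irreducible finite root system used below. -/
structure FiniteType (D : QDatum I) : Prop where
  det_ne_zero : D.C.det ≠ 0
  pos_or_neg : ∀ w i, (∃ n : I → ℕ, D.act w (D.simpleRoot i) = ∑ j, n j • D.simpleRoot j) ∨
    ∃ n : I → ℕ, D.act w (D.simpleRoot i) = -∑ j, n j • D.simpleRoot j
  cartan : ∀ i j, i ≠ j → (D.C i j = 0 ∧ D.C j i = 0) ∨ (D.C i j = -1 ∧ D.C j i = -1) ∨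
    (D.C i j = -1 ∧ D.C j i = -2) ∨ (D.C i j = -2 ∧ D.C j i = -1) ∨
    (D.C i j = -1 ∧ D.C j i = -3) ∨ (D.C i j = -3 ∧ D.C j i = -1)
  d_eq_one : ∀ i j, D.C i j = -2 ∨ D.C i j = -3 → D.d i = 1
  finite_roots : D.roots.Finite

theorem act_one (x : Wt I) : D.act 1 x = x := rfl

theorem act_mul (v w : D.W) (x : Wt I) : D.act (v * w) x = D.act v (D.act w x) := rfl

theorem act_add (w : D.W) (x y : Wt I) : D.act w (x + y) = D.act w x + D.act w y := by
  simp [act]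

theorem act_sub (w : D.W) (x y : Wt I) : D.act w (x - y) = D.act w x - D.act w y := by
  simp [act]

theorem act_neg (w : D.W) (x : Wt I) : D.act w (-x) = -D.act w x := by
  simp [act]

theorem act_zero (w : D.W) : D.act w 0 = 0 := by
  simp [act]

theorem act_zsmul (w : D.W) (n : ℤ) (x : Wt I) : D.act w (n • x) = n • D.act w x :=
  map_zsmul (w : Wt I ≃ₗ[ℤ] Wt I) n x

theorem act_nsmul (w : D.W) (n : ℕ) (x : Wt I) : D.act w (n • x) = n • D.act w x :=
  map_nsmul (w : Wt I ≃ₗ[ℤ] Wt I) n x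

theorem act_s (i : I) (x : Wt I) : D.act (D.s i) x = x - x i • D.simpleRoot i := rfl

theorem simpleRoot_self (i : I) : D.simpleRoot i i = 2 := D.C_diag i

theorem act_s_simpleRoot (i : I) : D.act (D.s i) (D.simpleRoot i) = -D.simpleRoot i := by
  rw [act_s, simpleRoot_self, two_smul]; abel

theorem act_s_act_s (i : I) (x : Wt I) : D.act (D.s i) (D.act (D.s i) x) = x := by
  rw [act_s D i x, act_sub, act_zsmul, act_s_simpleRoot, act_s]; simp

theorem s_mul_self (i : I) : D.s i * D.s i = 1 :=
  Subtype.ext (LinearEquiv.ext fun x => D.act_s_act_s i x)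

theorem s_inv (i : I) : (D.s i)⁻¹ = D.s i := inv_eq_of_mul_eq_one_left (D.s_mul_self i)

theorem mul_s_mul_s (w : D.W) (i : I) : w * D.s i * D.s i = w := by
  rw [mul_assoc, s_mul_self, mul_one]

theorem act_inv_act (w : D.W) (x : Wt I) : D.act w⁻¹ (D.act w x) = x := by
  rw [← act_mul, inv_mul_cancel, act_one]

theorem act_act_inv (w : D.W) (x : Wt I) : D.act w (D.act w⁻¹ x) = x := by
  rw [← act_mul, mul_inv_cancel, act_one]

theorem act_injective (w : D.W) : Function.Injective (D.act w) :=
  (w : Wt I ≃ₗ[ℤ] Wt I).injective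

theorem W_ext {v w : D.W} (h : ∀ x, D.act v x = D.act w x) : v = w :=
  Subtype.ext (LinearEquiv.ext h)

theorem fundWt_apply (i j : I) : D.fundWt i j = if j = i then 1 else 0 := by
  simp [fundWt, Pi.single_apply]

theorem act_s_fundWt_of_ne {i j : I} (h : j ≠ i) : D.act (D.s i) (D.fundWt j) = D.fundWt j := by
  rw [act_s, fundWt_apply, if_neg h.symm]; simp

theorem act_s_fundWt (i : I) : D.act (D.s i) (D.fundWt i) = D.fundWt i - D.simpleRoot i := by
  rw [act_s, fundWt_apply, if_pos rfl]; simp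

theorem wt_eq_sum (x : Wt I) : x = ∑ i, x i • D.fundWt i := by
  ext j
  simp [Finset.sum_apply, fundWt_apply]

/-- The coordinates of a weight in the basis of simple roots. -/
def rootCoord (x : Wt I) : I → ℚ := (D.C.map (Int.cast : ℤ → ℚ))⁻¹.mulVec fun i => (x i : ℚ)

theorem rootCoord_add (x y : Wt I) : D.rootCoord (x + y) = D.rootCoord x + D.rootCoord y := by
  rw [rootCoord, rootCoord, rootCoord, ← Matrix.mulVec_add]; congr 1; ext i; simp

theorem rootCoord_zsmul (n : ℤ) (x : Wt I) : D.rootCoord (n • x) = (n : ℚ) • D.rootCoord x := by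
  rw [rootCoord, rootCoord, ← Matrix.mulVec_smul]; congr 1; ext i; simp

/-- `rootCoord` as a homomorphism. -/
def rootCoordHom : Wt I →+ (I → ℚ) :=
  AddMonoidHom.mk' D.rootCoord D.rootCoord_add

theorem rootCoord_sub (x y : Wt I) : D.rootCoord (x - y) = D.rootCoord x - D.rootCoord y :=
  map_sub D.rootCoordHom x y

theorem rootCoord_neg (x : Wt I) : D.rootCoord (-x) = -D.rootCoord x :=
  map_neg D.rootCoordHom x

theorem rootCoord_zero : D.rootCoord 0 = 0 := map_zero D.rootCoordHom

/-- The height of a weight, which is additive and equals `1` on simple roots. -/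
def ht : Wt I →+ ℚ :=
  { toFun := fun x => ∑ i, D.rootCoord x i
    map_zero' := by simp [rootCoord_zero]
    map_add' := fun x y => by simp [rootCoord_add, Finset.sum_add_distrib] }

/-- The cone `Q^+`. -/
def IsQPos (x : Wt I) : Prop := ∃ n : I → ℕ, x = ∑ i, n i • D.simpleRoot i

theorem wle_iff (x y : Wt I) : D.wle x y ↔ D.IsQPos (y - x) := Iff.rfl

theorem IsQPos.zero : D.IsQPos 0 := ⟨0, by simp⟩

variable {D}

theorem IsQPos.add {x y : Wt I} (hx : D.IsQPos x) (hy : D.IsQPos y) : D.IsQPos (x + y) := by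
  obtain ⟨m, rfl⟩ := hx
  obtain ⟨n, rfl⟩ := hy
  exact ⟨m + n, by simp [add_smul, Finset.sum_add_distrib]⟩

theorem IsQPos.nsmul {x : Wt I} (hx : D.IsQPos x) (k : ℕ) : D.IsQPos (k • x) := by
  induction k with
  | zero => simpa using IsQPos.zero D
  | succ k ih => rw [succ_nsmul]; exact ih.add hx

variable (D)

theorem isQPos_simpleRoot (i : I) : D.IsQPos (D.simpleRoot i) :=
  ⟨Pi.single i 1, by simp [Pi.single_apply, ite_smul]⟩

theorem wle_refl (x : Wt I) : D.wle x x := by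
  rw [wle_iff, sub_self]; exact IsQPos.zero D

namespace FiniteType

variable {D} (h : D.FiniteType)
include h

theorem isUnit_det : IsUnit (D.C.map (Int.cast : ℤ → ℚ)).det := by
  have : (D.C.map (Int.cast : ℤ → ℚ)).det = ((D.C.det : ℤ) : ℚ) := by
    exact (RingHom.map_det (Int.castRingHom ℚ) D.C).symm
  rw [this]
  exact isUnit_iff_ne_zero.2 (by exact_mod_cast h.det_ne_zero)

theorem mulVec_rootCoord (x : Wt I) (i : I) : ∑ j, (D.C i j : ℚ) * D.rootCoord x j = x i := by
  have : (D.C.map (Int.cast : ℤ → ℚ)).mulVec (D.rootCoord x) = fun i => (x i : ℚ) := by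
    rw [rootCoord, Matrix.mulVec_mulVec, Matrix.mul_nonsing_inv _ h.isUnit_det, Matrix.one_mulVec]
  simpa [Matrix.mulVec, dotProduct] using congrFun this i

theorem rootCoord_injective : Function.Injective D.rootCoord := by
  intro x y hxy
  ext i
  have := h.mulVec_rootCoord x i
  rw [hxy, h.mulVec_rootCoord y i] at this
  exact_mod_cast this.symm

theorem rootCoord_simpleRoot (i : I) : D.rootCoord (D.simpleRoot i) = Pi.single i 1 := by
  have : (fun j => (D.simpleRoot i j : ℚ)) =
      (D.C.map (Int.cast : ℤ → ℚ)).mulVec (Pi.single i 1) := by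
    ext j; simp [simpleRoot]
  rw [rootCoord, this, Matrix.mulVec_mulVec, Matrix.nonsing_inv_mul _ h.isUnit_det,
    Matrix.one_mulVec]

theorem rootCoord_sum (n : I → ℤ) : D.rootCoord (∑ i, n i • D.simpleRoot i) = fun i => (n i : ℚ) := by
  have : D.rootCoord (∑ i, n i • D.simpleRoot i) = ∑ i, D.rootCoord (n i • D.simpleRoot i) :=
    map_sum D.rootCoordHom _ _
  rw [this]
  ext j
  simp [rootCoord_zsmul, h.rootCoord_simpleRoot, Finset.sum_apply, Pi.single_apply,
    -zsmul_eq_mul]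

theorem rootCoord_sum_nat (n : I → ℕ) :
    D.rootCoord (∑ i, n i • D.simpleRoot i) = fun i => (n i : ℚ) := by
  simpa using h.rootCoord_sum fun i => (n i : ℤ)

theorem isQPos_iff (x : Wt I) : D.IsQPos x ↔ ∃ n : I → ℕ, D.rootCoord x = fun i => (n i : ℚ) :=
  ⟨fun ⟨n, hn⟩ => ⟨n, hn ▸ h.rootCoord_sum_nat n⟩, fun ⟨n, hn⟩ =>
    ⟨n, h.rootCoord_injective (hn.trans (h.rootCoord_sum_nat n).symm)⟩⟩

theorem rootCoord_nonneg {x : Wt I} (hx : D.IsQPos x) (i : I) : 0 ≤ D.rootCoord x i := by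
  obtain ⟨n, hn⟩ := (h.isQPos_iff x).1 hx
  rw [hn]; positivity

theorem eq_zero_of_isQPos_neg {x : Wt I} (hx : D.IsQPos x) (hx' : D.IsQPos (-x)) : x = 0 := by
  refine h.rootCoord_injective ?_
  ext i
  have h1 := h.rootCoord_nonneg hx i
  have h2 := h.rootCoord_nonneg hx' i
  rw [rootCoord_neg] at h2
  simp only [Pi.neg_apply] at h2
  rw [rootCoord_zero]
  simp only [Pi.zero_apply]
  linarith

theorem wle_antisymm {x y : Wt I} (hx : D.wle x y) (hy : D.wle y x) : x = y := by
  rw [wle_iff] at hx hy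
  rw [← neg_sub] at hy
  exact (sub_eq_zero.1 (h.eq_zero_of_isQPos_neg hx hy)).symm

theorem wlt_iff (v : D.W) (x y : Wt I) : D.wlt v x y ↔ D.wle (D.act v x) (D.act v y) ∧ x ≠ y := by
  refine and_congr_right fun hxy => not_congr ⟨fun hyx => ?_, fun e => ?_⟩
  · exact D.act_injective v (h.wle_antisymm hxy hyx)
  · rw [e]; exact D.wle_refl _

theorem ht_simpleRoot (i : I) : D.ht (D.simpleRoot i) = 1 := by
  change ∑ j, D.rootCoord (D.simpleRoot i) j = 1
  simp [h.rootCoord_simpleRoot]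

theorem exists_ht_eq {x : Wt I} (hx : D.IsQPos x) : ∃ n : ℕ, D.ht x = n := by
  obtain ⟨n, rfl⟩ := hx
  exact ⟨∑ i, n i, by simp only [map_sum, map_nsmul, h.ht_simpleRoot]; simp⟩

theorem ht_nonneg {x : Wt I} (hx : D.IsQPos x) : 0 ≤ D.ht x := by
  obtain ⟨n, hn⟩ := h.exists_ht_eq hx
  rw [hn]; positivity

theorem eq_zero_of_ht {x : Wt I} (hx : D.IsQPos x) (h0 : D.ht x = 0) : x = 0 := by
  refine h.rootCoord_injective ?_
  ext i
  have h1 : ∑ j, D.rootCoord x j = 0 := h0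
  rw [Finset.sum_eq_zero_iff_of_nonneg fun j _ => h.rootCoord_nonneg hx j] at h1
  rw [h1 i (Finset.mem_univ i), rootCoord_zero]; rfl

theorem one_le_ht {x : Wt I} (hx : D.IsQPos x) (h0 : x ≠ 0) : 1 ≤ D.ht x := by
  obtain ⟨n, hn⟩ := h.exists_ht_eq hx
  have : n ≠ 0 := by
    rintro rfl
    exact h0 (h.eq_zero_of_ht hx (by simpa using hn))
  rw [hn]
  exact_mod_cast Nat.one_le_iff_ne_zero.2 this

/-- The coefficients of an element of Q^+ are natural numbers with sum equal to the height, so each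
of them is bounded. This is what makes the low-level part of a convergent series finite. -/
theorem finite_isQPos_ht_le (c : ℚ) : {x | D.IsQPos x ∧ D.ht x ≤ c}.Finite := by
  obtain ⟨N, hN⟩ := exists_nat_ge c
  refine ((Set.finite_Iic (fun _ : I => N)).image fun n : I → ℕ =>
    ∑ i, n i • D.simpleRoot i).subset ?_
  rintro x ⟨⟨n, rfl⟩, hx⟩
  refine ⟨n, fun i => ?_, rfl⟩
  have h1 : ((∑ i, n i : ℕ) : ℚ) ≤ N := by
    refine le_trans (le_of_eq ?_) (hx.trans hN)
    simp only [map_sum, map_nsmul, h.ht_simpleRoot]; simp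
  have h2 : ∑ i, n i ≤ N := by exact_mod_cast h1
  exact (Finset.single_le_sum (f := n) (fun _ _ => Nat.zero_le _) (Finset.mem_univ i)).trans h2

/-- The invariant bilinear form. -/
theorem form_symm (x y : Wt I) :
    ∑ i, (D.d i : ℚ) * x i * D.rootCoord y i = ∑ i, (D.d i : ℚ) * y i * D.rootCoord x i := by
  -- In simple-root coordinates the form has matrix (d_i C_{ij}), which is symmetric by `d_symm`.
  have e : ∀ x y : Wt I, ∑ i, (D.d i : ℚ) * x i * D.rootCoord y i =
      ∑ i, ∑ j, (D.d i : ℚ) * D.C i j * D.rootCoord x j * D.rootCoord y i := by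
    intro x y
    refine Finset.sum_congr rfl fun i _ => ?_
    rw [← h.mulVec_rootCoord x i, Finset.mul_sum, Finset.sum_mul]
    exact Finset.sum_congr rfl fun j _ => by ring
  rw [e, e, Finset.sum_comm]
  refine Finset.sum_congr rfl fun i _ => Finset.sum_congr rfl fun j _ => ?_
  have : (D.d i : ℚ) * D.C i j = D.d j * D.C j i := by exact_mod_cast D.d_symm i j
  rw [this]; ring

end FiniteType

/-- The invariant bilinear form on weights. -/
def form (x y : Wt I) : ℚ := ∑ i, (D.d i : ℚ) * x i * D.rootCoord y i

theorem form_fundWt_left (i : I) (y : Wt I) : D.form (D.fundWt i) y = D.d i * D.rootCoord y i := by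
  simp [form, fundWt_apply]

theorem form_sub_left (x y z : Wt I) : D.form (x - y) z = D.form x z - D.form y z := by
  simp only [form, ← Finset.sum_sub_distrib]
  exact Finset.sum_congr rfl fun i _ => by simp; ring

theorem form_zsmul_left (n : ℤ) (x z : Wt I) : D.form (n • x) z = n * D.form x z := by
  simp only [form, Finset.mul_sum]
  exact Finset.sum_congr rfl fun i _ => by simp; ring

namespace FiniteType

variable {D} (h : D.FiniteType)
include h

theorem form_comm (x y : Wt I) : D.form x y = D.form y x := h.form_symm x y

theorem form_simpleRoot_right (x : Wt I) (i : I) : D.form x (D.simpleRoot i) = D.d i * x i := by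
  simp [form, h.rootCoord_simpleRoot, Pi.single_apply]

theorem form_act_s (i : I) (x y : Wt I) :
    D.form (D.act (D.s i) x) (D.act (D.s i) y) = D.form x y := by
  have e : ∀ x y : Wt I, D.form (D.act (D.s i) x) y = D.form x y - x i * (D.d i * y i) := by
    intro x y
    rw [act_s, form_sub_left, form_zsmul_left, h.form_comm (D.simpleRoot i) y,
      h.form_simpleRoot_right]
  have h2 : D.act (D.s i) y i = -y i := by
    rw [act_s]; simp [simpleRoot_self]; ring
  rw [e, h2, h.form_comm x, e, h.form_comm y x]
  push_cast; ring

theorem form_act (w : D.W) (x y : Wt I) : D.form (D.act w x) (D.act w y) = D.form x y := by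
  obtain ⟨w, hw⟩ := w
  revert x y
  refine Subgroup.closure_induction (p := fun w hw => ∀ x y,
    D.form (D.act ⟨w, hw⟩ x) (D.act ⟨w, hw⟩ y) = D.form x y) ?_ ?_ ?_ ?_ hw
  · rintro _ ⟨i, rfl⟩ x y
    exact h.form_act_s i x y
  · intro x y; rfl
  · intro a b ha hb h1 h2 x y
    exact (h1 _ _).trans (h2 x y)
  · intro a ha h1 x y
    have e : ∀ z, D.act ⟨a, ha⟩ (D.act ⟨a, ha⟩⁻¹ z) = z := D.act_act_inv ⟨a, ha⟩
    have := h1 (D.act ⟨a, ha⟩⁻¹ x) (D.act ⟨a, ha⟩⁻¹ y)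
    rw [e, e] at this
    exact this.symm

theorem d_eq_of_act_eq {w : D.W} {i j : I} (e : D.act w (D.simpleRoot i) = D.simpleRoot j) :
    D.d i = D.d j := by
  have := h.form_act w (D.simpleRoot i) (D.simpleRoot i)
  rw [e, h.form_simpleRoot_right, h.form_simpleRoot_right, simpleRoot_self, simpleRoot_self] at this
  have h3 : (D.d j : ℚ) = D.d i := by push_cast at this; linarith
  exact_mod_cast h3.symm

/-- Invariance of the form gives ⟨w(x), α_j^∨⟩ = ⟨x, α_i^∨⟩, so w conjugates one reflection into the
other. This is the cancellation behind the exchange condition. -/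
theorem mul_s_eq_of_act_eq {w : D.W} {i j : I} (e : D.act w (D.simpleRoot i) = D.simpleRoot j) :
    w * D.s i = D.s j * w := by
  refine D.W_ext fun x => ?_
  have h1 := h.form_act w x (D.simpleRoot i)
  rw [e, h.form_simpleRoot_right, h.form_simpleRoot_right, h.d_eq_of_act_eq e] at h1
  have h2 : (D.d j : ℚ) ≠ 0 := by exact_mod_cast (D.d_pos j).ne'
  have h3 : D.act w x j = x i := by exact_mod_cast mul_left_cancel₀ h2 h1
  rw [act_mul, act_mul, act_s, act_s, act_sub, act_zsmul, e, h3]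

theorem simpleRoot_ne_zero (i : I) : D.simpleRoot i ≠ 0 := fun e => by
  have := D.simpleRoot_self i
  rw [e] at this; simp at this

theorem act_simpleRoot_ne_zero (w : D.W) (i : I) : D.act w (D.simpleRoot i) ≠ 0 := fun e =>
  h.simpleRoot_ne_zero i (D.act_injective w (e.trans (D.act_zero w).symm))

theorem isQPos_or (w : D.W) (i : I) :
    D.IsQPos (D.act w (D.simpleRoot i)) ∨ D.IsQPos (-D.act w (D.simpleRoot i)) := by
  rcases h.pos_or_neg w i with hn | ⟨n, hn⟩
  · exact Or.inl hn
  · exact Or.inr ⟨n, by rw [hn, neg_neg]⟩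

theorem isQPos_neg_iff (w : D.W) (i : I) :
    D.IsQPos (-D.act w (D.simpleRoot i)) ↔ ¬ D.IsQPos (D.act w (D.simpleRoot i)) :=
  ⟨fun h1 h2 => h.act_simpleRoot_ne_zero w i (h.eq_zero_of_isQPos_neg h2 h1),
    fun h1 => (h.isQPos_or w i).resolve_left h1⟩

theorem exists_int_coord (w : D.W) (i : I) :
    ∃ n : I → ℤ, D.act w (D.simpleRoot i) = ∑ j, n j • D.simpleRoot j := by
  rcases h.pos_or_neg w i with ⟨n, hn⟩ | ⟨n, hn⟩
  · exact ⟨fun j => n j, by simpa using hn⟩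
  · exact ⟨fun j => -n j, by simpa using hn⟩

theorem rootCoord_act_s (i : I) (x : Wt I) (j : I) :
    D.rootCoord (D.act (D.s i) x) j = D.rootCoord x j - if j = i then (x i : ℚ) else 0 := by
  rw [act_s, rootCoord_sub, rootCoord_zsmul, h.rootCoord_simpleRoot]
  simp [Pi.single_apply]

/-- A simple reflection makes only one positive root negative. -/
theorem eq_simpleRoot_of_neg {w : D.W} {i k : I} (hp : D.IsQPos (D.act w (D.simpleRoot i)))
    (hn : ¬ D.IsQPos (D.act (D.s k) (D.act w (D.simpleRoot i)))) :
    D.act w (D.simpleRoot i) = D.simpleRoot k := by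
  rw [← act_mul, ← h.isQPos_neg_iff, act_mul] at hn
  -- s_k changes only the coordinate at k, so every other coordinate is both nonnegative and
  -- nonpositive.
  have hz : ∀ j, j ≠ k → D.rootCoord (D.act w (D.simpleRoot i)) j = 0 := by
    intro j hj
    have h1 := h.rootCoord_nonneg hn j
    rw [rootCoord_neg, Pi.neg_apply, h.rootCoord_act_s, if_neg hj] at h1
    have h2 := h.rootCoord_nonneg hp j
    linarith
  obtain ⟨n, hn'⟩ := id hp
  have hn2 : D.act w (D.simpleRoot i) = n k • D.simpleRoot k := by
    rw [hn', Finset.sum_eq_single k]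
    · intro j _ hj
      have := hz j hj
      rw [hn', h.rootCoord_sum_nat] at this
      have : n j = 0 := Nat.cast_eq_zero.1 this
      rw [this, zero_smul]
    · simp
  -- The multiple of α_k is 1: applying w⁻¹ writes α_i as `n k` times a vector with integer
  -- coordinates.
  obtain ⟨m, hm⟩ := h.exists_int_coord w⁻¹ k
  have h3 : D.simpleRoot i = (n k : ℤ) • ∑ j, m j • D.simpleRoot j := by
    rw [← hm, ← D.act_inv_act w (D.simpleRoot i), hn2, act_nsmul]; simp
  have h4 := congrArg (fun x => D.rootCoord x i) h3
  simp only [rootCoord_zsmul, h.rootCoord_sum, h.rootCoord_simpleRoot] at h4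
  simp only [Pi.single_eq_same, Pi.smul_apply, smul_eq_mul] at h4
  have h5 : (1 : ℤ) = n k * m i := by exact_mod_cast h4
  have h6 : (n k : ℤ) ∣ 1 := ⟨m i, h5⟩
  have h7 : n k = 1 := by
    have := Int.eq_one_of_dvd_one (by positivity) h6
    exact_mod_cast this
  rw [hn2, h7, one_smul]

end FiniteType

/-! ### Lengths -/

theorem wordProd_nil : D.wordProd [] = 1 := rfl

theorem wordProd_cons (i : I) (l : List I) : D.wordProd (i :: l) = D.s i * D.wordProd l := by
  simp [wordProd]

theorem wordProd_append (l l' : List I) :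
    D.wordProd (l ++ l') = D.wordProd l * D.wordProd l' := by
  simp [wordProd]

theorem wordProd_singleton (i : I) : D.wordProd [i] = D.s i := by
  simp [wordProd]

theorem exists_word (w : D.W) : ∃ l, D.wordProd l = w := by
  obtain ⟨w, hw⟩ := w
  have hw' := hw
  refine Subgroup.closure_induction (p := fun w hw => ∃ l, D.wordProd l = ⟨w, hw⟩) ?_ ?_ ?_ ?_ hw
  · rintro _ ⟨i, rfl⟩
    exact ⟨[i], D.wordProd_singleton i⟩
  · exact ⟨[], rfl⟩
  · rintro a b ha hb ⟨l, hl⟩ ⟨l', hl'⟩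
    exact ⟨l ++ l', by rw [wordProd_append, hl, hl']; rfl⟩
  · rintro a ha ⟨l, hl⟩
    refine ⟨l.reverse, ?_⟩
    have : (⟨a⁻¹, inv_mem ha⟩ : D.W) = (⟨a, ha⟩ : D.W)⁻¹ := rfl
    rw [this, ← hl]
    clear hl
    induction l with
    | nil => simp [wordProd_nil]
    | cons i l ih =>
      rw [List.reverse_cons, wordProd_append, ih, wordProd_singleton, wordProd_cons, mul_inv_rev,
        s_inv]

theorem length_le (l : List I) : D.length (D.wordProd l) ≤ l.length :=
  Nat.sInf_le ⟨l, rfl, rfl⟩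

theorem exists_reduced (w : D.W) : ∃ l, D.wordProd l = w ∧ l.length = D.length w := by
  obtain ⟨l, hl⟩ := D.exists_word w
  obtain ⟨l', h1, h2⟩ := Nat.sInf_mem (s := {n | ∃ l : List I, l.length = n ∧ D.wordProd l = w})
    ⟨_, l, rfl, hl⟩
  exact ⟨l', h2, h1⟩

theorem reducedWord_spec (w : D.W) :
    D.wordProd (D.reducedWord w) = w ∧ (D.reducedWord w).length = D.length w :=
  Classical.epsilon_spec (D.exists_reduced w)

theorem length_one : D.length 1 = 0 := Nat.le_zero.1 (D.length_le [])

theorem length_mul_s_le (w : D.W) (i : I) : D.length (w * D.s i) ≤ D.length w + 1 := by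
  obtain ⟨l, rfl, hl⟩ := D.exists_reduced w
  rw [← hl, ← wordProd_singleton, ← wordProd_append]
  exact (D.length_le _).trans (by simp)

theorem length_le_mul_s (w : D.W) (i : I) : D.length w ≤ D.length (w * D.s i) + 1 := by
  conv_lhs => rw [← D.mul_s_mul_s w i]
  exact D.length_mul_s_le _ i

namespace FiniteType

variable {D} (h : D.FiniteType)
include h

/-- The exchange condition. -/
theorem exists_shorter (l : List I) (i : I)
    (hn : ¬ D.IsQPos (D.act (D.wordProd l) (D.simpleRoot i))) :
    ∃ l', l'.length + 1 = l.length ∧ D.wordProd l * D.s i = D.wordProd l' := by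
  induction l with
  | nil => exact absurd (D.isQPos_simpleRoot i) hn
  | cons k l ih =>
    by_cases hp : D.IsQPos (D.act (D.wordProd l) (D.simpleRoot i))
    · rw [wordProd_cons, act_mul] at hn
      have e := h.eq_simpleRoot_of_neg hp hn
      refine ⟨l, rfl, ?_⟩
      rw [wordProd_cons, mul_assoc, h.mul_s_eq_of_act_eq e, ← mul_assoc, s_mul_self, one_mul]
    · obtain ⟨l', h1, h2⟩ := ih hp
      exact ⟨k :: l', by simp [← h1], by rw [wordProd_cons, wordProd_cons, mul_assoc, h2]⟩

theorem length_mul_s_of_not_isQPos {w : D.W} {i : I}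
    (hn : ¬ D.IsQPos (D.act w (D.simpleRoot i))) : D.length (w * D.s i) + 1 = D.length w := by
  refine le_antisymm ?_ (D.length_le_mul_s w i)
  obtain ⟨l, rfl, hl⟩ := D.exists_reduced w
  obtain ⟨l', h1, h2⟩ := h.exists_shorter l i hn
  rw [h2, ← hl, ← h1]
  exact Nat.succ_le_succ (D.length_le l')

theorem length_mul_s_of_isQPos {w : D.W} {i : I}
    (hp : D.IsQPos (D.act w (D.simpleRoot i))) : D.length (w * D.s i) = D.length w + 1 := by
  have hn : ¬ D.IsQPos (D.act (w * D.s i) (D.simpleRoot i)) := by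
    rw [← h.isQPos_neg_iff, act_mul, act_s_simpleRoot, act_neg, neg_neg]; exact hp
  have := h.length_mul_s_of_not_isQPos hn
  rw [mul_s_mul_s] at this
  exact this.symm

theorem length_lt_iff {w : D.W} {i : I} :
    D.length w < D.length (w * D.s i) ↔ D.IsQPos (D.act w (D.simpleRoot i)) := by
  by_cases hp : D.IsQPos (D.act w (D.simpleRoot i))
  · simp [hp, h.length_mul_s_of_isQPos hp]
  · have := h.length_mul_s_of_not_isQPos hp
    simp only [hp, iff_false]; omega

theorem length_mul_s_eq_iff {w : D.W} {i : I} :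
    D.length (w * D.s i) = D.length w + 1 ↔ D.IsQPos (D.act w (D.simpleRoot i)) := by
  rw [← h.length_lt_iff]
  have := D.length_mul_s_le w i
  omega

theorem isQPos_act_mul_s_iff (w : D.W) (i : I) :
    D.IsQPos (D.act (w * D.s i) (D.simpleRoot i)) ↔ ¬ D.IsQPos (D.act w (D.simpleRoot i)) := by
  rw [← h.isQPos_neg_iff, act_mul, act_s_simpleRoot, act_neg]

theorem exists_descent {w : D.W} (hw : w ≠ 1) :
    ∃ i, ¬ D.IsQPos (D.act w (D.simpleRoot i)) := by
  obtain ⟨l, hl, hl'⟩ := D.exists_reduced w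
  rcases List.eq_nil_or_concat l with rfl | ⟨l', i, rfl⟩
  · exact absurd hl.symm hw
  · refine ⟨i, fun hp => ?_⟩
    have h1 := h.length_mul_s_of_isQPos hp
    rw [← hl, List.concat_eq_append, wordProd_append, wordProd_singleton, mul_s_mul_s] at h1
    have h2 := D.length_le l'
    rw [← hl] at hl'
    simp [List.concat_eq_append, wordProd_append, wordProd_singleton] at hl'
    omega

end FiniteType

end QDatum

end

/-! ### Parabolic stabilizers and braid moves in the Weyl group. -/

noncomputable section

namespace QDatum

set_option linter.unusedSectionVars false

variable {I : Type*} [Fintype I] [DecidableEq I] (D : QDatum I)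

/-! ### Stabilizers of fundamental weights -/

namespace FiniteType

variable {D} (h : D.FiniteType)
include h

/-- Induction on length. If x(α_k) < 0 then k ≠ i: otherwise (ω_j, x(α_i)) = (ω_i, α_i) = d_i would
be positive, while it is a nonpositive coordinate times d_j. So s_k fixes ω_i and can be removed
from x. This makes families defined through pairs (w, i) depend only on the weight w(ω_i). -/
theorem stabilizer {x : D.W} {i j : I} (e : D.act x (D.fundWt i) = D.fundWt j) :
    i = j ∧ ∃ l : List I, (∀ k ∈ l, k ≠ i) ∧ D.wordProd l = x := by
  induction hn : D.length x generalizing x with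
  | zero =>
    obtain ⟨l, hl, hl'⟩ := D.exists_reduced x
    rw [hn, List.length_eq_zero_iff] at hl'
    subst hl'
    subst hl
    refine ⟨?_, [], by simp, rfl⟩
    have e1 := congrFun e i
    rw [wordProd_nil, act_one, fundWt_apply, fundWt_apply, if_pos rfl] at e1
    by_contra hij
    rw [if_neg hij] at e1
    exact one_ne_zero e1
  | succ n ih =>
    have hx : x ≠ 1 := by
      rintro rfl
      rw [length_one] at hn; omega
    obtain ⟨k, hk⟩ := h.exists_descent hx
    have h1 := h.form_act x (D.fundWt i) (D.simpleRoot k)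
    rw [e, h.form_simpleRoot_right, form_fundWt_left] at h1
    have h2 := h.rootCoord_nonneg ((h.isQPos_neg_iff x k).2 hk) j
    rw [rootCoord_neg, Pi.neg_apply] at h2
    have hki : k ≠ i := by
      rintro rfl
      rw [fundWt_apply, if_pos rfl] at h1
      have h3 : (0 : ℚ) < D.d k := by exact_mod_cast D.d_pos k
      have h4 : (0 : ℚ) < D.d j := by exact_mod_cast D.d_pos j
      have h5 : (D.d j : ℚ) * D.rootCoord (D.act x (D.simpleRoot k)) j ≤ 0 :=
        mul_nonpos_of_nonneg_of_nonpos h4.le (by linarith)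
      rw [h1] at h5
      push_cast at h5
      linarith
    have h3 := h.length_mul_s_of_not_isQPos hk
    obtain ⟨hij, l, hl, hl'⟩ := ih (x := x * D.s k)
      (by rw [act_mul, act_s_fundWt_of_ne D hki.symm, e]) (by omega)
    refine ⟨hij, l ++ [k], ?_, ?_⟩
    · intro t ht
      rcases List.mem_append.1 ht with ht | ht
      · exact hl t ht
      · rw [List.mem_singleton.1 ht]; exact hki
    · rw [wordProd_append, wordProd_singleton, hl', mul_s_mul_s]

end FiniteType

/-! ### Alternating words and reduced decompositions -/

/-- The alternating word in `i` and `j` of the given length which ends in `i`. -/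
def altWord (i j : I) : ℕ → List I
  | 0 => []
  | k + 1 => (if Even k then i else j) :: altWord i j k

theorem length_altWord (i j : I) (k : ℕ) : (altWord i j k).length = k := by
  induction k with
  | zero => rfl
  | succ k ih => simp [altWord, ih]

/-- The definition grows the word on the left; arguments with right descents need its last letter.
-/
theorem altWord_succ (i j : I) (k : ℕ) : altWord i j (k + 1) = altWord j i k ++ [i] := by
  induction k with
  | zero => simp [altWord]
  | succ k ih =>
    rw [altWord, ih, altWord]
    by_cases hk : Even k <;> simp [hk, Nat.even_add_one]

/-- The order of `s_i s_j`. -/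
def coxeterOrder (i j : I) : ℕ :=
  if D.C i j * D.C j i = 0 then 2 else if D.C i j * D.C j i = 1 then 3
  else if D.C i j * D.C j i = 2 then 4 else 6

/-- On a coset of ℤα_i + ℤα_j both reflections act affinely on two integer coefficients, which
reduces the rank two braid relations to arithmetic. -/
theorem act_s_comb (i j : I) (x : Wt I) (p q : ℤ) :
    D.act (D.s i) (x - p • D.simpleRoot i - q • D.simpleRoot j) =
      x - (x i - p - D.C i j * q) • D.simpleRoot i - q • D.simpleRoot j := by
  rw [act_s]
  have : (x - p • D.simpleRoot i - q • D.simpleRoot j) i = x i - 2 * p - D.C i j * q := by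
    simp [simpleRoot, D.C_diag]; ring
  rw [this]
  module

theorem act_s_comb' (i j : I) (x : Wt I) (p q : ℤ) :
    D.act (D.s j) (x - p • D.simpleRoot i - q • D.simpleRoot j) =
      x - p • D.simpleRoot i - (x j - q - D.C j i * p) • D.simpleRoot j := by
  rw [sub_right_comm, act_s_comb, sub_right_comm]

theorem act_s_rank_two (i j : I) (p q : ℤ) :
    D.act (D.s i) (p • D.simpleRoot i + q • D.simpleRoot j) =
      (-p - D.C i j * q) • D.simpleRoot i + q • D.simpleRoot j := by
  have := D.act_s_comb i j 0 (-p) (-q)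
  have e : (0 : Wt I) - (-p) • D.simpleRoot i - (-q) • D.simpleRoot j =
    p • D.simpleRoot i + q • D.simpleRoot j := by module
  rw [e] at this
  rw [this, Pi.zero_apply]
  module

theorem act_s_rank_two' (i j : I) (p q : ℤ) :
    D.act (D.s j) (p • D.simpleRoot i + q • D.simpleRoot j) =
      p • D.simpleRoot i + (-q - D.C j i * p) • D.simpleRoot j := by
  rw [add_comm, act_s_rank_two, add_comm]

theorem altWord_two (i j : I) : altWord i j 2 = [j, i] := rfl

theorem altWord_three (i j : I) : altWord i j 3 = [i, j, i] := rfl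

theorem altWord_four (i j : I) : altWord i j 4 = [j, i, j, i] := rfl

theorem altWord_five (i j : I) : altWord i j 5 = [i, j, i, j, i] := rfl

theorem altWord_six (i j : I) : altWord i j 6 = [j, i, j, i, j, i] := rfl

namespace FiniteType

variable {D} (h : D.FiniteType)
include h

theorem coxeterOrder_cases {i j : I} (hij : i ≠ j) :
    (D.coxeterOrder i j = 2 ∧ D.C i j = 0 ∧ D.C j i = 0) ∨
    (D.coxeterOrder i j = 3 ∧ D.C i j = -1 ∧ D.C j i = -1) ∨
    (D.coxeterOrder i j = 4 ∧ D.C i j = -1 ∧ D.C j i = -2) ∨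
    (D.coxeterOrder i j = 4 ∧ D.C i j = -2 ∧ D.C j i = -1) ∨
    (D.coxeterOrder i j = 6 ∧ D.C i j = -1 ∧ D.C j i = -3) ∨
    (D.coxeterOrder i j = 6 ∧ D.C i j = -3 ∧ D.C j i = -1) := by
  rcases h.cartan i j hij with hc | hc | hc | hc | hc | hc <;>
    simp [coxeterOrder, hc.1, hc.2]

theorem wordProd_altWord {i j : I} (hij : i ≠ j) :
    D.wordProd (altWord i j (D.coxeterOrder i j)) =
      D.wordProd (altWord j i (D.coxeterOrder i j)) := by
  refine D.W_ext fun x => ?_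
  have e : x = x - (0 : ℤ) • D.simpleRoot i - (0 : ℤ) • D.simpleRoot j := by simp
  rw [e]
  rcases h.coxeterOrder_cases hij with hc | hc | hc | hc | hc | hc <;>
    simp only [hc.1, altWord_two, altWord_three, altWord_four, altWord_six, wordProd_cons,
      wordProd_nil, mul_one, act_mul, act_s_comb, act_s_comb', hc.2.1, hc.2.2] <;>
    ring_nf

/-- Below the order of s_i s_j, each new letter of an alternating word contributes an inversion that
is a positive combination of α_i and α_j. -/
theorem altWord_root {i j : I} (hij : i ≠ j) {k : ℕ} (hk : k < D.coxeterOrder i j) :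
    ∃ p q : ℕ, D.act (D.wordProd (altWord i j k))⁻¹ (D.simpleRoot (if Even k then i else j)) =
      p • D.simpleRoot i + q • D.simpleRoot j := by
  suffices H : ∃ p q : ℤ, 0 ≤ p ∧ 0 ≤ q ∧
      D.act (D.wordProd (altWord i j k))⁻¹ (D.simpleRoot (if Even k then i else j)) =
        p • D.simpleRoot i + q • D.simpleRoot j by
    obtain ⟨p, q, hp, hq, H⟩ := H
    lift p to ℕ using hp
    lift q to ℕ using hq
    exact ⟨p, q, by simpa only [natCast_zsmul] using H⟩
  have ei : D.simpleRoot i = (1 : ℤ) • D.simpleRoot i + (0 : ℤ) • D.simpleRoot j := by simp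
  have ej : D.simpleRoot j = (0 : ℤ) • D.simpleRoot i + (1 : ℤ) • D.simpleRoot j := by simp
  have key : ∀ p q : ℤ, 0 ≤ p → 0 ≤ q → ∀ x, x = p • D.simpleRoot i + q • D.simpleRoot j →
      ∃ p q : ℤ, 0 ≤ p ∧ 0 ≤ q ∧ x = p • D.simpleRoot i + q • D.simpleRoot j :=
    fun p q hp hq x hx => ⟨p, q, hp, hq, hx⟩
  obtain ⟨e1, e3, e5⟩ : ¬ Even 1 ∧ ¬ Even 3 ∧ ¬ Even 5 := by decide
  obtain ⟨e0, e2, e4⟩ : Even 0 ∧ Even 2 ∧ Even 4 := by decide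
  have a0 : altWord i j 0 = [] := rfl
  have a1 : altWord i j 1 = [i] := rfl
  rcases h.coxeterOrder_cases hij with hc | hc | hc | hc | hc | hc <;>
    (rw [hc.1] at hk; interval_cases k) <;>
    simp only [e0, e1, e2, e3, e4, e5, if_true, if_false, a0, a1, altWord_two, altWord_three,
      altWord_four, altWord_five]
  -- The alternatives correspond to the next letter: i for even k, j for odd k.
  all_goals first
    | (refine key _ _ ?_ ?_ _ ((congrArg (D.act _) ei).trans (by
        simp only [wordProd_cons, wordProd_nil, mul_one, mul_inv_rev, s_inv, act_mul,
          act_s_rank_two, act_s_rank_two', hc.2.1, hc.2.2]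
        rfl)) <;> norm_num)
    | (refine key _ _ ?_ ?_ _ ((congrArg (D.act _) ej).trans (by
        simp only [wordProd_cons, wordProd_nil, mul_one, mul_inv_rev, s_inv, act_mul,
          act_s_rank_two, act_s_rank_two', hc.2.1, hc.2.2]
        rfl)) <;> norm_num)

/-- If w makes α_i and α_j negative, it makes every root of their positive span negative. So the
letters of an alternating word can be stripped from w one at a time, each lowering the length. -/
theorem exists_mul_altWord {w : D.W} {i j : I} (hij : i ≠ j)
    (hi : ¬ D.IsQPos (D.act w (D.simpleRoot i))) (hj : ¬ D.IsQPos (D.act w (D.simpleRoot j)))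
    {k : ℕ} (hk : k ≤ D.coxeterOrder i j) :
    ∃ w', w = w' * D.wordProd (altWord i j k) ∧ D.length w = D.length w' + k := by
  induction k with
  | zero => exact ⟨w, by simp [altWord, wordProd_nil], rfl⟩
  | succ k ih =>
    obtain ⟨w', h1, h2⟩ := ih (by omega)
    obtain ⟨p, q, hpq⟩ := h.altWord_root hij (k := k) (by omega)
    set c := if Even k then i else j with hc
    have h3 : D.act w' (D.simpleRoot c) = p • D.act w (D.simpleRoot i) +
        q • D.act w (D.simpleRoot j) := by
      have : w' = w * (D.wordProd (altWord i j k))⁻¹ := by rw [h1]; simp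
      rw [this, act_mul, hpq, act_add, act_nsmul, act_nsmul]
    have h4 : ¬ D.IsQPos (D.act w' (D.simpleRoot c)) := by
      rw [← h.isQPos_neg_iff, h3, neg_add, ← smul_neg, ← smul_neg]
      exact (((h.isQPos_neg_iff w i).2 hi).nsmul p).add (((h.isQPos_neg_iff w j).2 hj).nsmul q)
    refine ⟨w' * D.s c, ?_, ?_⟩
    · rw [altWord, ← hc, wordProd_cons, ← mul_assoc, mul_s_mul_s, h1]
    · rw [h2, ← h.length_mul_s_of_not_isQPos h4]; ring

theorem two_le_coxeterOrder {i j : I} (hij : i ≠ j) : 2 ≤ D.coxeterOrder i j := by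
  rcases h.coxeterOrder_cases hij with hc | hc | hc | hc | hc | hc <;> omega

/-- Matsumoto's theorem. -/
theorem prod_map_eq_of_reduced {M : Type*} [Monoid M] (f : I → M)
    (hf : ∀ i j, i ≠ j → ((altWord i j (D.coxeterOrder i j)).map f).prod =
      ((altWord j i (D.coxeterOrder i j)).map f).prod) (l l' : List I)
    (hl : l.length = D.length (D.wordProd l)) (hl' : l'.length = D.length (D.wordProd l'))
    (e : D.wordProd l = D.wordProd l') : (l.map f).prod = (l'.map f).prod := by
  induction hn : l.length generalizing l l' with
  | zero =>
    have h1 : l'.length = 0 := by rw [hl', ← e, ← hl, hn]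
    rw [List.length_eq_zero_iff.1 hn, List.length_eq_zero_iff.1 h1]
  | succ n ih =>
    have hn' : l'.length = n + 1 := by rw [hl', ← e, ← hl, hn]
    obtain ⟨a, i, rfl⟩ := (List.eq_nil_or_concat l).resolve_left (by rintro rfl; simp at hn)
    obtain ⟨b, j, rfl⟩ := (List.eq_nil_or_concat l').resolve_left (by rintro rfl; simp at hn')
    simp only [List.concat_eq_append, List.length_append, List.length_singleton,
      wordProd_append, wordProd_singleton, List.map_append, List.prod_append, List.map_singleton,
      List.prod_singleton] at *
    have ha : a.length = n := by omega
    have hb : b.length = n := by omega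
    have hal := D.length_le a
    have hbl := D.length_le b
    have hal' := D.length_mul_s_le (D.wordProd a) i
    have hbl' := D.length_mul_s_le (D.wordProd b) j
    have har : a.length = D.length (D.wordProd a) := by omega
    have hbr : b.length = D.length (D.wordProd b) := by omega
    by_cases hij : i = j
    · subst hij
      rw [ih a b har hbr (mul_right_cancel e) ha]
    · have hi : ¬ D.IsQPos (D.act (D.wordProd a * D.s i) (D.simpleRoot i)) := by
        rw [← h.length_lt_iff, mul_s_mul_s]; omega
      have hj : ¬ D.IsQPos (D.act (D.wordProd a * D.s i) (D.simpleRoot j)) := by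
        rw [← h.length_lt_iff, e, mul_s_mul_s]; omega
      -- The two words end in different letters, both of which are descents of the common product.
      -- The product therefore ends in either full alternating word. Each given word is compared,
      -- after its last letter is removed, with a word through `c`, and the two words through `c`
      -- differ by the braid relation.
      obtain ⟨w', h1, h2⟩ := h.exists_mul_altWord hij hi hj le_rfl
      obtain ⟨c, rfl, hc⟩ := D.exists_reduced w'
      obtain ⟨m, hm⟩ : ∃ m, D.coxeterOrder i j = m + 1 :=
        ⟨D.coxeterOrder i j - 1, by have := h.two_le_coxeterOrder hij; omega⟩
      have h3 : D.wordProd b * D.s j = D.wordProd c *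
          D.wordProd (altWord j i (D.coxeterOrder i j)) := by
        rw [← e, h1, h.wordProd_altWord hij]
      have hbraid := hf i j hij
      rw [hm, altWord_succ, wordProd_append, wordProd_singleton, ← mul_assoc] at h1 h3
      rw [hm, altWord_succ, altWord_succ] at hbraid
      have h1' := mul_right_cancel h1
      have h3' := mul_right_cancel h3
      have e1 := ih a (c ++ altWord j i m) har
        (by rw [wordProd_append, ← h1', ← har, List.length_append, length_altWord]; omega)
        (by rw [wordProd_append, h1']) ha
      have e2 := ih b (c ++ altWord i j m) hbr
        (by rw [wordProd_append, ← h3', ← hbr, List.length_append, length_altWord]; omega)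
        (by rw [wordProd_append, h3']) hb
      rw [e1, e2]
      simp only [List.map_append, List.prod_append, List.map_singleton, List.prod_singleton]
        at hbraid ⊢
      rw [mul_assoc, hbraid, ← mul_assoc]

end FiniteType

end QDatum

end

/-! ### Convergent series: supports, separated filtration, inversion. -/

noncomputable section

namespace QDatum

set_option linter.unusedSectionVars false

variable {I : Type*} [Fintype I] [DecidableEq I] (D : QDatum I)

/-! ### Supports of convergent series -/

section Series

variable {G : Type*} [AddCommGroup G] (wt : G →+ Wt I) (v : D.W)

/-- The weight of a monomial, transformed by `v`. -/
def vwt : D.Graded wt v →+ Wt I :=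
  AddMonoidHom.mk' (fun x => D.act v (wt ((D.gr wt v).symm x))) fun x y => by
    simp only [map_add, act_add]

theorem vwt_gr (x : G) : D.vwt wt v (D.gr wt v x) = D.act v (wt x) := rfl

/-- The level of a monomial: the opposite of the height of its transformed weight. -/
def lev : D.Graded wt v →+ ℚ := -(D.ht.comp (D.vwt wt v))

theorem lev_apply (x : D.Graded wt v) : D.lev wt v x = -D.ht (D.vwt wt v x) := rfl

variable {D wt v}

theorem FiniteType.graded_le_iff' (h : D.FiniteType) (x y : D.Graded wt v) :
    x ≤ y ↔ x = y ∨ (D.wle (D.vwt wt v y) (D.vwt wt v x) ∧ D.vwt wt v x ≠ D.vwt wt v y) := by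
  rw [graded_le_iff, h.wlt_iff]
  refine or_congr_right (and_congr_right fun _ => ?_)
  exact not_congr (eq_comm.trans (D.act_injective v).eq_iff.symm)

theorem FiniteType.wle_of_le (h : D.FiniteType) {x y : D.Graded wt v} (hxy : x ≤ y) :
    D.wle (D.vwt wt v y) (D.vwt wt v x) := by
  rcases (h.graded_le_iff' x y).1 hxy with rfl | hlt
  · exact D.wle_refl _
  · exact hlt.1

theorem FiniteType.lev_le_of_wle (h : D.FiniteType) {x y : Wt I} (hxy : D.wle y x) :
    -D.ht x ≤ -D.ht y := by
  have := h.ht_nonneg hxy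
  rw [map_sub] at this
  linarith

/-- The condition of convergence for a set of monomials. -/
def Conv (S : Set (D.Graded wt v)) : Prop :=
  (∃ L : Set (Wt I), L.Finite ∧ ∀ x ∈ S, ∃ l ∈ L, D.wle (D.vwt wt v x) l) ∧
    ∀ c : ℚ, {x ∈ S | D.lev wt v x ≤ c}.Finite

/-- By Dickson's lemma a sequence of monomials under finitely many cones has a subsequence under one
apex along which the Q^+-coefficients weakly increase. Either the weight drops strictly somewhere,
which is a comparable pair, or it is constant, and finiteness at a bounded level forces a
repetition. -/
theorem FiniteType.isPWO_of_conv (h : D.FiniteType) {S : Set (D.Graded wt v)} (hS : Conv S) :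
    S.IsPWO := by
  obtain ⟨⟨L, hL, hSL⟩, hfin⟩ := hS
  refine Set.partiallyWellOrderedOn_iff_exists_lt.2 fun f hf => ?_
  choose l hl n hn using fun k => hSL (f k) (hf k)
  have hp : (L ×ˢ (Set.univ : Set (I → ℕ))).PartiallyWellOrderedOn
      fun a b => a.1 = b.1 ∧ a.2 ≤ b.2 :=
    Set.PartiallyWellOrderedOn.prod (r := (· = ·)) (hL.partiallyWellOrderedOn)
      (show (Set.univ : Set (I → ℕ)).IsPWO by
        have := Set.IsPWO.pi (fun _ : I => Set.isPWO_of_wellQuasiOrderedLE (Set.univ : Set ℕ))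
        rwa [Set.pi_univ] at this)
  have : IsPreorder (Wt I × (I → ℕ)) fun a b => a.1 = b.1 ∧ a.2 ≤ b.2 :=
    { refl := fun a => ⟨rfl, le_rfl⟩
      trans := fun a b c hab hbc => ⟨hab.1.trans hbc.1, hab.2.trans hbc.2⟩ }
  obtain ⟨g, hg⟩ := hp.exists_monotone_subseq (f := fun k => (l k, n k))
    fun k => ⟨hl k, Set.mem_univ _⟩
  have hw : ∀ a b, a ≤ b → D.wle (D.vwt wt v (f (g b))) (D.vwt wt v (f (g a))) := by
    intro a b hab
    obtain ⟨h1, h2⟩ := hg a b hab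
    refine ⟨n (g b) - n (g a), ?_⟩
    have h3 : n (g b) = (n (g b) - n (g a)) + n (g a) := (tsub_add_cancel_of_le h2).symm
    have h4 := hn (g b)
    rw [h3] at h4
    simp only [Pi.add_apply, add_smul, Finset.sum_add_distrib] at h4
    rw [← hn (g a)] at h4
    simp only at h1
    rw [h1] at h4
    have := eq_sub_of_add_eq h4.symm
    rw [this]; abel
  by_cases hc : ∃ a b, a < b ∧ D.vwt wt v (f (g a)) ≠ D.vwt wt v (f (g b))
  · obtain ⟨a, b, hab, hne⟩ := hc
    exact ⟨g a, g b, g.strictMono hab,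
      (h.graded_le_iff' _ _).2 (Or.inr ⟨hw a b hab.le, hne⟩)⟩
  · push Not at hc
    have hconst : ∀ a, D.vwt wt v (f (g a)) = D.vwt wt v (f (g 0)) := by
      intro a
      rcases Nat.eq_zero_or_pos a with rfl | ha
      · rfl
      · exact (hc 0 a ha).symm
    have hmem : ∀ a, f (g a) ∈ {x ∈ S | D.lev wt v x ≤ D.lev wt v (f (g 0))} := fun a =>
      ⟨hf _, by rw [lev_apply, lev_apply, hconst a]⟩
    obtain ⟨a, b, hab, heq⟩ := (hfin (D.lev wt v (f (g 0)))).exists_lt_map_eq_of_forall_mem hmem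
    exact ⟨g a, g b, g.strictMono hab, heq.le⟩

/-- Antichains in a partially well-ordered set are finite. Applied to the minimal elements this
gives the apexes of the cones, and applied to the monomials of a fixed weight it gives finiteness in
each weight. Only finitely many weights under the cones have bounded level. -/
theorem FiniteType.conv_of_isPWO (h : D.FiniteType) {S : Set (D.Graded wt v)} (hS : S.IsPWO) :
    Conv S := by
  have hM : {x | Minimal (· ∈ S) x}.Finite :=
    IsAntichain.finite_of_partiallyWellOrderedOn (setOfPred_minimal_antichain _)
      (hS.mono fun x hx => hx.1)
  have h1 : ∃ L : Set (Wt I), L.Finite ∧ ∀ x ∈ S, ∃ l ∈ L, D.wle (D.vwt wt v x) l := by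
    refine ⟨_, hM.image (D.vwt wt v), fun x hx => ?_⟩
    obtain ⟨y, hyx, hy⟩ := hS.exists_le_minimal hx
    exact ⟨_, ⟨y, hy, rfl⟩, h.wle_of_le hyx⟩
  refine ⟨h1, fun c => ?_⟩
  obtain ⟨L, hL, hSL⟩ := h1
  have hW : ((⋃ l ∈ L, (fun b => l - b) '' {b | D.IsQPos b ∧ D.ht b ≤ c + D.ht l})).Finite :=
    hL.biUnion fun l _ => (h.finite_isQPos_ht_le _).image _
  refine (hW.biUnion (t := fun μ => {x ∈ S | D.vwt wt v x = μ}) fun μ _ => ?_).subset ?_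
  · refine IsAntichain.finite_of_partiallyWellOrderedOn (r := (· ≤ ·)) ?_
      (hS.mono fun x hx => hx.1)
    intro x hx y hy hne hxy
    rcases (h.graded_le_iff' x y).1 hxy with he | ⟨_, hlt⟩
    · exact hne he
    · exact hlt (hx.2.trans hy.2.symm)
  · rintro x ⟨hx, hxc⟩
    obtain ⟨l, hl, hxl⟩ := hSL x hx
    refine Set.mem_biUnion (Set.mem_biUnion hl ⟨l - D.vwt wt v x, ⟨hxl, ?_⟩, sub_sub_cancel l _⟩)
      ⟨hx, rfl⟩
    rw [lev_apply] at hxc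
    rw [map_sub]; linarith

/-! ### The filtration by levels -/

/-- All monomials of `f` have level at least `c`. -/
def LevGe (c : ℚ) (f : HahnSeries (D.Graded wt v) ℤ) : Prop :=
  ∀ x, f.coeff x ≠ 0 → c ≤ D.lev wt v x

/-- All monomials of `f` have transformed weight at most `l`. -/
def Below (l : Wt I) (f : HahnSeries (D.Graded wt v) ℤ) : Prop :=
  ∀ x, f.coeff x ≠ 0 → D.wle (D.vwt wt v x) l

section

variable {f g : HahnSeries (D.Graded wt v) ℤ} {c c' : ℚ} {l l' : Wt I}

theorem LevGe.zero : LevGe c (0 : HahnSeries (D.Graded wt v) ℤ) := fun _ hx => absurd rfl hx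

theorem LevGe.mono (hf : LevGe c f) (hc : c' ≤ c) : LevGe c' f := fun x hx => hc.trans (hf x hx)

theorem LevGe.add (hf : LevGe c f) (hg : LevGe c g) : LevGe c (f + g) := by
  intro x hx
  rw [HahnSeries.coeff_add] at hx
  by_cases h1 : f.coeff x = 0
  · exact hg x fun h2 => hx (by rw [h1, h2, add_zero])
  · exact hf x h1

theorem LevGe.neg (hf : LevGe c f) : LevGe c (-f) := by
  intro x hx
  rw [HahnSeries.coeff_neg] at hx
  exact hf x (neg_ne_zero.1 hx)

theorem LevGe.sub (hf : LevGe c f) (hg : LevGe c g) : LevGe c (f - g) := by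
  rw [sub_eq_add_neg]; exact hf.add hg.neg

theorem LevGe.mul (hf : LevGe c f) (hg : LevGe c' g) : LevGe (c + c') (f * g) := by
  intro x hx
  obtain ⟨y, hy, z, hz, rfl⟩ := HahnSeries.support_mul_subset (Function.mem_support.2 hx)
  rw [map_add]
  exact add_le_add (hf y hy) (hg z hz)

theorem LevGe.sum {ι : Type*} {s : Finset ι} {F : ι → HahnSeries (D.Graded wt v) ℤ}
    (hF : ∀ k ∈ s, LevGe c (F k)) : LevGe c (∑ k ∈ s, F k) :=
  Finset.sum_induction F (LevGe c) (fun _ _ => LevGe.add) LevGe.zero hF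

theorem LevGe.single {x : D.Graded wt v} {r : ℤ} (hx : c ≤ D.lev wt v x) :
    LevGe c (HahnSeries.single x r) := by
  intro y hy
  rw [HahnSeries.eq_of_mem_support_single (Function.mem_support.2 hy)]
  exact hx

/-- The filtration is separated, since every monomial has a finite level. Identities of series are
proved below by showing that a difference has arbitrarily high level. -/
theorem eq_zero_of_levGe (hf : ∀ n : ℕ, LevGe (c + n) f) : f = 0 := by
  ext x
  by_contra hx
  obtain ⟨n, hn⟩ := exists_nat_gt (D.lev wt v x - c)
  have := hf n x hx
  linarith

theorem Below.neg (hf : Below l f) : Below l (-f) := by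
  intro x hx
  rw [HahnSeries.coeff_neg] at hx
  exact hf x (neg_ne_zero.1 hx)

theorem wle_add {a b a' b' : Wt I} (h1 : D.wle a a') (h2 : D.wle b b') :
    D.wle (a + b) (a' + b') := by
  rw [wle_iff, add_sub_add_comm]; exact IsQPos.add h1 h2

theorem Below.mul (hf : Below l f) (hg : Below l' g) : Below (l + l') (f * g) := by
  intro x hx
  obtain ⟨y, hy, z, hz, rfl⟩ := HahnSeries.support_mul_subset (Function.mem_support.2 hx)
  rw [map_add]
  exact wle_add (hf y hy) (hg z hz)

theorem Below.single {x : D.Graded wt v} {r : ℤ} (hx : D.wle (D.vwt wt v x) l) :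
    Below l (HahnSeries.single x r) := by
  intro y hy
  rw [HahnSeries.eq_of_mem_support_single (Function.mem_support.2 hy)]
  exact hx

theorem FiniteType.exists_levGe (h : D.FiniteType) (f : HahnSeries (D.Graded wt v) ℤ) :
    ∃ c, LevGe c f := by
  obtain ⟨⟨L, hL, hSL⟩, -⟩ := h.conv_of_isPWO f.isPWO_support
  obtain ⟨c, hc⟩ := (hL.image fun l => -D.ht l).bddBelow
  refine ⟨c, fun x hx => ?_⟩
  obtain ⟨l, hl, hxl⟩ := hSL x hx
  exact (hc ⟨l, hl, rfl⟩).trans (h.lev_le_of_wle hxl)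

/-- Up to terms of high level, a series is a finite sum of its terms. -/
theorem FiniteType.exists_truncation (h : D.FiniteType) (f : HahnSeries (D.Graded wt v) ℤ)
    (c : ℚ) : ∃ S : Finset (D.Graded wt v), (∀ x ∈ S, f.coeff x ≠ 0) ∧
      LevGe c (f - ∑ x ∈ S, HahnSeries.single x (f.coeff x)) := by
  classical
  have hfin := (h.conv_of_isPWO f.isPWO_support).2 c
  refine ⟨hfin.toFinset, fun x hx => (hfin.mem_toFinset.1 hx).1, fun x hx => ?_⟩
  by_contra hlt
  refine hx ?_
  rw [HahnSeries.coeff_sub, HahnSeries.coeff_sum, sub_eq_zero]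
  by_cases h0 : f.coeff x = 0
  · rw [h0, Finset.sum_eq_zero]
    intro y hy
    by_cases hyx : x = y
    · subst hyx; rw [h0]; simp
    · exact HahnSeries.coeff_single_of_ne hyx
  · rw [Finset.sum_eq_single x]
    · simp
    · intro y _ hyx
      exact HahnSeries.coeff_single_of_ne hyx.symm
    · intro hx'
      exact absurd (hfin.mem_toFinset.2 ⟨h0, (not_le.1 hlt).le⟩) hx'

end

/-! ### Series with leading term `1` -/

/-- `f` is `1` plus a combination of smaller monomials. -/
def IsOneAdd (f : HahnSeries (D.Graded wt v) ℤ) : Prop :=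
  f.coeff 0 = 1 ∧ ∀ x, f.coeff x ≠ 0 → 0 ≤ x

theorem FiniteType.one_le_lev (h : D.FiniteType) {x : D.Graded wt v} (hx : 0 ≤ x) (h0 : x ≠ 0) :
    1 ≤ D.lev wt v x := by
  rcases (h.graded_le_iff' 0 x).1 hx with rfl | ⟨h1, h2⟩
  · exact absurd rfl h0
  · rw [map_zero] at h1 h2
    rw [lev_apply, ← map_neg]
    rw [wle_iff, zero_sub] at h1
    exact h.one_le_ht h1 (neg_ne_zero.2 h2.symm)

theorem IsOneAdd.one : IsOneAdd (1 : HahnSeries (D.Graded wt v) ℤ) := by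
  classical
  refine ⟨by simp [HahnSeries.coeff_one], fun x hx => ?_⟩
  rw [HahnSeries.coeff_one] at hx
  split_ifs at hx with h0
  · exact h0.symm.le
  · exact absurd rfl hx

theorem FiniteType.isOneAdd_of_below (h : D.FiniteType) {f : HahnSeries (D.Graded wt v) ℤ}
    {b : Wt I} (hb : D.IsQPos b) (hb0 : b ≠ 0) (hf : Below (-b) f) : IsOneAdd (1 + f) := by
  classical
  have hneg : ∀ x, f.coeff x ≠ 0 → D.IsQPos (-D.vwt wt v x) ∧ D.vwt wt v x ≠ 0 := by
    intro x hx
    have h1 := hf x hx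
    rw [wle_iff] at h1
    have h2 : -D.vwt wt v x = (-b - D.vwt wt v x) + b := by abel
    refine ⟨h2 ▸ IsQPos.add h1 hb, fun h3 => hb0 ?_⟩
    rw [h3, sub_zero] at h1
    exact h.eq_zero_of_isQPos_neg hb h1
  constructor
  · rw [HahnSeries.coeff_add, HahnSeries.coeff_one, if_pos rfl]
    by_contra hne
    exact (hneg 0 fun h0 => hne (by rw [h0, add_zero])).2 (map_zero _)
  · intro x hx
    rw [HahnSeries.coeff_add, HahnSeries.coeff_one] at hx
    by_cases h0 : x = 0
    · exact h0.symm.le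
    · rw [if_neg h0, zero_add] at hx
      refine (h.graded_le_iff' 0 x).2 (Or.inr ?_)
      rw [map_zero, wle_iff, zero_sub]
      exact ⟨(hneg x hx).1, (hneg x hx).2.symm⟩

theorem IsOneAdd.mul {f g : HahnSeries (D.Graded wt v) ℤ} (hf : IsOneAdd f) (hg : IsOneAdd g) :
    IsOneAdd (f * g) := by
  classical
  constructor
  · rw [HahnSeries.coeff_mul, Finset.sum_eq_single (0, 0)]
    · rw [hf.1, hg.1, one_mul]
    · rintro ⟨x, y⟩ hxy hne
      obtain ⟨hx, hy, hxy⟩ := Finset.mem_antidiagonal.1 hxy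
      have hx0 := hf.2 x hx
      have hy0 := hg.2 y hy
      refine absurd ?_ hne
      have h1 : x ≤ 0 := by
        calc x ≤ x + y := le_add_of_nonneg_right hy0
          _ = 0 := hxy
      have h2 := le_antisymm h1 hx0
      simp only at hxy
      rw [h2, zero_add] at hxy
      rw [h2, hxy]
    · intro hn
      by_contra hne
      refine hn (Finset.mem_antidiagonal.2 ⟨?_, ?_, add_zero _⟩)
      · exact left_ne_zero_of_mul hne
      · exact right_ne_zero_of_mul hne
  · intro x hx
    obtain ⟨y, hy, z, hz, rfl⟩ := HahnSeries.support_mul_subset (Function.mem_support.2 hx)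
    exact add_nonneg (hf.2 y hy) (hg.2 z hz)

theorem FiniteType.levGe_sub_one (h : D.FiniteType) {f : HahnSeries (D.Graded wt v) ℤ}
    (hf : IsOneAdd f) : LevGe 1 (f - 1) ∧ ∀ x, (f - 1).coeff x ≠ 0 → 0 ≤ x := by
  classical
  have key : ∀ x, (f - 1).coeff x ≠ 0 → f.coeff x ≠ 0 ∧ x ≠ 0 := by
    intro x hx
    rw [HahnSeries.coeff_sub, HahnSeries.coeff_one] at hx
    by_cases h0 : x = 0
    · rw [if_pos h0, h0, hf.1, sub_self] at hx; exact absurd rfl hx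
    · rw [if_neg h0, sub_zero] at hx; exact ⟨hx, h0⟩
  exact ⟨fun x hx => h.one_le_lev (hf.2 x (key x hx).1) (key x hx).2,
    fun x hx => hf.2 x (key x hx).1⟩

/-- Geometric series in n = 1 - f. Since n^k has level at least k, each coefficient of the series is
a finite sum, and all supports lie in the submonoid generated by the support of n, which is
partially well-ordered. -/
theorem FiniteType.exists_inverse (h : D.FiniteType) {f : HahnSeries (D.Graded wt v) ℤ}
    (hf : IsOneAdd f) : ∃ g, IsOneAdd g ∧ f * g = 1 := by
  classical
  obtain ⟨hlev, hpos⟩ := h.levGe_sub_one hf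
  set n := 1 - f with hn
  have hnf : f = 1 - n := by rw [hn]; ring
  have hlevn : LevGe 1 n := by
    have := hlev.neg
    rwa [neg_sub] at this
  have hposn : ∀ x, n.coeff x ≠ 0 → 0 ≤ x := by
    intro x hx
    refine hpos x fun h0 => hx ?_
    rw [hn, ← neg_sub, HahnSeries.coeff_neg, h0, neg_zero]
  have hpow : ∀ k : ℕ, LevGe (k : ℚ) (n ^ k) := by
    intro k
    induction k with
    | zero => rw [pow_zero, ← HahnSeries.single_zero_one]; exact LevGe.single (by simp)
    | succ k ih => rw [pow_succ, Nat.cast_succ]; exact ih.mul hlevn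
  let S : Set (D.Graded wt v) := (AddSubmonoid.closure n.support : AddSubmonoid (D.Graded wt v))
  have hSpwo : S.IsPWO := Set.IsPWO.addSubmonoid_closure (fun x hx => hposn x hx) n.isPWO_support
  have hsub : ∀ k x, (n ^ k).coeff x ≠ 0 → x ∈ S := fun k x hx =>
    HahnSeries.SummableFamily.support_pow_subset_closure n k (Function.mem_support.2 hx)
  -- `N x` exceeds the level of x, so the powers from `N x` on do not involve x.
  let N : D.Graded wt v → ℕ := fun x => ⌈D.lev wt v x⌉₊ + 1
  have hN : ∀ x k, N x ≤ k → (n ^ k).coeff x = 0 := by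
    intro x k hk
    by_contra hne
    have h1 := hpow k x hne
    have h2 : D.lev wt v x < N x := by
      refine (Nat.le_ceil _).trans_lt ?_
      exact_mod_cast Nat.lt_succ_self _
    have h3 : (N x : ℚ) ≤ k := by exact_mod_cast hk
    linarith
  let g : HahnSeries (D.Graded wt v) ℤ :=
    ⟨fun x => ∑ k ∈ Finset.range (N x), (n ^ k).coeff x, hSpwo.mono fun x hx => by
      obtain ⟨k, _, hk⟩ := Finset.exists_ne_zero_of_sum_ne_zero (Function.mem_support.1 hx)
      exact hsub k x hk⟩
  have hg : ∀ K : ℕ, LevGe (K : ℚ) (g - ∑ k ∈ Finset.range K, n ^ k) := by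
    intro K x hx
    by_contra hlt
    refine hx ?_
    rw [HahnSeries.coeff_sub, HahnSeries.coeff_sum, sub_eq_zero]
    change ∑ k ∈ Finset.range (N x), (n ^ k).coeff x = _
    refine Finset.sum_congr_of_eq_on_inter (fun k _ hk => ?_) (fun k _ hk => ?_)
      fun k _ _ => rfl
    · by_contra hne
      have h1 : (K : ℚ) ≤ k := by
        simpa using hk
      exact hlt (h1.trans (hpow k x hne))
    · exact hN x k (by simpa using hk)
  have hmul : f * g = 1 := by
    refine sub_eq_zero.1 (eq_zero_of_levGe (c := 0) fun K => ?_)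
    have hl : LevGe (0 : ℚ) f := by
      intro x hx
      by_cases h0 : x = 0
      · rw [h0, map_zero]
      · exact zero_le_one.trans (h.one_le_lev (hf.2 x hx) h0)
    have h1 : f * g - 1 = f * (g - ∑ k ∈ Finset.range K, n ^ k) - n ^ K := by
      have h2 : (1 - n) * ∑ k ∈ Finset.range K, n ^ k = 1 - n ^ K := mul_neg_geom_sum n K
      rw [mul_sub, hnf, h2]; ring
    rw [h1]
    refine (hl.mul (hg K)).sub ?_
    rw [zero_add]; exact hpow K
  refine ⟨g, ⟨?_, fun x hx => ?_⟩, hmul⟩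
  · change ∑ k ∈ Finset.range (N 0), (n ^ k).coeff 0 = 1
    rw [Finset.sum_eq_single 0]
    · simp
    · intro k _ hk
      by_contra hne
      have := hpow k 0 hne
      rw [map_zero] at this
      exact hk (by exact_mod_cast le_antisymm this (Nat.cast_nonneg k))
    · intro h0; simp [N] at h0
  · obtain ⟨k, _, hk⟩ := Finset.exists_ne_zero_of_sum_ne_zero (show ∑ k ∈ Finset.range (N x),
      (n ^ k).coeff x ≠ 0 from hx)
    have := hsub k x hk
    have hle : AddSubmonoid.closure n.support ≤ AddSubmonoid.nonneg (D.Graded wt v) :=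
      AddSubmonoid.closure_le.2 fun y hy => hposn y hy
    exact hle this

theorem FiniteType.isOneAdd_of_mul_eq_one (h : D.FiniteType)
    {f g : HahnSeries (D.Graded wt v) ℤ} (hf : IsOneAdd f) (hfg : f * g = 1) : IsOneAdd g := by
  obtain ⟨g', hg', hfg'⟩ := h.exists_inverse hf
  have : g = g' := by
    calc g = g * (f * g') := by rw [hfg', mul_one]
      _ = (f * g) * g' := by ring
      _ = g' := by rw [hfg, one_mul]
  rw [this]; exact hg'

theorem FiniteType.isUnit_of_isOneAdd (h : D.FiniteType) {f : HahnSeries (D.Graded wt v) ℤ}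
    (hf : IsOneAdd f) : IsUnit f := by
  obtain ⟨g, _, hg⟩ := h.exists_inverse hf
  exact IsUnit.of_mul_eq_one g hg

end Series

end QDatum

end

/-! ### Extending multiplicative maps from monomials to convergent series. -/

noncomputable section

namespace QDatum

set_option linter.unusedSectionVars false

variable {I : Type*} [Fintype I] [DecidableEq I] {D : QDatum I}

/-! ### Continuous homomorphisms given on monomials -/

section Extension

variable {G G' : Type*} [AddCommGroup G] [AddCommGroup G'] {wt : G →+ Wt I} {v : D.W}
  {wt' : G' →+ Wt I} {v' : D.W}

/-- A multiplicative family of series, indexed by monomials, which does not raise weights. -/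
structure IsKernel (wt : G →+ Wt I) (v : D.W)
    (K : G → HahnSeries (D.Graded wt' v') ℤ) : Prop where
  zero : K 0 = 1
  add : ∀ x y, K (x + y) = K x * K y
  below : ∀ x, Below (D.act v (wt x)) (K x)

/-- The continuous linear extension of a family of series indexed by monomials. -/
def ext (K : G → HahnSeries (D.Graded wt' v') ℤ) (f : HahnSeries (D.Graded wt v) ℤ) :
    HahnSeries (D.Graded wt' v') ℤ :=
  D.ofCoeff wt' v' fun y => ∑ᶠ x : G, f.coeff (D.gr wt v x) * (K x).coeff y

theorem exists_of_finsum_ne_zero {α M : Type*} [AddCommMonoid M] {f : α → M}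
    (hf : ∑ᶠ x, f x ≠ 0) : ∃ x, f x ≠ 0 := by
  by_contra! h0
  exact hf (by simp [h0])

variable {K : G → HahnSeries (D.Graded wt' v') ℤ}

theorem IsKernel.lev_le (h : D.FiniteType) (hK : IsKernel wt v K) {x : G}
    {y : D.Graded wt' v'} (hy : (K x).coeff y ≠ 0) :
    D.lev wt v (D.gr wt v x) ≤ D.lev wt' v' y :=
  h.lev_le_of_wle (hK.below x y hy)

/-- Since `K x` has no term below the level of x, only the finitely many x of level at most that of
y can contribute at y. -/
theorem IsKernel.finite_support (h : D.FiniteType) (hK : IsKernel wt v K)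
    (f : HahnSeries (D.Graded wt v) ℤ) (y : D.Graded wt' v') :
    (Function.support fun x : G => f.coeff (D.gr wt v x) * (K x).coeff y).Finite := by
  refine Set.Finite.of_finite_image (f := D.gr wt v) ?_ (D.gr wt v).injective.injOn
  refine ((h.conv_of_isPWO f.isPWO_support).2 (D.lev wt' v' y)).subset ?_
  rintro _ ⟨x, hx, rfl⟩
  exact ⟨left_ne_zero_of_mul hx, hK.lev_le h (right_ne_zero_of_mul hx)⟩

/-- `ofCoeff` returns 0 on divergent data, so the content is convergence. Terms of the image up to
level c come from terms of f up to level c, of which there are finitely many, and each contributes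
finitely many. -/
theorem IsKernel.coeff_ext (h : D.FiniteType) (hK : IsKernel wt v K)
    (f : HahnSeries (D.Graded wt v) ℤ) (y : D.Graded wt' v') :
    (ext K f).coeff y = ∑ᶠ x : G, f.coeff (D.gr wt v x) * (K x).coeff y := by
  have hf := h.conv_of_isPWO f.isPWO_support
  have key : ∀ y, (∑ᶠ x : G, f.coeff (D.gr wt v x) * (K x).coeff y) ≠ 0 →
      ∃ x : D.Graded wt v, f.coeff x ≠ 0 ∧ (K ((D.gr wt v).symm x)).coeff y ≠ 0 := by
    intro y hy
    obtain ⟨x, hx⟩ := exists_of_finsum_ne_zero hy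
    exact ⟨D.gr wt v x, left_ne_zero_of_mul hx, right_ne_zero_of_mul hx⟩
  have hconv : (Function.support fun y : D.Graded wt' v' =>
      ∑ᶠ x : G, f.coeff (D.gr wt v x) * (K x).coeff y).IsPWO := by
    refine h.isPWO_of_conv ⟨?_, fun c => ?_⟩
    · obtain ⟨L, hL, hfL⟩ := hf.1
      refine ⟨L, hL, fun y hy => ?_⟩
      obtain ⟨x, hx, hxy⟩ := key y hy
      obtain ⟨l, hl, hxl⟩ := hfL x hx
      exact ⟨l, hl, D.wle_trans (hK.below _ y hxy) hxl⟩
    · refine ((hf.2 c).biUnion (t := fun x => {y ∈ (K ((D.gr wt v).symm x)).support |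
        D.lev wt' v' y ≤ c}) fun x _ => (h.conv_of_isPWO (HahnSeries.isPWO_support _)).2 c).subset ?_
      rintro y ⟨hy, hyc⟩
      obtain ⟨x, hx, hxy⟩ := key y hy
      exact Set.mem_biUnion ⟨hx, (hK.lev_le h hxy).trans hyc⟩ ⟨hxy, hyc⟩
  rw [ext, ofCoeff, dif_pos hconv]

theorem IsKernel.exists_of_coeff_ext (h : D.FiniteType) (hK : IsKernel wt v K)
    {f : HahnSeries (D.Graded wt v) ℤ} {y : D.Graded wt' v'} (hy : (ext K f).coeff y ≠ 0) :
    ∃ x : D.Graded wt v, f.coeff x ≠ 0 ∧ (K ((D.gr wt v).symm x)).coeff y ≠ 0 := by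
  rw [hK.coeff_ext h] at hy
  obtain ⟨x, hx⟩ := exists_of_finsum_ne_zero hy
  exact ⟨D.gr wt v x, left_ne_zero_of_mul hx, right_ne_zero_of_mul hx⟩

theorem IsKernel.ext_levGe (h : D.FiniteType) (hK : IsKernel wt v K)
    {f : HahnSeries (D.Graded wt v) ℤ} {c : ℚ} (hf : LevGe c f) : LevGe c (ext K f) := by
  intro y hy
  obtain ⟨x, hx, hxy⟩ := hK.exists_of_coeff_ext h hy
  exact (hf x hx).trans (hK.lev_le h hxy)

theorem IsKernel.ext_below (h : D.FiniteType) (hK : IsKernel wt v K)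
    {f : HahnSeries (D.Graded wt v) ℤ} {l : Wt I} (hf : Below l f) : Below l (ext K f) := by
  intro y hy
  obtain ⟨x, hx, hxy⟩ := hK.exists_of_coeff_ext h hy
  exact D.wle_trans (hK.below _ y hxy) (hf x hx)

theorem IsKernel.ext_add (h : D.FiniteType) (hK : IsKernel wt v K)
    (f g : HahnSeries (D.Graded wt v) ℤ) : ext K (f + g) = ext K f + ext K g := by
  ext y
  rw [HahnSeries.coeff_add, hK.coeff_ext h, hK.coeff_ext h, hK.coeff_ext h,
    ← finsum_add_distrib (hK.finite_support h f y) (hK.finite_support h g y)]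
  exact finsum_congr fun x => by rw [HahnSeries.coeff_add, add_mul]

theorem IsKernel.ext_single (h : D.FiniteType) (hK : IsKernel wt v K) (x : G) (r : ℤ) :
    ext K (HahnSeries.single (D.gr wt v x) r) = r • K x := by
  ext y
  rw [hK.coeff_ext h, finsum_eq_single _ x]
  · rw [HahnSeries.coeff_single_same, HahnSeries.coeff_smul, smul_eq_mul]
  · intro z hz
    rw [HahnSeries.coeff_single_of_ne fun e => hz ((D.gr wt v).injective e), zero_mul]

/-- `ext K` as an additive homomorphism. -/
def IsKernel.extAdd (h : D.FiniteType) (hK : IsKernel wt v K) :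
    HahnSeries (D.Graded wt v) ℤ →+ HahnSeries (D.Graded wt' v') ℤ :=
  AddMonoidHom.mk' (ext K) (hK.ext_add h)

theorem IsKernel.ext_single_mul (h : D.FiniteType) (hK : IsKernel wt v K)
    (x y : D.Graded wt v) (r s : ℤ) :
    hK.extAdd h (HahnSeries.single x r * HahnSeries.single y s) =
      hK.extAdd h (HahnSeries.single x r) * hK.extAdd h (HahnSeries.single y s) := by
  obtain ⟨x, rfl⟩ := (D.gr wt v).surjective x
  obtain ⟨y, rfl⟩ := (D.gr wt v).surjective y
  change ext K _ = ext K _ * ext K _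
  rw [HahnSeries.single_mul_single, ← map_add, hK.ext_single h, hK.ext_single h,
    hK.ext_single h, hK.add, smul_mul_smul_comm]

/-- Multiplicativity is immediate on finite sums. The extension does not lower levels, so f and g
may be replaced by truncations, with errors of arbitrarily high level. -/
theorem IsKernel.ext_mul (h : D.FiniteType) (hK : IsKernel wt v K)
    (f g : HahnSeries (D.Graded wt v) ℤ) : ext K (f * g) = ext K f * ext K g := by
  set T := hK.extAdd h with hT
  have hTlev : ∀ (c : ℚ) (f), LevGe c f → LevGe c (T f) := fun c f hf => hK.ext_levGe h hf
  change T (f * g) = T f * T g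
  obtain ⟨a, ha⟩ := h.exists_levGe f
  obtain ⟨b, hb⟩ := h.exists_levGe g
  refine sub_eq_zero.1 (eq_zero_of_levGe (c := 0) fun n => ?_)
  -- The thresholds n - b and n - a compensate for the lowest levels b of g and a of f, so that both
  -- error products have level at least n.
  obtain ⟨S, hS, hp⟩ := h.exists_truncation f (n - b)
  obtain ⟨S', hS', hq⟩ := h.exists_truncation g (n - a)
  set p := ∑ x ∈ S, HahnSeries.single x (f.coeff x) with hpdef
  set q := ∑ x ∈ S', HahnSeries.single x (g.coeff x) with hqdef
  have hpa : LevGe a p := LevGe.sum fun x hx => LevGe.single (ha x (hS x hx))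
  have hpq : T (p * q) = T p * T q := by
    rw [hpdef, hqdef, Finset.sum_mul_sum, map_sum, map_sum, map_sum, Finset.sum_mul_sum]
    refine Finset.sum_congr rfl fun x _ => ?_
    rw [map_sum]
    exact Finset.sum_congr rfl fun y _ => hK.ext_single_mul h x y _ _
  have e1 : T (f * g) - T f * T g =
      T ((f - p) * g + p * (g - q)) - (T (f - p) * T g + T p * T (g - q)) := by
    have : f * g = ((f - p) * g + p * (g - q)) + p * q := by ring
    rw [this, map_add, hpq, map_sub T f p, map_sub T g q]
    ring
  have e2 : (0 : ℚ) + n = (n - b) + b := by ring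
  have e3 : (0 : ℚ) + n = a + (n - a) := by ring
  rw [e1]
  refine (hTlev _ _ (LevGe.add ?_ ?_)).sub (LevGe.add ?_ ?_)
  · rw [e2]; exact hp.mul hb
  · rw [e3]; exact hpa.mul hq
  · rw [e2]; exact (hTlev _ _ hp).mul (hTlev _ _ hb)
  · rw [e3]; exact (hTlev _ _ hpa).mul (hTlev _ _ hq)

/-- `ext K` as a ring homomorphism. -/
def IsKernel.extHom (h : D.FiniteType) (hK : IsKernel wt v K) :
    HahnSeries (D.Graded wt v) ℤ →+* HahnSeries (D.Graded wt' v') ℤ :=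
  { hK.extAdd h with
    map_one' := by
      change ext K 1 = 1
      rw [← HahnSeries.single_zero_one, ← map_zero (D.gr wt v), hK.ext_single h, hK.zero, one_smul]
    map_mul' := hK.ext_mul h }

end Extension

end QDatum

end

/-! ### Weights of the A_{i,a}, the functional equation of Σ, leading monomials. -/

noncomputable section

namespace QDatum

set_option linter.unusedSectionVars false

variable {I : Type*} [Fintype I] [DecidableEq I] (D : QDatum I)

/-! ### Spectral shifts attached to the entries of the Cartan matrix -/

/-- The spectral shifts attached to an entry of the Cartan matrix. -/
def shifts (c : ℤ) : List ℂˣ :=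
  if c = -1 then [1] else if c = -2 then [D.q⁻¹, D.q] else if c = -3 then
    [(D.q ^ 2)⁻¹, 1, D.q ^ 2] else []

theorem shifts_neg_one : D.shifts (-1) = [1] := by simp [shifts]

theorem shifts_neg_two : D.shifts (-2) = [D.q⁻¹, D.q] := by simp [shifts]

theorem shifts_neg_three : D.shifts (-3) = [(D.q ^ 2)⁻¹, 1, D.q ^ 2] := by simp [shifts]

theorem shifts_zero : D.shifts 0 = [] := by simp [shifts]

theorem shifts_two : D.shifts 2 = [] := by simp [shifts]

/-- Replaces the three filtered sums by one sum over all j; entries other than -1, -2, -3, in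
particular 0 and 2, contribute an empty list. -/
theorem sum_shifts {M : Type*} [AddCommMonoid M] (c : I → ℤ) (X : I → ℂˣ → M) (a : ℂˣ) :
    (∑ j with c j = -1, X j a)
      + (∑ j with c j = -2, (X j (a * D.q⁻¹) + X j (a * D.q)))
      + (∑ j with c j = -3, (X j (a * (D.q ^ 2)⁻¹) + X j a + X j (a * D.q ^ 2)))
    = ∑ j, ((D.shifts (c j)).map fun t => X j (a * t)).sum := by
  rw [Finset.sum_filter, Finset.sum_filter, Finset.sum_filter, ← Finset.sum_add_distrib,
    ← Finset.sum_add_distrib]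
  refine Finset.sum_congr rfl fun j _ => ?_
  by_cases h1 : c j = -1
  · simp [h1, shifts_neg_one]
  by_cases h2 : c j = -2
  · simp [h2, shifts_neg_two]
  by_cases h3 : c j = -3
  · simp [h3, shifts_neg_three, add_assoc]
  · simp [h1, h2, h3, shifts]

/-- The neighbours' contribution to `A_{i,a}`. -/
def nbr (i : I) (a : ℂˣ) : FreeMon I := ∑ j, ((D.shifts (D.C j i)).map fun t => D.Y j (a * t)).sum

theorem A_eq (i : I) (a : ℂˣ) :
    D.A i a = D.Y i (a * (D.qi i)⁻¹) + D.Y i (a * D.qi i) - D.nbr i a := by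
  rw [A, nbr, ← D.sum_shifts (fun j => D.C j i) D.Y a]

theorem phi_Y (i : I) (a : ℂˣ) : D.phi (D.Y i a) = D.fundWt i := by
  simp [phi, Y]

theorem closure_range_Y : AddSubgroup.closure (Set.range fun p : I × ℂˣ => D.Y p.1 p.2) = ⊤ := by
  rw [eq_top_iff]
  intro m _
  induction m using Finsupp.induction_linear with
  | zero => exact zero_mem _
  | add f g hf hg => exact add_mem (hf trivial) (hg trivial)
  | single p n =>
    have : Finsupp.single p n = n • D.Y p.1 p.2 := by simp [Y]
    rw [this]
    exact zsmul_mem (AddSubgroup.subset_closure (Set.mem_range_self p)) n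

theorem freeMon_induction {p : FreeMon I → Prop} (hY : ∀ i a, p (D.Y i a)) (h0 : p 0)
    (hadd : ∀ m n, p m → p n → p (m + n)) (hneg : ∀ m, p m → p (-m)) (m : FreeMon I) : p m := by
  have hm : m ∈ AddSubgroup.closure (Set.range fun p : I × ℂˣ => D.Y p.1 p.2) := by
    rw [closure_range_Y]; trivial
  induction hm using AddSubgroup.closure_induction with
  | mem x hx => obtain ⟨⟨i, a⟩, rfl⟩ := hx; exact hY i a
  | zero => exact h0
  | add x y _ _ hx hy => exact hadd x y hx hy
  | neg x _ hx => exact hneg x hx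

variable {D}

theorem FiniteType.length_shifts (h : D.FiniteType) {i j : I} (hij : i ≠ j) :
    ((D.shifts (D.C i j)).length : ℤ) = -D.C i j := by
  rcases h.cartan i j hij with hc | hc | hc | hc | hc | hc <;> simp [hc.1, shifts]

theorem FiniteType.sum_map_shifts (h : D.FiniteType) {i j : I} (hij : i ≠ j)
    (x : Wt I) : ((D.shifts (D.C j i)).map fun _ => x).sum = (-D.C j i) • x := by
  rw [List.map_const', List.sum_replicate, ← h.length_shifts hij.symm, natCast_zsmul]

theorem FiniteType.phi_nbr (h : D.FiniteType) (i : I) (a : ℂˣ) :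
    D.phi (D.nbr i a) = (2 : ℤ) • D.fundWt i - D.simpleRoot i := by
  have e : D.simpleRoot i = ∑ j, D.C j i • D.fundWt j := D.wt_eq_sum (D.simpleRoot i)
  rw [nbr, map_sum, e]
  rw [← Finset.add_sum_erase _ _ (Finset.mem_univ i),
    ← Finset.add_sum_erase _ (fun j => D.C j i • D.fundWt j) (Finset.mem_univ i), D.C_diag,
    shifts_two]
  simp only [List.map_nil, List.sum_nil, map_zero, zero_add, sub_add_cancel_left]
  rw [← Finset.sum_neg_distrib]
  refine Finset.sum_congr rfl fun j hj => ?_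
  have hij : i ≠ j := (Finset.ne_of_mem_erase hj).symm
  rw [map_list_sum, List.map_map, ← neg_smul, ← h.sum_map_shifts hij]
  congr 1
  exact List.map_congr_left fun t _ => D.phi_Y j _

theorem FiniteType.phi_A (h : D.FiniteType) (i : I) (a : ℂˣ) :
    D.phi (D.A i a) = D.simpleRoot i := by
  rw [A_eq, map_sub, map_add, phi_Y, phi_Y, h.phi_nbr, two_smul]; abel

/-! ### The series `Σ` -/

theorem yMonom_add (u : D.W) (m n : FreeMon I) :
    D.yMonom u (m + n) = D.yMonom u m * D.yMonom u n := by
  rw [yMonom, yMonom, yMonom, HahnSeries.single_mul_single, map_add, one_mul]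

theorem yMonom_zero (u : D.W) : D.yMonom u 0 = 1 := by
  rw [yMonom, map_zero]; rfl

theorem yMonom_mul_neg (u : D.W) (m : FreeMon I) : D.yMonom u m * D.yMonom u (-m) = 1 := by
  rw [← yMonom_add, add_neg_cancel, yMonom_zero]

theorem coeff_yMonom_mul (u : D.W) (m : FreeMon I) (f : D.Ytilde u) (x : D.YMon u) :
    (D.yMonom u m * f).coeff x = f.coeff (x - D.gr D.phi u m) := by
  rw [yMonom, HahnSeries.coeff_single_mul, one_mul]

theorem below_yMonom (u : D.W) (m : FreeMon I) : Below (D.act u (D.phi m)) (D.yMonom u m) :=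
  Below.single (D.wle_refl _)

-- The content is again convergence: the transformed weights descend along multiples of a nonzero b
-- in Q^+. The offset k₀ is 0 for `sigmaMonE`, which starts at 1, and 1 for `sigmaMonS`, which
-- starts with one factor A.
open Classical in
theorem FiniteType.ofCoeff_sequence (h : D.FiniteType) {u : D.W} (m : ℕ → FreeMon I) {b : Wt I}
    (hb : D.IsQPos b) (hb0 : b ≠ 0) (k₀ : ℕ)
    (hm : ∀ k, D.act u (D.phi (m k)) = -((k + k₀) • b)) (r : ℤ) (x : D.YMon u) :
    (D.ofCoeff D.phi u fun x => if ∃ k, x = D.gr D.phi u (m k) then r else 0).coeff x =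
      if ∃ k, x = D.gr D.phi u (m k) then r else 0 := by
  rw [ofCoeff, dif_pos]
  refine (h.isPWO_of_conv (S := Set.range fun k => D.gr D.phi u (m k)) ⟨⟨{0}, Set.finite_singleton 0,
    ?_⟩, fun c => ?_⟩).mono ?_
  · rintro _ ⟨k, rfl⟩
    refine ⟨0, rfl, ?_⟩
    rw [vwt_gr, hm, wle_iff, sub_neg_eq_add, zero_add]
    exact hb.nsmul _
  · obtain ⟨N, hN⟩ := exists_nat_ge c
    refine ((Set.finite_Iic N).image fun k => D.gr D.phi u (m k)).subset ?_
    rintro _ ⟨⟨k, rfl⟩, hk⟩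
    refine ⟨k, ?_, rfl⟩
    simp only at hk
    rw [lev_apply, vwt_gr, hm, map_neg, neg_neg, map_nsmul, nsmul_eq_mul] at hk
    have h1 := h.one_le_ht hb hb0
    have h2 : ((k : ℕ) : ℚ) ≤ N := by
      refine le_trans ?_ (hk.trans hN)
      have h3 : (k : ℚ) ≤ ((k + k₀ : ℕ) : ℚ) := by push_cast; linarith [(Nat.cast_nonneg k₀ : (0:ℚ) ≤ k₀)]
      nlinarith [(Nat.cast_nonneg (k + k₀) : (0 : ℚ) ≤ ((k + k₀ : ℕ) : ℚ))]
    exact_mod_cast h2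
  · intro y hy
    rw [Function.mem_support] at hy
    by_contra hne
    refine hy (if_neg ?_)
    rintro ⟨k, rfl⟩
    exact hne ⟨k, rfl⟩

theorem sigmaMonE_zero (i : I) (a : ℂˣ) : D.sigmaMonE i a 0 = 0 := by
  simp [sigmaMonE]

theorem sigmaMonE_succ (i : I) (a : ℂˣ) (k : ℕ) :
    D.sigmaMonE i a (k + 1) = -D.A i a + D.sigmaMonE i (a * ((D.qi i) ^ 2)⁻¹) k := by
  rw [sigmaMonE, sigmaMonE, Finset.sum_range_succ', neg_add, add_comm]
  congr 1
  · simp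
  · congr 1
    refine Finset.sum_congr rfl fun j _ => ?_
    rw [mul_assoc, ← mul_inv, ← pow_add]
    congr 4
    ring

theorem sigmaMonS_zero (i : I) (a : ℂˣ) : D.sigmaMonS i (a * ((D.qi i) ^ 2)⁻¹) 0 = D.A i a := by
  simp [sigmaMonS]

theorem sigmaMonS_succ (i : I) (a : ℂˣ) (k : ℕ) :
    D.sigmaMonS i (a * ((D.qi i) ^ 2)⁻¹) (k + 1) = D.A i a + D.sigmaMonS i a k := by
  rw [sigmaMonS, sigmaMonS, Finset.sum_range_succ', add_comm]
  congr 1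
  · simp
  · refine Finset.sum_congr rfl fun j _ => ?_
    congr 1
    rw [mul_assoc]
    congr 1
    rw [inv_mul_eq_iff_eq_mul, ← pow_add]
    congr 1
    ring

theorem FiniteType.phi_sigmaMonE (h : D.FiniteType) (i : I) (a : ℂˣ) (k : ℕ) :
    D.phi (D.sigmaMonE i a k) = -(k • D.simpleRoot i) := by
  rw [sigmaMonE, map_neg, map_sum, Finset.sum_congr rfl fun j _ => h.phi_A i _]
  simp

theorem FiniteType.phi_sigmaMonS (h : D.FiniteType) (i : I) (a : ℂˣ) (k : ℕ) :
    D.phi (D.sigmaMonS i a k) = (k + 1) • D.simpleRoot i := by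
  rw [sigmaMonS, map_sum, Finset.sum_congr rfl fun j _ => h.phi_A i _]
  simp

open Classical in
theorem FiniteType.coeff_Sigma_of_pos (h : D.FiniteType) {u : D.W} {i : I}
    (hp : D.IsQPos (D.act u (D.simpleRoot i))) (a : ℂˣ) (x : D.YMon u) :
    (D.Sigma u i a).coeff x = if ∃ k, x = D.gr D.phi u (D.sigmaMonE i a k) then 1 else 0 := by
  rw [Sigma, if_pos (h.length_lt_iff.2 hp)]
  refine h.ofCoeff_sequence _ hp (h.act_simpleRoot_ne_zero u i) 0 (fun k => ?_) 1 x
  rw [h.phi_sigmaMonE, act_neg, act_nsmul, add_zero]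

open Classical in
theorem FiniteType.coeff_Sigma_of_neg (h : D.FiniteType) {u : D.W} {i : I}
    (hp : ¬ D.IsQPos (D.act u (D.simpleRoot i))) (a : ℂˣ) (x : D.YMon u) :
    (D.Sigma u i a).coeff x = if ∃ k, x = D.gr D.phi u (D.sigmaMonS i a k) then -1 else 0 := by
  rw [Sigma, if_neg (mt h.length_lt_iff.1 hp)]
  refine h.ofCoeff_sequence _ ((h.isQPos_neg_iff u i).2 hp)
    (neg_ne_zero.2 (h.act_simpleRoot_ne_zero u i)) 1 (fun k => ?_) (-1) x
  rw [h.phi_sigmaMonS, act_nsmul, smul_neg, neg_neg]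

theorem FiniteType.smul_simpleRoot_ne_zero (h : D.FiniteType) (i : I) (k : ℕ) :
    (k + 1) • D.simpleRoot i ≠ 0 :=
  smul_ne_zero (Nat.succ_ne_zero k) (h.simpleRoot_ne_zero i)

/-- The functional equation of the series `Σ`. -/
theorem FiniteType.Sigma_eq (h : D.FiniteType) (u : D.W) (i : I) (a : ℂˣ) :
    D.Sigma u i a = 1 + D.yMonom u (-D.A i a) * D.Sigma u i (a * ((D.qi i) ^ 2)⁻¹) := by
  classical
  have hsub : ∀ (x : D.YMon u) (m : FreeMon I),
      x - D.gr D.phi u (-D.A i a) = D.gr D.phi u m ↔ x = D.gr D.phi u (-D.A i a + m) := by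
    intro x m
    rw [sub_eq_iff_eq_add', map_add]
  ext x
  rw [HahnSeries.coeff_add, HahnSeries.coeff_one, coeff_yMonom_mul]
  by_cases hp : D.IsQPos (D.act u (D.simpleRoot i))
  · rw [h.coeff_Sigma_of_pos hp, h.coeff_Sigma_of_pos hp]
    simp only [hsub, ← sigmaMonE_succ]
    by_cases h0 : x = 0
    · rw [if_pos ⟨0, by rw [sigmaMonE_zero, map_zero, h0]⟩, if_pos h0, if_neg, add_zero]
      rintro ⟨k, hk⟩
      rw [h0, ← map_zero (D.gr D.phi u)] at hk
      have := congrArg D.phi ((D.gr D.phi u).injective hk)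
      rw [map_zero, h.phi_sigmaMonE] at this
      exact neg_ne_zero.2 (h.smul_simpleRoot_ne_zero i k) this.symm
    · rw [if_neg h0, zero_add]
      refine if_congr ⟨?_, fun ⟨k, hk⟩ => ⟨k + 1, hk⟩⟩ rfl rfl
      rintro ⟨k, hk⟩
      cases k with
      | zero => exact absurd (by rw [hk, sigmaMonE_zero, map_zero]) h0
      | succ k => exact ⟨k, hk⟩
  · rw [h.coeff_Sigma_of_neg hp, h.coeff_Sigma_of_neg hp]
    simp only [hsub]
    by_cases h0 : x = 0
    -- In the expansion in positive powers of A, the constant 1 is cancelled by the k = 0 term of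
    -- A⁻¹Σ, whose coefficient is -1; the left side has no constant term.
    · rw [if_neg, if_pos h0, if_pos ⟨0, by rw [sigmaMonS_zero, h0]; simp⟩]
      · norm_num
      · rintro ⟨k, hk⟩
        rw [h0, ← map_zero (D.gr D.phi u)] at hk
        have := congrArg D.phi ((D.gr D.phi u).injective hk)
        rw [map_zero, h.phi_sigmaMonS] at this
        exact h.smul_simpleRoot_ne_zero i k this.symm
    · rw [if_neg h0, zero_add]
      refine if_congr ⟨?_, ?_⟩ rfl rfl
      · rintro ⟨k, hk⟩
        exact ⟨k + 1, by rw [sigmaMonS_succ, neg_add_cancel_left, hk]⟩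
      · rintro ⟨k, hk⟩
        cases k with
        | zero => exact absurd (by rw [hk, sigmaMonS_zero, neg_add_cancel, map_zero]) h0
        | succ k => exact ⟨k, by rw [hk, sigmaMonS_succ, neg_add_cancel_left]⟩

theorem FiniteType.below_Sigma_of_pos (h : D.FiniteType) {u : D.W} {i : I}
    (hp : D.IsQPos (D.act u (D.simpleRoot i))) (a : ℂˣ) : Below 0 (D.Sigma u i a) := by
  classical
  intro x hx
  rw [h.coeff_Sigma_of_pos hp] at hx
  split_ifs at hx with hk
  · obtain ⟨k, rfl⟩ := hk
    rw [vwt_gr, h.phi_sigmaMonE, act_neg, act_nsmul, wle_iff, sub_neg_eq_add, zero_add]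
    exact hp.nsmul k
  · exact absurd rfl hx

theorem FiniteType.below_Sigma_of_neg (h : D.FiniteType) {u : D.W} {i : I}
    (hp : ¬ D.IsQPos (D.act u (D.simpleRoot i))) (a : ℂˣ) :
    Below (D.act u (D.simpleRoot i)) (D.Sigma u i a) := by
  classical
  intro x hx
  rw [h.coeff_Sigma_of_neg hp] at hx
  split_ifs at hx with hk
  · obtain ⟨k, rfl⟩ := hk
    rw [vwt_gr, h.phi_sigmaMonS, act_nsmul, wle_iff, succ_nsmul]
    have := ((h.isQPos_neg_iff u i).2 hp).nsmul k
    rw [smul_neg] at this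
    convert this using 1
    abel
  · exact absurd rfl hx

/-! ### Series with a monomial leading term -/

/-- `f` is, up to sign, a monomial of transformed weight `l` times a series with leading
term `1`. -/
def HasLead {u : D.W} (l : Wt I) (f : D.Ytilde u) : Prop :=
  ∃ (m : FreeMon I) (r : ℤˣ) (g : D.Ytilde u), IsOneAdd g ∧ D.act u (D.phi m) = l ∧
    f = (r : ℤ) • (D.yMonom u m * g)

theorem HasLead.mul {u : D.W} {l l' : Wt I} {f f' : D.Ytilde u} (hf : HasLead l f)
    (hf' : HasLead l' f') : HasLead (l + l') (f * f') := by
  obtain ⟨m, r, g, hg, hl, rfl⟩ := hf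
  obtain ⟨m', r', g', hg', hl', rfl⟩ := hf'
  refine ⟨m + m', r * r', g * g', hg.mul hg', by rw [map_add, act_add, hl, hl'], ?_⟩
  rw [yMonom_add, smul_mul_smul_comm, Units.val_mul]
  congr 1
  ring

theorem HasLead.exists_inverse (h : D.FiniteType) {u : D.W} {l : Wt I} {f : D.Ytilde u}
    (hf : HasLead l f) : ∃ f', HasLead (-l) f' ∧ f * f' = 1 := by
  obtain ⟨m, r, g, hg, hl, rfl⟩ := hf
  obtain ⟨g', hg', hgg⟩ := h.exists_inverse hg
  refine ⟨_, ⟨-m, r, g', hg', by rw [map_neg, act_neg, hl], rfl⟩, ?_⟩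
  rw [smul_mul_smul_comm, mul_mul_mul_comm, yMonom_mul_neg, hgg, ← Units.val_mul, Int.units_mul_self]
  simp

theorem HasLead.isUnit (h : D.FiniteType) {u : D.W} {l : Wt I} {f : D.Ytilde u}
    (hf : HasLead l f) : IsUnit f := by
  obtain ⟨f', _, h1⟩ := hf.exists_inverse h
  exact IsUnit.of_mul_eq_one f' h1

theorem HasLead.of_mul_eq_one (h : D.FiniteType) {u : D.W} {l : Wt I} {f f' : D.Ytilde u}
    (hf : HasLead l f) (hff : f * f' = 1) : HasLead (-l) f' := by
  obtain ⟨g, hg, hfg⟩ := hf.exists_inverse h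
  have : f' = g := by
    calc f' = f' * (f * g) := by rw [hfg, mul_one]
      _ = (f * f') * g := by ring
      _ = g := by rw [hff, one_mul]
  rw [this]; exact hg

theorem HasLead.inverse (h : D.FiniteType) {u : D.W} {l : Wt I} {f : D.Ytilde u}
    (hf : HasLead l f) : HasLead (-l) (Ring.inverse f) :=
  hf.of_mul_eq_one h (Ring.mul_inverse_cancel f (hf.isUnit h))

theorem IsOneAdd.below (h : D.FiniteType) {u : D.W} {f : D.Ytilde u} (hf : IsOneAdd f) :
    Below 0 f := by
  intro x hx
  have := h.wle_of_le (hf.2 x hx)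
  rwa [map_zero] at this

theorem HasLead.below (h : D.FiniteType) {u : D.W} {l : Wt I} {f : D.Ytilde u}
    (hf : HasLead l f) : Below l f := by
  obtain ⟨m, r, g, hg, hl, rfl⟩ := hf
  intro x hx
  rw [HahnSeries.coeff_smul, smul_eq_mul] at hx
  have := (below_yMonom u m).mul (hg.below h) x (right_ne_zero_of_mul hx)
  rwa [add_zero, hl] at this

theorem hasLead_yMonom (u : D.W) (m : FreeMon I) : HasLead (D.act u (D.phi m)) (D.yMonom u m) :=
  ⟨m, 1, 1, IsOneAdd.one, rfl, by simp⟩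

theorem FiniteType.isOneAdd_Sigma (h : D.FiniteType) {u : D.W} {i : I}
    (hp : D.IsQPos (D.act u (D.simpleRoot i))) (a : ℂˣ) : IsOneAdd (D.Sigma u i a) := by
  rw [h.Sigma_eq]
  refine h.isOneAdd_of_below hp (h.act_simpleRoot_ne_zero u i) ?_
  have := (below_yMonom u (-D.A i a)).mul (h.below_Sigma_of_pos hp (a * ((D.qi i) ^ 2)⁻¹))
  rwa [add_zero, map_neg, h.phi_A, act_neg] at this

-- If u(α_i) < 0, the functional equation at aq_i² reads Σ_a = -A_{aq_i²} (1 - Σ_{aq_i²}), and all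
-- terms of Σ_{aq_i²} have negative transformed weight. Hence the leading monomial is A_{aq_i²},
-- with sign -1.
open Classical in
theorem FiniteType.hasLead_Sigma (h : D.FiniteType) (u : D.W) (i : I) (a : ℂˣ) :
    HasLead (if D.IsQPos (D.act u (D.simpleRoot i)) then 0 else D.act u (D.simpleRoot i))
      (D.Sigma u i a) := by
  split_ifs with hp
  · exact ⟨0, 1, _, h.isOneAdd_Sigma hp a, by rw [map_zero, act_zero], by simp [yMonom_zero]⟩
  · have e := h.Sigma_eq u i (a * (D.qi i) ^ 2)
    rw [mul_inv_cancel_right] at e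
    have hb : IsOneAdd (1 + -D.Sigma u i (a * (D.qi i) ^ 2)) :=
      h.isOneAdd_of_below ((h.isQPos_neg_iff u i).2 hp)
        (neg_ne_zero.2 (h.act_simpleRoot_ne_zero u i)) (by
          rw [neg_neg]; exact (h.below_Sigma_of_neg hp _).neg)
    refine ⟨D.A i (a * (D.qi i) ^ 2), -1, _, hb, by rw [h.phi_A], ?_⟩
    rw [e]
    have h1 := yMonom_mul_neg u (D.A i (a * (D.qi i) ^ 2))
    simp only [Units.val_neg, Units.val_one, neg_smul, one_smul]
    linear_combination (-D.Sigma u i a) * h1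

theorem FiniteType.isUnit_Sigma (h : D.FiniteType) (u : D.W) (i : I) (a : ℂˣ) :
    IsUnit (D.Sigma u i a) := (h.hasLead_Sigma u i a).isUnit h

end QDatum

end

/-! ### The operators Θ_i: multiplicativity and the two-term invariants. -/

noncomputable section

namespace QDatum

set_option linter.unusedSectionVars false

variable {I : Type*} [Fintype I] [DecidableEq I] {D : QDatum I}

/-! ### The operators `Θ_i` as ring homomorphisms -/

theorem zpowUnit_val {R : Type*} [CommRing R] (x : Rˣ) (n : ℤ) : zpowUnit (x : R) n = ↑(x ^ n) := by
  unfold zpowUnit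
  split_ifs with hn
  · lift n to ℕ using hn
    simp
  · obtain ⟨k, rfl⟩ : ∃ k : ℕ, n = -k := ⟨(-n).toNat, by omega⟩
    simp

theorem qi_cube_inv (i : I) (a : ℂˣ) :
    a * (D.qi i)⁻¹ * ((D.qi i) ^ 2)⁻¹ = a * ((D.qi i) ^ 3)⁻¹ := by
  rw [mul_assoc, ← mul_inv, ← pow_succ']

namespace FiniteType

variable (h : D.FiniteType)
include h

/-- The two series Σ in the quotient have leading monomials of equal weight, which cancel. What
remains is u(ω_i - α_i) = us_i(ω_i), whatever the sign of u(α_i). -/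
theorem hasLead_thetaVar (u : D.W) (i : I) (p : I × ℂˣ) :
    HasLead (D.act (u * D.s i) (D.fundWt p.1)) (D.thetaVar u i p) := by
  classical
  unfold thetaVar
  split_ifs with hp
  · have h1 := hasLead_yMonom u (D.Y i p.2 - D.A i (p.2 * (D.qi i)⁻¹))
    have h2 := (h1.mul (h.hasLead_Sigma u i (p.2 * ((D.qi i) ^ 3)⁻¹))).mul
      ((h.hasLead_Sigma u i (p.2 * (D.qi i)⁻¹)).inverse h)
    rw [add_neg_cancel_right, map_sub, phi_Y, h.phi_A] at h2
    rwa [hp, act_mul, act_s_fundWt]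
  · have h1 := hasLead_yMonom u (D.Y p.1 p.2)
    rwa [phi_Y, ← act_s_fundWt_of_ne D hp, ← act_mul] at h1

/-- `Θ_i(Y_{j,a})` as a unit. -/
def thetaUnit (u : D.W) (i : I) (p : I × ℂˣ) : (D.Ytilde u)ˣ :=
  ((h.hasLead_thetaVar u i p).isUnit h).unit

theorem val_thetaUnit (u : D.W) (i : I) (p : I × ℂˣ) :
    (h.thetaUnit u i p : D.Ytilde u) = D.thetaVar u i p := rfl

theorem thetaMon_eq (u : D.W) (i : I) (m : FreeMon I) :
    D.thetaMon u i m = ↑(m.prod fun p n => h.thetaUnit u i p ^ n) := by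
  rw [thetaMon, Finsupp.prod, Units.coe_prod]
  exact Finset.prod_congr rfl fun p _ => by rw [← zpowUnit_val, val_thetaUnit]

theorem thetaMon_zero (u : D.W) (i : I) : D.thetaMon u i 0 = 1 := by
  rw [h.thetaMon_eq, Finsupp.prod_zero_index, Units.val_one]

theorem thetaMon_add (u : D.W) (i : I) (m n : FreeMon I) :
    D.thetaMon u i (m + n) = D.thetaMon u i m * D.thetaMon u i n := by
  rw [h.thetaMon_eq, h.thetaMon_eq, h.thetaMon_eq, ← Units.val_mul,
    Finsupp.prod_add_index' (fun _ => zpow_zero _) (fun _ _ _ => zpow_add _ _ _)]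

theorem thetaMon_Y (u : D.W) (i j : I) (a : ℂˣ) :
    D.thetaMon u i (D.Y j a) = D.thetaVar u i (j, a) := by
  rw [h.thetaMon_eq, Y, Finsupp.prod_single_index (zpow_zero _), zpow_one, val_thetaUnit]

theorem hasLead_thetaMon (u : D.W) (i : I) (m : FreeMon I) :
    HasLead (D.act (u * D.s i) (D.phi m)) (D.thetaMon u i m) := by
  refine D.freeMon_induction (p := fun m => HasLead (D.act (u * D.s i) (D.phi m))
    (D.thetaMon u i m)) (fun j a => ?_) ?_ (fun m n hm hn => ?_) (fun m hm => ?_) m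
  · rw [h.thetaMon_Y, phi_Y]; exact h.hasLead_thetaVar u i (j, a)
  · rw [h.thetaMon_zero, map_zero, act_zero, ← act_zero D u, ← map_zero D.phi, ← yMonom_zero u]
    exact hasLead_yMonom u 0
  · rw [h.thetaMon_add, map_add, act_add]; exact hm.mul hn
  · rw [map_neg, act_neg]
    exact hm.of_mul_eq_one h (by rw [← h.thetaMon_add, add_neg_cancel, h.thetaMon_zero])

theorem isKernel_thetaMon (u : D.W) (i : I) :
    IsKernel D.phi (u * D.s i) (D.thetaMon u i) where
  zero := h.thetaMon_zero u i
  add := h.thetaMon_add u i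
  below m := (h.hasLead_thetaMon u i m).below h

/-- The operator `Θ_i` as a ring homomorphism. -/
def thetaHom (i : I) : D.PiRing →+* D.PiRing :=
  RingHom.pi fun u => ((h.isKernel_thetaMon u i).extHom h).comp (Pi.evalRingHom _ (u * D.s i))

theorem thetaHom_eval (i : I) (F : D.PiRing) (u : D.W) :
    h.thetaHom i F u = ext (D.thetaMon u i) (F (u * D.s i)) := rfl

/-- The operator attached to a word. -/
def wordHom (l : List I) : D.PiRing →+* D.PiRing := (l.map h.thetaHom).prod

theorem wordHom_apply (l : List I) (F : D.PiRing) : h.wordHom l F = l.foldr D.theta F := by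
  induction l with
  | nil => rfl
  | cons i l ih =>
    rw [List.foldr_cons, ← ih]
    simp only [wordHom, List.map_cons, List.prod_cons]
    rfl

theorem Theta_apply (w : D.W) (F : D.PiRing) : D.Theta w F = h.wordHom (D.reducedWord w) F :=
  (h.wordHom_apply _ F).symm

end FiniteType

/-- A monomial, diagonally embedded in `Π`. -/
def yDiag (m : FreeMon I) : D.PiRing := fun v => D.yMonom v m

theorem yDiag_add (m n : FreeMon I) : (yDiag (m + n) : D.PiRing) = yDiag m * yDiag n :=
  funext fun u => yMonom_add u m n

theorem yDiag_zero : (yDiag 0 : D.PiRing) = 1 := funext fun u => yMonom_zero u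

theorem yDiag_mul_neg (m : FreeMon I) : (yDiag m * yDiag (-m) : D.PiRing) = 1 := by
  rw [← yDiag_add, add_neg_cancel, yDiag_zero]

/-- The family of the series `Σ^u_{i,a}`. -/
def SigmaPi (D : QDatum I) (i : I) (a : ℂˣ) : D.PiRing := fun u => D.Sigma u i a

namespace FiniteType

variable (h : D.FiniteType)
include h

theorem SigmaPi_eq (i : I) (a : ℂˣ) :
    D.SigmaPi i a = 1 + yDiag (-D.A i a) * D.SigmaPi i (a * ((D.qi i) ^ 2)⁻¹) :=
  funext fun u => h.Sigma_eq u i a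

theorem isUnit_SigmaPi (i : I) (a : ℂˣ) : IsUnit (D.SigmaPi i a) :=
  Pi.isUnit_iff.2 fun u => h.isUnit_Sigma u i a

theorem thetaHom_yDiag (i : I) (m : FreeMon I) :
    h.thetaHom i (yDiag m) = fun u => D.thetaMon u i m := by
  funext u
  rw [thetaHom_eval]
  change ext _ (HahnSeries.single _ 1) = _
  rw [(h.isKernel_thetaMon u i).ext_single h, one_smul]

theorem thetaHom_Y_of_ne {i j : I} (hij : j ≠ i) (a : ℂˣ) :
    h.thetaHom i (yDiag (D.Y j a)) = yDiag (D.Y j a) := by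
  rw [h.thetaHom_yDiag]
  funext u
  rw [h.thetaMon_Y, thetaVar, if_neg hij]; rfl

/-- The image of `Y_{i,a}` under `Θ_i`. -/
theorem thetaHom_Y_mul (i : I) (a : ℂˣ) :
    h.thetaHom i (yDiag (D.Y i a)) * D.SigmaPi i (a * (D.qi i)⁻¹) =
      yDiag (D.Y i a - D.A i (a * (D.qi i)⁻¹)) * D.SigmaPi i (a * ((D.qi i) ^ 3)⁻¹) := by
  rw [h.thetaHom_yDiag]
  funext u
  simp only [Pi.mul_apply]
  rw [h.thetaMon_Y, thetaVar, if_pos rfl]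
  change D.yMonom u _ * D.Sigma u i _ * Ring.inverse (D.Sigma u i _) * D.Sigma u i _ =
    D.yMonom u _ * D.Sigma u i _
  rw [mul_assoc, Ring.inverse_mul_cancel _ (h.isUnit_Sigma u i _), mul_one]

/-- By the functional equation, Θ_i(Y_{i,a}) = Y_{i,a} (Σ - 1)/Σ with a single series Σ =
Σ_{i,aq_i⁻¹}. Invariance is checked most easily in this form. -/
theorem thetaHom_Y_mul' (i : I) (a : ℂˣ) :
    h.thetaHom i (yDiag (D.Y i a)) * D.SigmaPi i (a * (D.qi i)⁻¹) =
      yDiag (D.Y i a) * (D.SigmaPi i (a * (D.qi i)⁻¹) - 1) := by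
  rw [h.thetaHom_Y_mul, h.SigmaPi_eq i (a * (D.qi i)⁻¹), qi_cube_inv, sub_eq_add_neg, yDiag_add]
  ring

/-- The subgroup of monomials fixed by `Θ_i`. -/
def fixedMon (i : I) : AddSubgroup (FreeMon I) where
  carrier := {m | h.thetaHom i (yDiag m) = yDiag m}
  zero_mem' := by
    change h.thetaHom i (yDiag 0) = yDiag 0
    rw [yDiag_zero, map_one]
  add_mem' {m n} hm hn := by
    change h.thetaHom i (yDiag (m + n)) = yDiag (m + n)
    rw [yDiag_add, map_mul, show h.thetaHom i (yDiag m) = yDiag m from hm,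
      show h.thetaHom i (yDiag n) = yDiag n from hn]
  neg_mem' {m} hm := by
    change h.thetaHom i (yDiag (-m)) = yDiag (-m)
    have hm' : h.thetaHom i (yDiag m) = yDiag m := hm
    have e := congrArg (h.thetaHom i) (yDiag_mul_neg (D := D) m)
    rw [map_mul, hm', map_one] at e
    calc h.thetaHom i (yDiag (-m)) = (yDiag (-m) * yDiag m) * h.thetaHom i (yDiag (-m)) := by
          rw [mul_comm (yDiag (-m)), yDiag_mul_neg, one_mul]
      _ = yDiag (-m) := by rw [mul_assoc, e, mul_one]

theorem Y_mem_fixedMon {i j : I} (hij : j ≠ i) (a : ℂˣ) : D.Y j a ∈ h.fixedMon i :=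
  h.thetaHom_Y_of_ne hij a

/-- The elements of `Π` fixed by `Θ_i`. -/
def invariants (i : I) : Subring D.PiRing := RingHom.eqLocus (h.thetaHom i) (RingHom.id _)

theorem yDiag_mem_invariants {i : I} {m : FreeMon I} (hm : m ∈ h.fixedMon i) :
    yDiag m ∈ h.invariants i := hm

/-- The basic `Θ_i`-invariant elements. -/
theorem string_mem_invariants (i : I) (a : ℂˣ)
    (hn : D.A i (a * D.qi i) - D.Y i a - D.Y i (a * (D.qi i) ^ 2) ∈ h.fixedMon i) :
    yDiag (D.Y i a) + yDiag (D.Y i a - D.A i (a * D.qi i)) ∈ h.invariants i := by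
  change h.thetaHom i _ = yDiag (D.Y i a) + yDiag (D.Y i a - D.A i (a * D.qi i))
  -- The second term Y_{i,a} A⁻¹ is the inverse of Y_{i,aq_i²} times the monomial -n, which Θ_i
  -- fixes by hypothesis.
  set n := D.A i (a * D.qi i) - D.Y i a - D.Y i (a * (D.qi i) ^ 2) with hndef
  have e1 : D.Y i a - D.A i (a * D.qi i) = -n + -D.Y i (a * (D.qi i) ^ 2) := by rw [hndef]; abel
  have hn' : h.thetaHom i (yDiag (-n)) = yDiag (-n) := neg_mem hn
  have h1 := h.thetaHom_Y_mul' i a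
  have h2 := h.thetaHom_Y_mul' i (a * (D.qi i) ^ 2)
  have ea : a * (D.qi i) ^ 2 * (D.qi i)⁻¹ = a * D.qi i := by
    rw [pow_two, ← mul_assoc, mul_inv_cancel_right]
  have eb : a * D.qi i * ((D.qi i) ^ 2)⁻¹ = a * (D.qi i)⁻¹ := by
    rw [mul_assoc, pow_two, mul_inv, mul_inv_cancel_left]
  have h3 := h.SigmaPi_eq i (a * D.qi i)
  rw [ea] at h2
  rw [eb] at h3
  have h4 : yDiag (-D.A i (a * D.qi i)) =
      (yDiag (-n) * yDiag (-D.Y i (a * (D.qi i) ^ 2)) * yDiag (-D.Y i a) : D.PiRing) := by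
    rw [← yDiag_add, ← yDiag_add, ← e1]; congr 1; abel
  have h5 := congrArg (h.thetaHom i) (yDiag_mul_neg (D := D) (D.Y i (a * (D.qi i) ^ 2)))
  have h6 := yDiag_mul_neg (D := D) (D.Y i (a * (D.qi i) ^ 2))
  have h7 := yDiag_mul_neg (D := D) (D.Y i a)
  rw [map_mul, map_one] at h5
  rw [e1, yDiag_add, map_add, map_mul, hn']
  set S1 := D.SigmaPi i (a * (D.qi i)⁻¹)
  set S2 := D.SigmaPi i (a * D.qi i)
  set y1 : D.PiRing := yDiag (D.Y i a)
  set y1' : D.PiRing := yDiag (-D.Y i a)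
  set y2 : D.PiRing := yDiag (D.Y i (a * (D.qi i) ^ 2))
  set y2' : D.PiRing := yDiag (-D.Y i (a * (D.qi i) ^ 2))
  set N : D.PiRing := yDiag (-n)
  set t1 := h.thetaHom i y1
  set t2 := h.thetaHom i y2
  set t2' := h.thetaHom i y2'
  rw [h4] at h3
  -- After multiplication by S1 the image of the first term is y1(S1 - 1) and that of the second is
  -- y1 S2. Their sum is y1 S1 + y1(S2 - 1), and y1(S2 - 1) is the original second term times S1.
  refine (h.isUnit_SigmaPi i (a * (D.qi i)⁻¹)).mul_right_cancel ?_
  have h8 : t2' * (S2 - 1) = y2' * S2 := by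
    have : t2' * y2' * (t2 * S2) = t2' * y2' * (y2 * (S2 - 1)) := by rw [h2]
    linear_combination (-1 : D.PiRing) * this + (y2' * S2) * h5 - (t2' * (S2 - 1)) * h6
  have h9 : y1 * (S2 - 1) = N * y2' * S1 := by
    linear_combination y1 * h3 + (N * y2' * S1) * h7
  have h10 : N * t2' * S1 = y1 * S2 := by
    have : N * y2' * (t2' * S1 * N) = t2' * N * (N * y2' * S1) := by ring
    have hu : (y2 * yDiag n) * (N * y2') = 1 := by
      have : yDiag n * N = 1 := yDiag_mul_neg n
      linear_combination h6 + y2 * y2' * this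
    have h11 : N * y2' * (N * t2' * S1) = N * y2' * (y1 * S2) := by
      linear_combination (-(N * t2')) * h9 + N * y1 * h8
    calc N * t2' * S1 = ((y2 * yDiag n) * (N * y2')) * (N * t2' * S1) := by rw [hu, one_mul]
      _ = ((y2 * yDiag n) * (N * y2')) * (y1 * S2) := by rw [mul_assoc, h11, ← mul_assoc]
      _ = y1 * S2 := by rw [hu, one_mul]
  linear_combination h1 + h10 + h9

end FiniteType

end QDatum

end

/-! ### Rigidity, Θ_i² = 1, and reduction of the braid relations to rank two invariants. -/

noncomputable section

namespace QDatum

set_option linter.unusedSectionVars false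

variable {I : Type*} [Fintype I] [DecidableEq I] {D : QDatum I}

/-! ### Rigidity of filtered homomorphisms -/

/-- `T` is compatible with the filtrations by levels, the component at `u` of the image being
controlled by the component at `u w` of the argument. -/
def Filt (w : D.W) (T : D.PiRing →+* D.PiRing) : Prop :=
  ∀ (F : D.PiRing) (u : D.W) (c : ℚ), LevGe c (F (u * w)) → LevGe c (T F u)

theorem Filt.id : Filt (1 : D.W) (RingHom.id D.PiRing) := by
  intro F u c hF
  rwa [mul_one] at hF

theorem Filt.mul {w w' : D.W} {T T' : D.PiRing →+* D.PiRing} (hT : Filt w T) (hT' : Filt w' T') :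
    Filt (w * w') (T * T') := by
  intro F u c hF
  rw [← mul_assoc] at hF
  exact hT (T' F) u c (hT' F (u * w) c hF)

namespace FiniteType

variable (h : D.FiniteType)
include h

theorem filt_thetaHom (i : I) : Filt (D.s i) (h.thetaHom i) := fun _ u _ hF =>
  (h.isKernel_thetaMon u i).ext_levGe h hF

end FiniteType

theorem levGe_yMonom (v : D.W) (m : FreeMon I) :
    LevGe (-D.ht (D.act v (D.phi m))) (D.yMonom v m) := LevGe.single le_rfl

/-- Measured relative to the level of the monomial, agreement of T and T' up to order c is stable
under products and inverses. For inverses, 1/s - 1/t = -(s - t)/(st). -/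
theorem levGe_sub_of_closure {u w : D.W} {T T' : D.PiRing →+* D.PiRing} (hT : Filt w T)
    (hT' : Filt w T') {κ : Type*} (M : κ → FreeMon I)
    (hM : AddSubgroup.closure (Set.range M) = ⊤) (c : ℚ)
    (hk : ∀ k, LevGe (-D.ht (D.act (u * w) (D.phi (M k))) + c)
      (T (yDiag (M k)) u - T' (yDiag (M k)) u)) (m : FreeMon I) :
    LevGe (-D.ht (D.act (u * w) (D.phi m)) + c) (T (yDiag m) u - T' (yDiag m) u) := by
  have hlev : ∀ (T : D.PiRing →+* D.PiRing), Filt w T → ∀ m,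
      LevGe (-D.ht (D.act (u * w) (D.phi m))) (T (yDiag m) u) := fun T hT m =>
    hT _ u _ (levGe_yMonom (u * w) m)
  have hm : m ∈ AddSubgroup.closure (Set.range M) := by rw [hM]; trivial
  induction hm using AddSubgroup.closure_induction with
  | mem x hx => obtain ⟨k, rfl⟩ := hx; exact hk k
  | zero =>
    rw [yDiag_zero, map_one, map_one, sub_self]; exact LevGe.zero
  | add x y _ _ hx hy =>
    have e : T (yDiag (x + y)) u - T' (yDiag (x + y)) u =
        T (yDiag x) u * (T (yDiag y) u - T' (yDiag y) u)
          + (T (yDiag x) u - T' (yDiag x) u) * T' (yDiag y) u := by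
      rw [yDiag_add, map_mul, map_mul, Pi.mul_apply, Pi.mul_apply]; ring
    rw [e]
    refine (((hlev T hT x).mul hy).mono (le_of_eq ?_)).add
      ((hx.mul (hlev T' hT' y)).mono (le_of_eq ?_))
    · rw [map_add, act_add, map_add]; ring
    · rw [map_add, act_add, map_add]; ring
  | neg x _ hx =>
    have e1 : T (yDiag x) u * T (yDiag (-x)) u = 1 := by
      rw [← Pi.mul_apply, ← map_mul, yDiag_mul_neg, map_one]; rfl
    have e2 : T' (yDiag x) u * T' (yDiag (-x)) u = 1 := by
      rw [← Pi.mul_apply, ← map_mul, yDiag_mul_neg, map_one]; rfl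
    have e : T (yDiag (-x)) u - T' (yDiag (-x)) u =
        -(T (yDiag (-x)) u * T' (yDiag (-x)) u * (T (yDiag x) u - T' (yDiag x) u)) := by
      linear_combination (T (yDiag (-x)) u) * e2 * (-1) + (T' (yDiag (-x)) u) * e1
    rw [e]
    refine ((((hlev T hT (-x)).mul (hlev T' hT' (-x))).mul hx).mono (le_of_eq ?_)).neg
    rw [map_neg, act_neg, map_neg]; ring

/-- Two filtered homomorphisms agree as soon as they agree on elements whose leading monomials
generate all monomials. -/
theorem FiniteType.rigidity (h : D.FiniteType) {u w : D.W} {T T' : D.PiRing →+* D.PiRing}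
    (hT : Filt w T) (hT' : Filt w T') {κ : Type*} (M : κ → FreeMon I) (L : κ → List (FreeMon I))
    (hM : AddSubgroup.closure (Set.range M) = ⊤)
    (hL : ∀ k, ∀ m ∈ L k, 1 ≤ D.ht (D.act (u * w) (D.phi (M k) - D.phi m)))
    (hX : ∀ k, T (yDiag (M k) + ((L k).map yDiag).sum) u =
      T' (yDiag (M k) + ((L k).map yDiag).sum) u) (F : D.PiRing) : T F u = T' F u := by
  -- The error on monomials improves by one level at each step: on `M k` it is minus the sum of the
  -- errors on the terms of `L k`, which start at least one level higher, and the `M k` generate.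
  have hmon : ∀ (n : ℕ) (m : FreeMon I), LevGe (-D.ht (D.act (u * w) (D.phi m)) + n)
      (T (yDiag m) u - T' (yDiag m) u) := by
    intro n
    induction n with
    | zero =>
      intro m
      rw [Nat.cast_zero, add_zero]
      exact (hT _ u _ (levGe_yMonom (u * w) m)).sub (hT' _ u _ (levGe_yMonom (u * w) m))
    | succ n ih =>
      refine levGe_sub_of_closure hT hT' M hM _ fun k => ?_
      have e : T (yDiag (M k)) u - T' (yDiag (M k)) u =
          -((L k).map fun m => T (yDiag m) u - T' (yDiag m) u).sum := by
        have := hX k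
        rw [map_add, map_add, Pi.add_apply, Pi.add_apply, map_list_sum, map_list_sum,
          ← sub_eq_zero, add_sub_add_comm] at this
        rw [eq_neg_iff_add_eq_zero, ← this]
        congr 1
        clear this hX hL
        induction L k with
        | nil => simp
        | cons a l ih =>
          simp only [List.map_cons, List.sum_cons, Pi.add_apply, ih]
          abel
      rw [e]
      refine LevGe.neg ?_
      have hlist : ∀ l : List (FreeMon I),
          (∀ m ∈ l, 1 ≤ D.ht (D.act (u * w) (D.phi (M k) - D.phi m))) →
          LevGe (-D.ht (D.act (u * w) (D.phi (M k))) + ((n + 1 : ℕ) : ℚ))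
            (l.map fun m => T (yDiag m) u - T' (yDiag m) u).sum := by
        intro l hl
        induction l with
        | nil => exact LevGe.zero
        | cons a l ihl =>
          rw [List.map_cons, List.sum_cons]
          refine LevGe.add ((ih a).mono ?_) (ihl fun m hm => hl m (List.mem_cons_of_mem a hm))
          have := hl a List.mem_cons_self
          rw [act_sub, map_sub] at this
          push_cast
          linarith
      exact hlist _ (hL k)
  have heq : ∀ m, T (yDiag m) u = T' (yDiag m) u := fun m =>
    sub_eq_zero.1 (eq_zero_of_levGe fun n => hmon n m)
  refine sub_eq_zero.1 (eq_zero_of_levGe (c := 0) fun n => ?_)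
  obtain ⟨S, -, hS⟩ := h.exists_truncation (F (u * w)) (0 + n)
  -- The component at u of the image depends only on the component at u w. A truncation of the
  -- latter is lifted to diagonal monomials, where T and T' are already known to agree.
  set P : D.PiRing := ∑ x ∈ S, (F (u * w)).coeff x • yDiag ((D.gr D.phi (u * w)).symm x) with hP
  have hPv : P (u * w) = ∑ x ∈ S, HahnSeries.single x ((F (u * w)).coeff x) := by
    rw [hP, Finset.sum_apply]
    refine Finset.sum_congr rfl fun x _ => ?_
    ext y
    rw [Pi.smul_apply, HahnSeries.coeff_smul]
    change _ • (HahnSeries.single x (1 : ℤ)).coeff y = _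
    by_cases hyx : y = x
    · rw [hyx]; simp
    · rw [HahnSeries.coeff_single_of_ne hyx, HahnSeries.coeff_single_of_ne hyx, smul_zero]
  have hTP : T P u = T' P u := by
    rw [hP, map_sum, map_sum, Finset.sum_apply, Finset.sum_apply]
    refine Finset.sum_congr rfl fun x _ => ?_
    rw [map_zsmul, map_zsmul, Pi.smul_apply, Pi.smul_apply, heq]
  have hFP : LevGe (0 + (n : ℚ)) ((F - P) (u * w)) := by
    rw [Pi.sub_apply, hPv]; exact hS
  have e : T F u - T' F u = T (F - P) u - T' (F - P) u := by
    rw [map_sub, map_sub, Pi.sub_apply, Pi.sub_apply, hTP]; abel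
  rw [e]
  exact (hT _ u _ hFP).sub (hT' _ u _ hFP)

/-! ### Quadratic relations -/

namespace FiniteType

variable (h : D.FiniteType)
include h

theorem nbr_mem_of_forall {S : AddSubgroup (FreeMon I)} {i : I} (hS : ∀ j, j ≠ i → ∀ a, D.Y j a ∈ S)
    (a : ℂˣ) : D.nbr i a ∈ S := by
  refine sum_mem fun j _ => list_sum_mem fun x hx => ?_
  obtain ⟨t, ht, rfl⟩ := List.mem_map.1 hx
  by_cases hij : j = i
  · subst hij; rw [D.C_diag, shifts_two] at ht; simp at ht
  · exact hS j hij _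

theorem nbr_mem_fixedMon (i : I) (a : ℂˣ) : D.nbr i a ∈ h.fixedMon i :=
  h.nbr_mem_of_forall (fun _ hj a => h.Y_mem_fixedMon hj a) a

theorem Y_sub_A (i : I) (a : ℂˣ) :
    D.Y i a - D.A i (a * D.qi i) = D.nbr i (a * D.qi i) - D.Y i (a * (D.qi i) ^ 2) := by
  rw [A_eq, mul_inv_cancel_right, mul_assoc, ← pow_two]; abel

theorem string_mem (i : I) (a : ℂˣ) :
    yDiag (D.Y i a) + yDiag (D.Y i a - D.A i (a * D.qi i)) ∈ h.invariants i := by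
  refine h.string_mem_invariants i a ?_
  have := h.Y_sub_A i a
  have e : D.A i (a * D.qi i) - D.Y i a - D.Y i (a * (D.qi i) ^ 2) = -D.nbr i (a * D.qi i) := by
    rw [← neg_sub (D.Y i a), this]; abel
  rw [e]
  exact neg_mem (h.nbr_mem_fixedMon i _)

/-- Rigidity with the two-term invariants as test elements. At u the leading term is Y_{i,a} if
u(α_i) > 0. Otherwise it is Y_{i,a} A⁻¹, that is Y_{i,aq_i²}⁻¹ times neighbours. Together with the
Y_{j,a}, j ≠ i, either family generates all monomials. -/
theorem thetaHom_mul_self (i : I) : h.thetaHom i * h.thetaHom i = 1 := by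
  have hT : Filt (1 : D.W) (h.thetaHom i * h.thetaHom i) := by
    rw [← D.s_mul_self i]; exact (h.filt_thetaHom i).mul (h.filt_thetaHom i)
  have hinv : ∀ X ∈ h.invariants i, (h.thetaHom i * h.thetaHom i) X = X := by
    intro X hX
    have hX' : h.thetaHom i X = X := hX
    change h.thetaHom i (h.thetaHom i X) = X
    rw [hX', hX']
  refine RingHom.ext fun F => funext fun u => ?_
  by_cases hp : D.IsQPos (D.act u (D.simpleRoot i))
  · refine h.rigidity (T' := RingHom.id _) hT Filt.id (fun p : I × ℂˣ => D.Y p.1 p.2)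
      (fun p => if p.1 = i then [D.Y i p.2 - D.A i (p.2 * D.qi i)] else []) D.closure_range_Y
      ?_ ?_ F
    · rintro ⟨j, a⟩ m hm
      simp only at hm
      split_ifs at hm with hj
      · rw [List.mem_singleton.1 hm, map_sub, phi_Y, phi_Y, h.phi_A, hj, sub_sub_cancel, mul_one]
        exact h.one_le_ht hp (h.act_simpleRoot_ne_zero u i)
      · simp at hm
    · rintro ⟨j, a⟩
      refine congrFun (hinv _ ?_) u
      split_ifs with hj
      · simp only at hj
        subst hj
        simpa using h.string_mem j a
      · simpa using h.yDiag_mem_invariants (h.Y_mem_fixedMon hj a)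
  · refine h.rigidity (T' := RingHom.id _) hT Filt.id
      (fun p : I × ℂˣ => if p.1 = i then D.Y i p.2 - D.A i (p.2 * D.qi i) else D.Y p.1 p.2)
      (fun p => if p.1 = i then [D.Y i p.2] else []) ?_ ?_ ?_ F
    · set S := AddSubgroup.closure (Set.range fun p : I × ℂˣ =>
        if p.1 = i then D.Y i p.2 - D.A i (p.2 * D.qi i) else D.Y p.1 p.2) with hS
      have h1 : ∀ j, j ≠ i → ∀ a, D.Y j a ∈ S := fun j hj a =>
        AddSubgroup.subset_closure ⟨(j, a), if_neg hj⟩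
      have h2 : ∀ a, D.Y i (a * (D.qi i) ^ 2) ∈ S := by
        intro a
        have h3 : D.Y i a - D.A i (a * D.qi i) ∈ S :=
          AddSubgroup.subset_closure ⟨(i, a), if_pos rfl⟩
        rw [h.Y_sub_A] at h3
        have h4 := sub_mem (h.nbr_mem_of_forall h1 (a * D.qi i)) h3
        rwa [sub_sub_cancel] at h4
      rw [eq_top_iff, ← D.closure_range_Y, AddSubgroup.closure_le]
      rintro _ ⟨⟨j, a⟩, rfl⟩
      by_cases hj : j = i
      · subst hj
        have := h2 (a * ((D.qi j) ^ 2)⁻¹)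
        rwa [inv_mul_cancel_right] at this
      · exact h1 j hj a
    · rintro ⟨j, a⟩ m hm
      simp only at hm
      split_ifs at hm with hj
      · simp only [if_pos hj]
        rw [List.mem_singleton.1 hm, map_sub, phi_Y, h.phi_A, mul_one, sub_sub_cancel_left, act_neg]
        exact h.one_le_ht ((h.isQPos_neg_iff u i).2 hp)
          (neg_ne_zero.2 (h.act_simpleRoot_ne_zero u i))
      · simp at hm
    · rintro ⟨j, a⟩
      refine congrFun (hinv _ ?_) u
      by_cases hj : j = i
      · subst hj
        simpa [add_comm] using h.string_mem j a
      · simpa [hj] using h.yDiag_mem_invariants (h.Y_mem_fixedMon hj a)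

/-! ### Braid relations -/

/-- The operator `Θ_i` as an involution. -/
def thetaInvol (i : I) : (D.PiRing →+* D.PiRing)ˣ :=
  ⟨h.thetaHom i, h.thetaHom i, h.thetaHom_mul_self i, h.thetaHom_mul_self i⟩

theorem thetaInvol_inv (i : I) : (h.thetaInvol i)⁻¹ = h.thetaInvol i := Units.ext rfl

theorem thetaHom_congr {i : I} {F F' : D.PiRing} {u : D.W}
    (e : F (u * D.s i) = F' (u * D.s i)) : h.thetaHom i F u = h.thetaHom i F' u := by
  rw [thetaHom_eval, thetaHom_eval, e]

/-- If Z is the identity at v, so is Z⁻¹. Conjugation by Θ_k, which exchanges the components v and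
vs_k, turns Z⁻¹ at v into Z at vs_k. -/
theorem loop_propagate {Z : (D.PiRing →+* D.PiRing)ˣ} {k : I}
    (hZ : h.thetaInvol k * Z * h.thetaInvol k = Z⁻¹) {v : D.W}
    (hv : ∀ F : D.PiRing, (Z : D.PiRing →+* D.PiRing) F v = F v) (F : D.PiRing) :
    (Z : D.PiRing →+* D.PiRing) F (v * D.s k) = F (v * D.s k) := by
  have hZ' : Z = h.thetaInvol k * Z⁻¹ * h.thetaInvol k := by
    rw [← hZ]
    have e : h.thetaInvol k * h.thetaInvol k = 1 := Units.ext (h.thetaHom_mul_self k)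
    calc Z = (h.thetaInvol k * h.thetaInvol k) * Z * (h.thetaInvol k * h.thetaInvol k) := by
          rw [e, one_mul, mul_one]
      _ = _ := by group
  have hinv : ∀ F : D.PiRing, ((Z⁻¹ : (D.PiRing →+* D.PiRing)ˣ) : D.PiRing →+* D.PiRing) F v
      = F v := by
    intro F
    rw [← hv (((Z⁻¹ : (D.PiRing →+* D.PiRing)ˣ) : D.PiRing →+* D.PiRing) F)]
    change ((Z : D.PiRing →+* D.PiRing) * ((Z⁻¹ : (D.PiRing →+* D.PiRing)ˣ) :
      D.PiRing →+* D.PiRing)) F v = F v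
    rw [← Units.val_mul, mul_inv_cancel]; rfl
  rw [← D.mul_s_mul_s v k] at hinv
  rw [hZ']
  change h.thetaHom k (((Z⁻¹ : (D.PiRing →+* D.PiRing)ˣ) : D.PiRing →+* D.PiRing)
    (h.thetaHom k F)) (v * D.s k) = F (v * D.s k)
  rw [h.thetaHom_congr (hinv (h.thetaHom k F))]
  change (h.thetaHom k * h.thetaHom k) F (v * D.s k) = F (v * D.s k)
  rw [h.thetaHom_mul_self]; rfl

/-- There are elements invariant under `Θ_i` and `Θ_j` with leading monomials `Y_{i,a}`. -/
def HasInvariants (i j : I) : Prop :=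
  ∀ a, ∃ L : List (FreeMon I),
    yDiag (D.Y i a) + (L.map yDiag).sum ∈ h.invariants i ⊓ h.invariants j ∧
    ∀ m ∈ L, ∃ p q : ℕ, p + q ≠ 0 ∧
      D.fundWt i - D.phi m = p • D.simpleRoot i + q • D.simpleRoot j

/-- Where v(α_i) and v(α_j) are positive, the invariants lead with Y_{i,a} and Y_{j,a}, the other
variables are fixed, and rigidity applies. Every other component has a descent s_i or s_j.
Conjugating (Θ_iΘ_j)^m by Θ_i or Θ_j inverts it, so `loop_propagate` reaches that component from a
shorter one. -/
theorem braid_of_hasInvariants {i j : I} (h1 : h.HasInvariants i j)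
    (h2 : h.HasInvariants j i) {m : ℕ} (hm : (D.s i * D.s j) ^ m = 1) :
    (h.thetaHom i * h.thetaHom j) ^ m = 1 := by
  set Z := (h.thetaInvol i * h.thetaInvol j) ^ m with hZ
  have hZval : (Z : D.PiRing →+* D.PiRing) = (h.thetaHom i * h.thetaHom j) ^ m := rfl
  have hfilt : Filt (1 : D.W) (Z : D.PiRing →+* D.PiRing) := by
    rw [hZval, ← hm]
    clear hm hZ hZval Z
    induction m with
    | zero => exact Filt.id
    | succ m ih =>
      rw [pow_succ, pow_succ]
      exact ih.mul ((h.filt_thetaHom i).mul (h.filt_thetaHom j))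
  have hinv : ∀ X ∈ h.invariants i ⊓ h.invariants j, (Z : D.PiRing →+* D.PiRing) X = X := by
    rintro X ⟨hXi, hXj⟩
    have hXi' : h.thetaHom i X = X := hXi
    have hXj' : h.thetaHom j X = X := hXj
    rw [hZval]
    clear hm hZ hZval hfilt Z
    induction m with
    | zero => rfl
    | succ m ih =>
      rw [pow_succ]
      change ((h.thetaHom i * h.thetaHom j) ^ m) (h.thetaHom i (h.thetaHom j X)) = X
      rw [hXj', hXi', ih]
  have hZi : h.thetaInvol i * Z * h.thetaInvol i = Z⁻¹ := by
    have := conj_pow (a := h.thetaInvol i) (b := h.thetaInvol i * h.thetaInvol j) (i := m)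
    rw [thetaInvol_inv] at this
    rw [hZ, ← this, ← inv_pow, mul_inv_rev, thetaInvol_inv, thetaInvol_inv, ← mul_assoc]
    have e : h.thetaInvol i * h.thetaInvol i = 1 := Units.ext (h.thetaHom_mul_self i)
    rw [e, one_mul]
  have hZj : h.thetaInvol j * Z * h.thetaInvol j = Z⁻¹ := by
    have := conj_pow (a := h.thetaInvol j) (b := h.thetaInvol i * h.thetaInvol j) (i := m)
    rw [thetaInvol_inv] at this
    rw [hZ, ← this, ← inv_pow, mul_inv_rev, thetaInvol_inv, thetaInvol_inv, mul_assoc, mul_assoc]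
    have e : h.thetaInvol j * h.thetaInvol j = 1 := Units.ext (h.thetaHom_mul_self j)
    rw [e, mul_one]
  choose L₁ hL₁ hL₁' using h1
  choose L₂ hL₂ hL₂' using h2
  have key : ∀ (v : D.W) (F : D.PiRing), (Z : D.PiRing →+* D.PiRing) F v = F v := by
    intro v
    induction hn : D.length v using Nat.strong_induction_on generalizing v with
    | _ n ih =>
      have hdesc : ∀ k, h.thetaInvol k * Z * h.thetaInvol k = Z⁻¹ →
          ¬ D.IsQPos (D.act v (D.simpleRoot k)) →
          ∀ F : D.PiRing, (Z : D.PiRing →+* D.PiRing) F v = F v := by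
        intro k hk hk'
        have h3 := h.length_mul_s_of_not_isQPos hk'
        have h4 := h.loop_propagate hk (ih _ (by omega) (v * D.s k) rfl)
        rwa [mul_s_mul_s] at h4
      by_cases hi : D.IsQPos (D.act v (D.simpleRoot i))
      swap
      · exact hdesc i hZi hi
      by_cases hj : D.IsQPos (D.act v (D.simpleRoot j))
      swap
      · exact hdesc j hZj hj
      have hpq : ∀ p q : ℕ, p + q ≠ 0 → ∀ x, x = p • D.simpleRoot i + q • D.simpleRoot j →
          1 ≤ D.ht (D.act (v * 1) x) := by
        rintro p q hpq x rfl
        rw [mul_one, act_add, act_nsmul, act_nsmul, map_add, map_nsmul, map_nsmul, nsmul_eq_mul,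
          nsmul_eq_mul]
        have h3 := h.one_le_ht hi (h.act_simpleRoot_ne_zero v i)
        have h4 := h.one_le_ht hj (h.act_simpleRoot_ne_zero v j)
        have h5 : (1 : ℚ) ≤ p + q := by exact_mod_cast Nat.one_le_iff_ne_zero.2 hpq
        nlinarith [(Nat.cast_nonneg p : (0 : ℚ) ≤ p), (Nat.cast_nonneg q : (0 : ℚ) ≤ q)]
      refine h.rigidity (T' := RingHom.id _) hfilt Filt.id (fun p : I × ℂˣ => D.Y p.1 p.2)
        (fun p => if p.1 = i then L₁ p.2 else if p.1 = j then L₂ p.2 else []) D.closure_range_Y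
        ?_ ?_
      · rintro ⟨k, a⟩ x hx
        simp only at hx
        rw [phi_Y]
        split_ifs at hx with hki hkj
        · obtain ⟨p, q, h3, h4⟩ := hL₁' a x hx
          exact hpq p q h3 _ (by rw [hki, h4])
        · obtain ⟨p, q, h3, h4⟩ := hL₂' a x hx
          exact hpq q p (by omega) _ (by rw [hkj, h4, add_comm])
        · simp at hx
      · rintro ⟨k, a⟩
        refine congrFun (hinv _ ?_) v
        simp only
        split_ifs with hki hkj
        · rw [hki]; exact hL₁ a
        · rw [hkj, inf_comm]; exact hL₂ a
        · simpa using ⟨h.yDiag_mem_invariants (h.Y_mem_fixedMon hki a), h.yDiag_mem_invariants (h.Y_mem_fixedMon hkj a)⟩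
  rw [← hZval]
  exact RingHom.ext fun F => funext fun v => key v F

end FiniteType

end QDatum

end

/-! ### Products of strings: invariants of one Θ_i starting from a prescribed monomial. -/

noncomputable section

namespace QDatum

set_option linter.unusedSectionVars false

variable {I : Type*} [Fintype I] [DecidableEq I] {D : QDatum I}

/-! ### Invariant elements attached to strings -/

/-- The part of a monomial in the variables `Y_{i,a}` for a fixed `i`. -/
def nodePart (i : I) : FreeMon I →+ (ℂˣ →₀ ℤ) :=
  Finsupp.comapDomain.addMonoidHom (f := fun a : ℂˣ => (i, a)) (fun _ _ e => (Prod.mk.inj e).2)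

theorem nodePart_apply (i : I) (m : FreeMon I) (a : ℂˣ) : nodePart i m a = m (i, a) := rfl

theorem nodePart_Y_self (i : I) (a : ℂˣ) : nodePart i (D.Y i a) = Finsupp.single a 1 := by
  ext b
  rw [nodePart_apply, Y, Finsupp.single_apply, Finsupp.single_apply]
  simp

theorem nodePart_Y_of_ne {i j : I} (hij : i ≠ j) (a : ℂˣ) : nodePart i (D.Y j a) = 0 := by
  ext b
  rw [nodePart_apply, Y, Finsupp.single_apply, if_neg (by simp [hij.symm])]
  rfl

theorem nodePart_nbr (i j : I) (a : ℂˣ) :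
    nodePart j (D.nbr i a) =
      ((D.shifts (D.C j i)).map fun t => (Finsupp.single (a * t) 1 : ℂˣ →₀ ℤ)).sum := by
  rw [nbr, map_sum, Finset.sum_eq_single j]
  · rw [map_list_sum, List.map_map]
    congr 1
    exact List.map_congr_left fun t _ => nodePart_Y_self j _
  · intro k _ hk
    rw [map_list_sum, List.map_map]
    refine List.sum_eq_zero fun x hx => ?_
    obtain ⟨t, -, rfl⟩ := List.mem_map.1 hx
    exact nodePart_Y_of_ne hk.symm _
  · simp

/-- The delta function at `a Q ^ n`. -/
def node (a Q : ℂˣ) (n : ℤ) : ℂˣ →₀ ℤ := Finsupp.single (a * Q ^ n) 1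

theorem nodePart_A_self {a Q : ℂˣ} {i : I} {δ : ℤ} (hδ : D.qi i = Q ^ δ) (n : ℤ) :
    nodePart i (D.A i (a * Q ^ n)) = node a Q (n - δ) + node a Q (n + δ) := by
  rw [A_eq, map_sub, map_add, nodePart_Y_self, nodePart_Y_self, nodePart_nbr, D.C_diag,
    shifts_two, hδ, mul_assoc, mul_assoc, ← zpow_neg, ← zpow_add, ← zpow_add]
  simp [node, sub_eq_add_neg]

theorem nodePart_A_of_ne {a Q : ℂˣ} {i j : I} (hij : j ≠ i) (n : ℤ) :
    nodePart j (D.A i (a * Q ^ n)) =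
      -((D.shifts (D.C j i)).map fun t => (Finsupp.single (a * Q ^ n * t) 1 : ℂˣ →₀ ℤ)).sum := by
  rw [A_eq, map_sub, map_add, nodePart_Y_of_ne hij, nodePart_Y_of_ne hij, nodePart_nbr]
  simp

theorem nodePart_A_of_zero {a Q : ℂˣ} {i j : I} (hij : j ≠ i) (hc : D.C j i = 0) (n : ℤ) :
    nodePart j (D.A i (a * Q ^ n)) = 0 := by
  rw [nodePart_A_of_ne hij, hc, shifts_zero]; simp

theorem nodePart_A_of_one {a Q : ℂˣ} {i j : I} (hij : j ≠ i) (hc : D.C j i = -1) (n : ℤ) :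
    nodePart j (D.A i (a * Q ^ n)) = -node a Q n := by
  rw [nodePart_A_of_ne hij, hc, shifts_neg_one]; simp [node]

theorem nodePart_A_of_two {a : ℂˣ} {i j : I} (hij : j ≠ i) (hc : D.C j i = -2) (n : ℤ) :
    nodePart j (D.A i (a * D.q ^ n)) = -(node a D.q (n - 1) + node a D.q (n + 1)) := by
  rw [nodePart_A_of_ne hij, hc, shifts_neg_two]
  simp [node, zpow_sub, zpow_add, mul_assoc]

theorem nodePart_A_of_three {a : ℂˣ} {i j : I} (hij : j ≠ i) (hc : D.C j i = -3) (n : ℤ) :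
    nodePart j (D.A i (a * D.q ^ n)) =
      -(node a D.q (n - 2) + node a D.q n + node a D.q (n + 2)) := by
  rw [nodePart_A_of_ne hij, hc, shifts_neg_three]
  simp [node, zpow_sub, zpow_add, mul_assoc, add_assoc, pow_two]

theorem nodePart_Y_node (i : I) (a Q : ℂˣ) (n : ℤ) :
    nodePart i (D.Y i (a * Q ^ n)) = node a Q n := nodePart_Y_self i _

namespace FiniteType

variable (h : D.FiniteType)
include h

theorem mem_fixedMon_of_nodePart {i : I} {m : FreeMon I} (hm : nodePart i m = 0) :
    m ∈ h.fixedMon i := by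
  have e : m = m.sum fun p n => n • D.Y p.1 p.2 := by
    conv_lhs => rw [← Finsupp.sum_single m]
    refine Finsupp.sum_congr fun p _ => ?_
    rw [Y, Finsupp.smul_single, smul_eq_mul, mul_one]
  rw [e]
  refine sum_mem fun p hp => zsmul_mem (h.Y_mem_fixedMon ?_ p.2) _
  rintro rfl
  exact (Finsupp.mem_support_iff.1 hp) (DFunLike.congr_fun hm p.2)

theorem fixed_mem {i : I} {m : FreeMon I} (hm : nodePart i m = 0) :
    yDiag m ∈ h.invariants i := h.yDiag_mem_invariants (h.mem_fixedMon_of_nodePart hm)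

variable {i : I} {a Q : ℂˣ} {δ : ℤ} (hδ : D.qi i = Q ^ δ)
include hδ

theorem string_mem_zpow (n : ℤ) :
    yDiag (D.Y i (a * Q ^ n)) + yDiag (D.Y i (a * Q ^ n) - D.A i (a * Q ^ (n + δ)))
      ∈ h.invariants i := by
  have := h.string_mem i (a * Q ^ n)
  rwa [hδ, mul_assoc, ← zpow_add] at this

/-- A monomial whose i-part is a single variable is that variable times a Θ_i-fixed monomial, so the
basic two-term invariant can be multiplied by the latter. -/
theorem string_one_mem {m m' : FreeMon I} (n k : ℤ) (hm : nodePart i m = node a Q n)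
    (hk : k = n + δ) (hm' : m' = m - D.A i (a * Q ^ k)) :
    yDiag m + yDiag m' ∈ h.invariants i := by
  subst hk
  have h0 : yDiag (m - D.Y i (a * Q ^ n)) ∈ h.invariants i := h.fixed_mem (by
    rw [map_sub, hm, nodePart_Y_node, sub_self])
  have := mul_mem h0 (h.string_mem_zpow (a := a) hδ n)
  rw [mul_add, ← yDiag_add, ← yDiag_add] at this
  convert this using 3 <;> rw [sub_add_eq_add_sub] <;> try rw [hm']
  · abel
  · abel

/-- The product of the strings at n and n + 2δ has four terms. The term with only A at n + δ removed
contains no variable of index i, hence is itself invariant; subtracting it leaves a chain of three.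
-/
theorem string_two_mem {m m' m'' : FreeMon I} (n k k' : ℤ)
    (hm : nodePart i m = node a Q n + node a Q (n + 2 * δ))
    (hk : k = n + 3 * δ) (hk' : k' = n + δ) (hm' : m' = m - D.A i (a * Q ^ k))
    (hm'' : m'' = m' - D.A i (a * Q ^ k')) :
    yDiag m + yDiag m' + yDiag m'' ∈ h.invariants i := by
  subst hk hk'
  have h0 : yDiag (m - D.Y i (a * Q ^ n) - D.Y i (a * Q ^ (n + 2 * δ))) ∈ h.invariants i :=
    h.fixed_mem (by rw [map_sub, map_sub, hm, nodePart_Y_node, nodePart_Y_node]; abel)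
  have h1 := h.string_mem_zpow (a := a) hδ n
  have h2 := h.string_mem_zpow (a := a) hδ (n + 2 * δ)
  have h3 : yDiag (m - D.A i (a * Q ^ (n + δ))) ∈ h.invariants i :=
    h.fixed_mem (by
      rw [map_sub, hm, nodePart_A_self hδ, add_sub_cancel_right, add_assoc n δ δ, ← two_mul,
        sub_self])
  have h4 := sub_mem (mul_mem h0 (mul_mem h1 h2)) h3
  rw [add_assoc n, ← add_one_mul, show (2 : ℤ) + 1 = 3 by norm_num] at h4
  simp only [mul_add, add_mul, ← yDiag_add] at h4
  set y := D.Y i (a * Q ^ n)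
  set y' := D.Y i (a * Q ^ (n + 2 * δ))
  set A := D.A i (a * Q ^ (n + δ))
  set A' := D.A i (a * Q ^ (n + 3 * δ))
  have e1 : m - y - y' + (y + y') = m := by abel
  have e2 : m - y - y' + (y - A + y') = m - A := by abel
  have e3 : m - y - y' + (y + (y' - A')) = m' := by rw [hm']; abel
  have e4 : m - y - y' + (y - A + (y' - A')) = m'' := by rw [hm'', hm']; abel
  rw [e1, e2, e3, e4] at h4
  convert h4 using 1
  abel

/-- The three-term chain at n, n + 2δ times the string at n + 4δ has six terms. The two in which A
at n + 3δ is removed before A at n + 5δ form a string of their own and are subtracted. -/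
theorem string_three_mem {m m' m'' m''' : FreeMon I} (n k k' k'' : ℤ)
    (hm : nodePart i m = node a Q n + node a Q (n + 2 * δ) + node a Q (n + 4 * δ))
    (hk : k = n + 5 * δ) (hk' : k' = n + 3 * δ) (hk'' : k'' = n + δ)
    (hm' : m' = m - D.A i (a * Q ^ k)) (hm'' : m'' = m' - D.A i (a * Q ^ k'))
    (hm''' : m''' = m'' - D.A i (a * Q ^ k'')) :
    yDiag m + yDiag m' + yDiag m'' + yDiag m''' ∈ h.invariants i := by
  subst hk hk' hk''
  set y := D.Y i (a * Q ^ (n + 4 * δ)) with hy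
  set A := D.A i (a * Q ^ (n + δ)) with hA
  set A' := D.A i (a * Q ^ (n + 3 * δ)) with hA'
  set A'' := D.A i (a * Q ^ (n + 5 * δ)) with hA''
  have h1 := h.string_two_mem (a := a) hδ (m := m - y) (m' := m - y - A') (m'' := m - y - A' - A)
    n (n + 3 * δ) (n + δ) (by rw [map_sub, hm, hy, nodePart_Y_node]; abel) rfl rfl rfl rfl
  have h2 := h.string_mem_zpow (a := a) hδ (n + 4 * δ)
  have h3 := h.string_one_mem (a := a) hδ (m := m - A') (m' := m - A' - A) n (n + δ)
    (by
      rw [map_sub, hm, hA', nodePart_A_self hδ, show n + 3 * δ - δ = n + 2 * δ by ring,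
        show n + 3 * δ + δ = n + 4 * δ by ring]; abel) rfl rfl
  have h4 := sub_mem (mul_mem h1 h2) h3
  rw [show n + 4 * δ + δ = n + 5 * δ by ring, ← hy, ← hA''] at h4
  simp only [mul_add, add_mul, ← yDiag_add] at h4
  have e1 : m - y + y = m := by abel
  have e2 : m - y - A' + y = m - A' := by abel
  have e3 : m - y - A' - A + y = m - A' - A := by abel
  have e4 : m - y + (y - A'') = m' := by rw [hm']; abel
  have e5 : m - y - A' + (y - A'') = m'' := by rw [hm'', hm']; abel
  have e6 : m - y - A' - A + (y - A'') = m''' := by rw [hm''', hm'', hm']; abel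
  rw [e1, e2, e3, e4, e5, e6] at h4
  convert h4 using 1
  abel

/-- Two strings multiplied with all four terms kept, for variables that do not form a chain with
step 2δ. -/
theorem string_pair_mem {m m' m'' m''' : FreeMon I} (n n' k k' : ℤ)
    (hm : nodePart i m = node a Q n + node a Q n')
    (hk : k = n + δ) (hk' : k' = n' + δ) (hm' : m' = m - D.A i (a * Q ^ k))
    (hm'' : m'' = m - D.A i (a * Q ^ k')) (hm''' : m''' = m' - D.A i (a * Q ^ k')) :
    yDiag m + yDiag m' + yDiag m'' + yDiag m''' ∈ h.invariants i := by
  subst hk hk'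
  have h0 : yDiag (m - D.Y i (a * Q ^ n) - D.Y i (a * Q ^ n')) ∈ h.invariants i :=
    h.fixed_mem (by rw [map_sub, map_sub, hm, nodePart_Y_node, nodePart_Y_node]; abel)
  have h4 := mul_mem h0 (mul_mem (h.string_mem_zpow (a := a) hδ n)
    (h.string_mem_zpow (a := a) hδ n'))
  simp only [mul_add, add_mul, ← yDiag_add] at h4
  set y := D.Y i (a * Q ^ n)
  set y' := D.Y i (a * Q ^ n')
  set A := D.A i (a * Q ^ (n + δ))
  set A' := D.A i (a * Q ^ (n' + δ))
  have e1 : m - y - y' + (y + y') = m := by abel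
  have e2 : m - y - y' + (y - A + y') = m' := by rw [hm']; abel
  have e3 : m - y - y' + (y + (y' - A')) = m'' := by rw [hm'']; abel
  have e4 : m - y - y' + (y - A + (y' - A')) = m''' := by rw [hm''', hm']; abel
  rw [e1, e2, e3, e4] at h4
  convert h4 using 1
  abel

end FiniteType

end QDatum

end

/-! ### Rank two fundamental q-characters, type by type. -/

noncomputable section

namespace QDatum

set_option linter.unusedSectionVars false

variable {I : Type*} [Fintype I] [DecidableEq I] {D : QDatum I}

/-! ### Elements invariant under a rank two parabolic subgroup -/

namespace FiniteType

variable (h : D.FiniteType)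
include h

theorem d_ratio {i j : I} {n : ℕ} (hij : D.C i j = -1) (hji : D.C j i = -n) :
    D.d i = n * D.d j := by
  have := D.d_symm i j
  rw [hij, hji] at this
  have : (D.d i : ℤ) = n * D.d j := by linarith
  exact_mod_cast this

theorem fundWt_sub_phi_sub_A_left {i j : I} {m m' : FreeMon I} {p q : ℕ} {a : ℂˣ}
    (hm : D.fundWt i - D.phi m = p • D.simpleRoot i + q • D.simpleRoot j)
    (hm' : m' = m - D.A i a) :
    D.fundWt i - D.phi m' = (p + 1) • D.simpleRoot i + q • D.simpleRoot j := by
  rw [hm', map_sub, h.phi_A, ← sub_add, hm, add_smul, one_smul]; abel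

theorem fundWt_sub_phi_sub_A_right {i j : I} {m m' : FreeMon I} {p q : ℕ} {a : ℂˣ}
    (hm : D.fundWt i - D.phi m = p • D.simpleRoot i + q • D.simpleRoot j)
    (hm' : m' = m - D.A j a) :
    D.fundWt i - D.phi m' = p • D.simpleRoot i + (q + 1) • D.simpleRoot j := by
  rw [hm', map_sub, h.phi_A, ← sub_add, hm, add_smul, one_smul]; abel

theorem fundWt_sub_phi_Y (i j : I) (a : ℂˣ) :
    D.fundWt i - D.phi (D.Y i a) = 0 • D.simpleRoot i + 0 • D.simpleRoot j := by
  rw [phi_Y]; simp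

/-- In this and the next five lemmas the `m` are the monomials of the q-character of a fundamental
representation, each obtained from an earlier one by a factor A⁻¹. The facts `gi` group them into
Θ_i-strings and `gj` into Θ_j-strings, every monomial occurring once in each grouping. The facts `w`
record the weights. Here there is just the two-term string. -/
theorem hasInvariants_A1_A1 {i j : I} (hij : i ≠ j) (hc : D.C i j = 0) (hc' : D.C j i = 0) :
    h.HasInvariants i j := by
  intro a
  have hi : D.qi i = (D.qi i) ^ (1 : ℤ) := (zpow_one _).symm
  have pii : ∀ n, nodePart i (D.A i (a * (D.qi i) ^ n)) = node a (D.qi i) (n - 1) + node a (D.qi i) (n + 1) :=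
    nodePart_A_self hi
  have pij := nodePart_A_of_zero (a := a) (Q := (D.qi i)) hij hc
  have pji := nodePart_A_of_zero (a := a) (Q := (D.qi i)) hij.symm hc'
  obtain ⟨m₁, h₁⟩ : ∃ m, m = D.Y i (a * (D.qi i) ^ (0 : ℤ)) := ⟨_, rfl⟩
  have w₁ : D.fundWt i - D.phi m₁ = 0 • D.simpleRoot i + 0 • D.simpleRoot j := by
    rw [h₁]; exact h.fundWt_sub_phi_Y i j _
  have pi₁ : nodePart i m₁ = node a (D.qi i) 0 := by rw [h₁]; exact nodePart_Y_node i a (D.qi i) 0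
  have pj₁ : nodePart j m₁ = 0 := by rw [h₁]; exact nodePart_Y_of_ne hij.symm _
  obtain ⟨m₂, h₂⟩ : ∃ m, m = m₁ - D.A i (a * (D.qi i) ^ (1 : ℤ)) := ⟨_, rfl⟩
  have w₂ := h.fundWt_sub_phi_sub_A_left w₁ h₂
  have gi₁ := h.string_one_mem (a := a) hi (m := m₁) 0 1
    (by simpa using pi₁)
    (by norm_num) h₂
  have gj₁ := h.fixed_mem (i := j) (m := m₁) pj₁
  have gj₂ := h.fixed_mem (i := j) (m := m₂) (by simp only [h₂, map_sub, pji, pj₁]; norm_num)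
  have e : (yDiag (D.Y i a) + (([m₂] : List (FreeMon I)).map yDiag).sum : D.PiRing) =
      yDiag m₁ + yDiag m₂ := by
    rw [h₁, zpow_zero, mul_one]
    simp only [List.map_cons, List.map_nil, List.sum_cons, List.sum_nil]
    abel
  refine ⟨[m₂], ?_, ?_⟩
  · rw [e]
    refine Subring.mem_inf.2 ⟨?_, ?_⟩
    · convert gi₁ using 1
    · convert (add_mem gj₁ gj₂) using 1
  · simp only [List.forall_mem_cons, List.not_mem_nil, false_imp_iff, implies_true, and_true]
    exact ⟨1, 0, by norm_num, w₂⟩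

/-- Three monomials, as in the vector representation. -/
theorem hasInvariants_A2 {i j : I} (hij : i ≠ j) (hc : D.C i j = -1) (hc' : D.C j i = -1) :
    h.HasInvariants i j := by
  intro a
  have hi : D.qi i = (D.qi i) ^ (1 : ℤ) := (zpow_one _).symm
  have hj : D.qi j = (D.qi i) ^ (1 : ℤ) := by
    rw [zpow_one, qi, qi, h.d_ratio (n := 1) hc (by simpa using hc'), one_mul]
  have pii : ∀ n, nodePart i (D.A i (a * (D.qi i) ^ n)) = node a (D.qi i) (n - 1) + node a (D.qi i) (n + 1) :=
    nodePart_A_self hi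
  have pij := nodePart_A_of_one (a := a) (Q := (D.qi i)) hij hc
  have pji := nodePart_A_of_one (a := a) (Q := (D.qi i)) hij.symm hc'
  have pjj : ∀ n, nodePart j (D.A j (a * (D.qi i) ^ n)) = node a (D.qi i) (n - 1) + node a (D.qi i) (n + 1) :=
    nodePart_A_self hj
  obtain ⟨m₁, h₁⟩ : ∃ m, m = D.Y i (a * (D.qi i) ^ (0 : ℤ)) := ⟨_, rfl⟩
  have w₁ : D.fundWt i - D.phi m₁ = 0 • D.simpleRoot i + 0 • D.simpleRoot j := by
    rw [h₁]; exact h.fundWt_sub_phi_Y i j _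
  have pi₁ : nodePart i m₁ = node a (D.qi i) 0 := by rw [h₁]; exact nodePart_Y_node i a (D.qi i) 0
  have pj₁ : nodePart j m₁ = 0 := by rw [h₁]; exact nodePart_Y_of_ne hij.symm _
  obtain ⟨m₂, h₂⟩ : ∃ m, m = m₁ - D.A i (a * (D.qi i) ^ (1 : ℤ)) := ⟨_, rfl⟩
  have w₂ := h.fundWt_sub_phi_sub_A_left w₁ h₂
  obtain ⟨m₃, h₃⟩ : ∃ m, m = m₂ - D.A j (a * (D.qi i) ^ (2 : ℤ)) := ⟨_, rfl⟩
  have w₃ := h.fundWt_sub_phi_sub_A_right w₂ h₃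
  have gi₁ := h.string_one_mem (a := a) hi (m := m₁) 0 1
    (by simpa using pi₁)
    (by norm_num) h₂
  have gi₂ := h.fixed_mem (i := i) (m := m₃) (by simp only [h₃, h₂, map_sub, pii, pij, pi₁]; norm_num)
  have gj₁ := h.fixed_mem (i := j) (m := m₁) pj₁
  have gj₂ := h.string_one_mem (a := a) hj (m := m₂) 1 2
    (by simp only [h₂, map_sub, pji, pj₁]; norm_num)
    (by norm_num) h₃
  have e : (yDiag (D.Y i a) + (([m₂, m₃] : List (FreeMon I)).map yDiag).sum : D.PiRing) =
      yDiag m₁ + yDiag m₂ + yDiag m₃ := by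
    rw [h₁, zpow_zero, mul_one]
    simp only [List.map_cons, List.map_nil, List.sum_cons, List.sum_nil]
    abel
  refine ⟨[m₂, m₃], ?_, ?_⟩
  · rw [e]
    refine Subring.mem_inf.2 ⟨?_, ?_⟩
    · convert (add_mem gi₁ gi₂) using 1
    · convert (add_mem gj₁ gj₂) using 1
      abel
  · simp only [List.forall_mem_cons, List.not_mem_nil, false_imp_iff, implies_true, and_true]
    exact ⟨⟨1, 0, by norm_num, w₂⟩, ⟨1, 1, by norm_num, w₃⟩⟩

/-- The node i is short: four monomials in a chain, as in the spin representation. -/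
theorem hasInvariants_B2_short {i j : I} (hij : i ≠ j) (hc : D.C i j = -2) (hc' : D.C j i = -1) :
    h.HasInvariants i j := by
  intro a
  have di := h.d_eq_one i j (by simp [hc])
  have dj := h.d_ratio (n := 2) hc' (by simpa using hc)
  have hi : D.qi i = D.q ^ (1 : ℤ) := by rw [qi, di, zpow_one, pow_one]
  have hj : D.qi j = D.q ^ (2 : ℤ) := by rw [qi, dj, di]; norm_cast
  have pii : ∀ n, nodePart i (D.A i (a * D.q ^ n)) = node a D.q (n - 1) + node a D.q (n + 1) :=
    nodePart_A_self hi
  have pij := nodePart_A_of_two (a := a) hij hc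
  have pji := nodePart_A_of_one (a := a) (Q := D.q) hij.symm hc'
  have pjj : ∀ n, nodePart j (D.A j (a * D.q ^ n)) = node a D.q (n - 2) + node a D.q (n + 2) :=
    nodePart_A_self hj
  obtain ⟨m₁, h₁⟩ : ∃ m, m = D.Y i (a * D.q ^ (0 : ℤ)) := ⟨_, rfl⟩
  have w₁ : D.fundWt i - D.phi m₁ = 0 • D.simpleRoot i + 0 • D.simpleRoot j := by
    rw [h₁]; exact h.fundWt_sub_phi_Y i j _
  have pi₁ : nodePart i m₁ = node a D.q 0 := by rw [h₁]; exact nodePart_Y_node i a D.q 0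
  have pj₁ : nodePart j m₁ = 0 := by rw [h₁]; exact nodePart_Y_of_ne hij.symm _
  obtain ⟨m₂, h₂⟩ : ∃ m, m = m₁ - D.A i (a * D.q ^ (1 : ℤ)) := ⟨_, rfl⟩
  have w₂ := h.fundWt_sub_phi_sub_A_left w₁ h₂
  obtain ⟨m₃, h₃⟩ : ∃ m, m = m₂ - D.A j (a * D.q ^ (3 : ℤ)) := ⟨_, rfl⟩
  have w₃ := h.fundWt_sub_phi_sub_A_right w₂ h₃
  obtain ⟨m₄, h₄⟩ : ∃ m, m = m₃ - D.A i (a * D.q ^ (5 : ℤ)) := ⟨_, rfl⟩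
  have w₄ := h.fundWt_sub_phi_sub_A_left w₃ h₄
  have gi₁ := h.string_one_mem (a := a) hi (m := m₁) 0 1
    (by simpa using pi₁)
    (by norm_num) h₂
  have gi₂ := h.string_one_mem (a := a) hi (m := m₃) 4 5
    (by simp only [h₃, h₂, map_sub, pii, pij, pi₁]; norm_num)
    (by norm_num) h₄
  have gj₁ := h.fixed_mem (i := j) (m := m₁) pj₁
  have gj₂ := h.string_one_mem (a := a) hj (m := m₂) 1 3
    (by simp only [h₂, map_sub, pji, pj₁]; norm_num)
    (by norm_num) h₃
  have gj₃ := h.fixed_mem (i := j) (m := m₄) (by simp only [h₄, h₃, h₂, map_sub, pji, pjj, pj₁]; norm_num)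
  have e : (yDiag (D.Y i a) + (([m₂, m₃, m₄] : List (FreeMon I)).map yDiag).sum : D.PiRing) =
      yDiag m₁ + yDiag m₂ + yDiag m₃ + yDiag m₄ := by
    rw [h₁, zpow_zero, mul_one]
    simp only [List.map_cons, List.map_nil, List.sum_cons, List.sum_nil]
    abel
  refine ⟨[m₂, m₃, m₄], ?_, ?_⟩
  · rw [e]
    refine Subring.mem_inf.2 ⟨?_, ?_⟩
    · convert (add_mem gi₁ gi₂) using 1
      abel
    · convert (add_mem (add_mem gj₁ gj₂) gj₃) using 1
      abel
  · simp only [List.forall_mem_cons, List.not_mem_nil, false_imp_iff, implies_true, and_true]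
    exact ⟨⟨1, 0, by norm_num, w₂⟩, ⟨1, 1, by norm_num, w₃⟩, ⟨2, 1, by norm_num, w₄⟩⟩

/-- The node i is long: five monomials. Multiplying by A_i⁻¹ creates Y_j at exponents 1 and 3, which
gives a chain of three for Θ_j. -/
theorem hasInvariants_B2_long {i j : I} (hij : i ≠ j) (hc : D.C i j = -1) (hc' : D.C j i = -2) :
    h.HasInvariants i j := by
  intro a
  have dj := h.d_eq_one j i (by simp [hc'])
  have di := h.d_ratio (n := 2) hc (by simpa using hc')
  have hj : D.qi j = D.q ^ (1 : ℤ) := by rw [qi, dj, zpow_one, pow_one]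
  have hi : D.qi i = D.q ^ (2 : ℤ) := by rw [qi, di, dj]; norm_cast
  have pii : ∀ n, nodePart i (D.A i (a * D.q ^ n)) = node a D.q (n - 2) + node a D.q (n + 2) :=
    nodePart_A_self hi
  have pij := nodePart_A_of_one (a := a) (Q := D.q) hij hc
  have pji := nodePart_A_of_two (a := a) hij.symm hc'
  have pjj : ∀ n, nodePart j (D.A j (a * D.q ^ n)) = node a D.q (n - 1) + node a D.q (n + 1) :=
    nodePart_A_self hj
  obtain ⟨m₁, h₁⟩ : ∃ m, m = D.Y i (a * D.q ^ (0 : ℤ)) := ⟨_, rfl⟩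
  have w₁ : D.fundWt i - D.phi m₁ = 0 • D.simpleRoot i + 0 • D.simpleRoot j := by
    rw [h₁]; exact h.fundWt_sub_phi_Y i j _
  have pi₁ : nodePart i m₁ = node a D.q 0 := by rw [h₁]; exact nodePart_Y_node i a D.q 0
  have pj₁ : nodePart j m₁ = 0 := by rw [h₁]; exact nodePart_Y_of_ne hij.symm _
  obtain ⟨m₂, h₂⟩ : ∃ m, m = m₁ - D.A i (a * D.q ^ (2 : ℤ)) := ⟨_, rfl⟩
  have w₂ := h.fundWt_sub_phi_sub_A_left w₁ h₂
  obtain ⟨m₃, h₃⟩ : ∃ m, m = m₂ - D.A j (a * D.q ^ (4 : ℤ)) := ⟨_, rfl⟩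
  have w₃ := h.fundWt_sub_phi_sub_A_right w₂ h₃
  obtain ⟨m₄, h₄⟩ : ∃ m, m = m₃ - D.A j (a * D.q ^ (2 : ℤ)) := ⟨_, rfl⟩
  have w₄ := h.fundWt_sub_phi_sub_A_right w₃ h₄
  obtain ⟨m₅, h₅⟩ : ∃ m, m = m₄ - D.A i (a * D.q ^ (4 : ℤ)) := ⟨_, rfl⟩
  have w₅ := h.fundWt_sub_phi_sub_A_left w₄ h₅
  have gi₁ := h.string_one_mem (a := a) hi (m := m₁) 0 2
    (by simpa using pi₁)
    (by norm_num) h₂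
  have gi₂ := h.fixed_mem (i := i) (m := m₃) (by simp only [h₃, h₂, map_sub, pii, pij, pi₁]; norm_num)
  have gi₃ := h.string_one_mem (a := a) hi (m := m₄) 2 4
    (by simp only [h₄, h₃, h₂, map_sub, pii, pij, pi₁]; norm_num)
    (by norm_num) h₅
  have gj₁ := h.fixed_mem (i := j) (m := m₁) pj₁
  have gj₂ := h.string_two_mem (a := a) hj (m := m₂) 1 4 2
    (by simp only [h₂, map_sub, pji, pj₁]; norm_num)
    (by norm_num) (by norm_num) h₃ h₄
  have gj₃ := h.fixed_mem (i := j) (m := m₅) (by simp only [h₅, h₄, h₃, h₂, map_sub, pji, pjj, pj₁]; norm_num)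
  have e : (yDiag (D.Y i a) + (([m₂, m₃, m₄, m₅] : List (FreeMon I)).map yDiag).sum : D.PiRing) =
      yDiag m₁ + yDiag m₂ + yDiag m₃ + yDiag m₄ + yDiag m₅ := by
    rw [h₁, zpow_zero, mul_one]
    simp only [List.map_cons, List.map_nil, List.sum_cons, List.sum_nil]
    abel
  refine ⟨[m₂, m₃, m₄, m₅], ?_, ?_⟩
  · rw [e]
    refine Subring.mem_inf.2 ⟨?_, ?_⟩
    · convert (add_mem (add_mem gi₁ gi₂) gi₃) using 1
      abel
    · convert (add_mem (add_mem gj₁ gj₂) gj₃) using 1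
      abel
  · simp only [List.forall_mem_cons, List.not_mem_nil, false_imp_iff, implies_true, and_true]
    exact ⟨⟨1, 0, by norm_num, w₂⟩, ⟨1, 1, by norm_num, w₃⟩, ⟨1, 2, by norm_num, w₄⟩, ⟨2, 2, by norm_num, w₅⟩⟩

/-- Seven monomials in a chain. The middle Θ_i-string, from m₃ to m₅, has three terms. -/
theorem hasInvariants_G2_short {i j : I} (hij : i ≠ j) (hc : D.C i j = -3) (hc' : D.C j i = -1) :
    h.HasInvariants i j := by
  intro a
  have di := h.d_eq_one i j (by simp [hc])
  have dj := h.d_ratio (n := 3) hc' (by simpa using hc)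
  have hi : D.qi i = D.q ^ (1 : ℤ) := by rw [qi, di, zpow_one, pow_one]
  have hj : D.qi j = D.q ^ (3 : ℤ) := by rw [qi, dj, di]; norm_cast
  have pii : ∀ n, nodePart i (D.A i (a * D.q ^ n)) = node a D.q (n - 1) + node a D.q (n + 1) :=
    nodePart_A_self hi
  have pij := nodePart_A_of_three (a := a) hij hc
  have pji := nodePart_A_of_one (a := a) (Q := D.q) hij.symm hc'
  have pjj : ∀ n, nodePart j (D.A j (a * D.q ^ n)) = node a D.q (n - 3) + node a D.q (n + 3) :=
    nodePart_A_self hj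
  obtain ⟨m₁, h₁⟩ : ∃ m, m = D.Y i (a * D.q ^ (0 : ℤ)) := ⟨_, rfl⟩
  have w₁ : D.fundWt i - D.phi m₁ = 0 • D.simpleRoot i + 0 • D.simpleRoot j := by
    rw [h₁]; exact h.fundWt_sub_phi_Y i j _
  have pi₁ : nodePart i m₁ = node a D.q 0 := by rw [h₁]; exact nodePart_Y_node i a D.q 0
  have pj₁ : nodePart j m₁ = 0 := by rw [h₁]; exact nodePart_Y_of_ne hij.symm _
  obtain ⟨m₂, h₂⟩ : ∃ m, m = m₁ - D.A i (a * D.q ^ (1 : ℤ)) := ⟨_, rfl⟩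
  have w₂ := h.fundWt_sub_phi_sub_A_left w₁ h₂
  obtain ⟨m₃, h₃⟩ : ∃ m, m = m₂ - D.A j (a * D.q ^ (4 : ℤ)) := ⟨_, rfl⟩
  have w₃ := h.fundWt_sub_phi_sub_A_right w₂ h₃
  obtain ⟨m₄, h₄⟩ : ∃ m, m = m₃ - D.A i (a * D.q ^ (7 : ℤ)) := ⟨_, rfl⟩
  have w₄ := h.fundWt_sub_phi_sub_A_left w₃ h₄
  obtain ⟨m₅, h₅⟩ : ∃ m, m = m₄ - D.A i (a * D.q ^ (5 : ℤ)) := ⟨_, rfl⟩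
  have w₅ := h.fundWt_sub_phi_sub_A_left w₄ h₅
  obtain ⟨m₆, h₆⟩ : ∃ m, m = m₅ - D.A j (a * D.q ^ (8 : ℤ)) := ⟨_, rfl⟩
  have w₆ := h.fundWt_sub_phi_sub_A_right w₅ h₆
  obtain ⟨m₇, h₇⟩ : ∃ m, m = m₆ - D.A i (a * D.q ^ (11 : ℤ)) := ⟨_, rfl⟩
  have w₇ := h.fundWt_sub_phi_sub_A_left w₆ h₇
  have gi₁ := h.string_one_mem (a := a) hi (m := m₁) 0 1
    (by simpa using pi₁)
    (by norm_num) h₂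
  have gi₂ := h.string_two_mem (a := a) hi (m := m₃) 4 7 5
    (by simp only [h₃, h₂, map_sub, pii, pij, pi₁]; norm_num; abel)
    (by norm_num) (by norm_num) h₄ h₅
  have gi₃ := h.string_one_mem (a := a) hi (m := m₆) 10 11
    (by simp only [h₆, h₅, h₄, h₃, h₂, map_sub, pii, pij, pi₁]; norm_num; abel)
    (by norm_num) h₇
  have gj₁ := h.fixed_mem (i := j) (m := m₁) pj₁
  have gj₂ := h.string_one_mem (a := a) hj (m := m₂) 1 4
    (by simp only [h₂, map_sub, pji, pj₁]; norm_num)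
    (by norm_num) h₃
  have gj₃ := h.fixed_mem (i := j) (m := m₄) (by simp only [h₄, h₃, h₂, map_sub, pji, pjj, pj₁]; norm_num)
  have gj₄ := h.string_one_mem (a := a) hj (m := m₅) 5 8
    (by simp only [h₅, h₄, h₃, h₂, map_sub, pji, pjj, pj₁]; norm_num)
    (by norm_num) h₆
  have gj₅ := h.fixed_mem (i := j) (m := m₇) (by simp only [h₇, h₆, h₅, h₄, h₃, h₂, map_sub, pji, pjj, pj₁]; norm_num)
  have e : (yDiag (D.Y i a) + (([m₂, m₃, m₄, m₅, m₆, m₇] : List (FreeMon I)).map yDiag).sum : D.PiRing) =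
      yDiag m₁ + yDiag m₂ + yDiag m₃ + yDiag m₄ + yDiag m₅ + yDiag m₆ + yDiag m₇ := by
    rw [h₁, zpow_zero, mul_one]
    simp only [List.map_cons, List.map_nil, List.sum_cons, List.sum_nil]
    abel
  refine ⟨[m₂, m₃, m₄, m₅, m₆, m₇], ?_, ?_⟩
  · rw [e]
    refine Subring.mem_inf.2 ⟨?_, ?_⟩
    · convert (add_mem (add_mem gi₁ gi₂) gi₃) using 1
      abel
    · convert (add_mem (add_mem (add_mem (add_mem gj₁ gj₂) gj₃) gj₄) gj₅) using 1
      abel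
  · simp only [List.forall_mem_cons, List.not_mem_nil, false_imp_iff, implies_true, and_true]
    exact ⟨⟨1, 0, by norm_num, w₂⟩, ⟨1, 1, by norm_num, w₃⟩, ⟨2, 1, by norm_num, w₄⟩, ⟨3, 1, by norm_num, w₅⟩, ⟨3, 2, by norm_num, w₆⟩, ⟨4, 2, by norm_num, w₇⟩⟩

/-- Fifteen monomials, with the weights of the adjoint representation plus a trivial one: the weight
zero occurs three times, at m₇, m₈ and m₉. The monomials no longer form a chain, which is why
`string_pair_mem` is needed. -/
theorem hasInvariants_G2_long {i j : I} (hij : i ≠ j) (hc : D.C i j = -1) (hc' : D.C j i = -3) :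
    h.HasInvariants i j := by
  intro a
  have dj := h.d_eq_one j i (by simp [hc'])
  have di := h.d_ratio (n := 3) hc (by simpa using hc')
  have hj : D.qi j = D.q ^ (1 : ℤ) := by rw [qi, dj, zpow_one, pow_one]
  have hi : D.qi i = D.q ^ (3 : ℤ) := by rw [qi, di, dj]; norm_cast
  have pii : ∀ n, nodePart i (D.A i (a * D.q ^ n)) = node a D.q (n - 3) + node a D.q (n + 3) :=
    nodePart_A_self hi
  have pij := nodePart_A_of_one (a := a) (Q := D.q) hij hc
  have pji := nodePart_A_of_three (a := a) hij.symm hc'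
  have pjj : ∀ n, nodePart j (D.A j (a * D.q ^ n)) = node a D.q (n - 1) + node a D.q (n + 1) :=
    nodePart_A_self hj
  obtain ⟨m₁, h₁⟩ : ∃ m, m = D.Y i (a * D.q ^ (0 : ℤ)) := ⟨_, rfl⟩
  have w₁ : D.fundWt i - D.phi m₁ = 0 • D.simpleRoot i + 0 • D.simpleRoot j := by
    rw [h₁]; exact h.fundWt_sub_phi_Y i j _
  have pi₁ : nodePart i m₁ = node a D.q 0 := by rw [h₁]; exact nodePart_Y_node i a D.q 0
  have pj₁ : nodePart j m₁ = 0 := by rw [h₁]; exact nodePart_Y_of_ne hij.symm _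
  obtain ⟨m₂, h₂⟩ : ∃ m, m = m₁ - D.A i (a * D.q ^ (3 : ℤ)) := ⟨_, rfl⟩
  have w₂ := h.fundWt_sub_phi_sub_A_left w₁ h₂
  obtain ⟨m₃, h₃⟩ : ∃ m, m = m₂ - D.A j (a * D.q ^ (6 : ℤ)) := ⟨_, rfl⟩
  have w₃ := h.fundWt_sub_phi_sub_A_right w₂ h₃
  obtain ⟨m₄, h₄⟩ : ∃ m, m = m₃ - D.A j (a * D.q ^ (4 : ℤ)) := ⟨_, rfl⟩
  have w₄ := h.fundWt_sub_phi_sub_A_right w₃ h₄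
  obtain ⟨m₅, h₅⟩ : ∃ m, m = m₄ - D.A j (a * D.q ^ (2 : ℤ)) := ⟨_, rfl⟩
  have w₅ := h.fundWt_sub_phi_sub_A_right w₄ h₅
  obtain ⟨m₆, h₆⟩ : ∃ m, m = m₄ - D.A i (a * D.q ^ (7 : ℤ)) := ⟨_, rfl⟩
  have w₆ := h.fundWt_sub_phi_sub_A_left w₄ h₆
  obtain ⟨m₇, h₇⟩ : ∃ m, m = m₆ - D.A j (a * D.q ^ (2 : ℤ)) := ⟨_, rfl⟩
  have w₇ := h.fundWt_sub_phi_sub_A_right w₆ h₇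
  obtain ⟨m₈, h₈⟩ : ∃ m, m = m₅ - D.A i (a * D.q ^ (5 : ℤ)) := ⟨_, rfl⟩
  have w₈ := h.fundWt_sub_phi_sub_A_left w₅ h₈
  obtain ⟨m₉, h₉⟩ : ∃ m, m = m₆ - D.A j (a * D.q ^ (10 : ℤ)) := ⟨_, rfl⟩
  have w₉ := h.fundWt_sub_phi_sub_A_right w₆ h₉
  obtain ⟨m₁₀, h₁₀⟩ : ∃ m, m = m₇ - D.A i (a * D.q ^ (5 : ℤ)) := ⟨_, rfl⟩
  have w₁₀ := h.fundWt_sub_phi_sub_A_left w₇ h₁₀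
  obtain ⟨m₁₁, h₁₁⟩ : ∃ m, m = m₇ - D.A j (a * D.q ^ (10 : ℤ)) := ⟨_, rfl⟩
  have w₁₁ := h.fundWt_sub_phi_sub_A_right w₇ h₁₁
  obtain ⟨m₁₂, h₁₂⟩ : ∃ m, m = m₁₀ - D.A j (a * D.q ^ (10 : ℤ)) := ⟨_, rfl⟩
  have w₁₂ := h.fundWt_sub_phi_sub_A_right w₁₀ h₁₂
  obtain ⟨m₁₃, h₁₃⟩ : ∃ m, m = m₁₂ - D.A j (a * D.q ^ (8 : ℤ)) := ⟨_, rfl⟩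
  have w₁₃ := h.fundWt_sub_phi_sub_A_right w₁₂ h₁₃
  obtain ⟨m₁₄, h₁₄⟩ : ∃ m, m = m₁₃ - D.A j (a * D.q ^ (6 : ℤ)) := ⟨_, rfl⟩
  have w₁₄ := h.fundWt_sub_phi_sub_A_right w₁₃ h₁₄
  obtain ⟨m₁₅, h₁₅⟩ : ∃ m, m = m₁₄ - D.A i (a * D.q ^ (9 : ℤ)) := ⟨_, rfl⟩
  have w₁₅ := h.fundWt_sub_phi_sub_A_left w₁₄ h₁₅
  have gi₁ := h.string_one_mem (a := a) hi (m := m₁) 0 3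
    (by simpa using pi₁)
    (by norm_num) h₂
  have gi₂ := h.fixed_mem (i := i) (m := m₃) (by simp only [h₃, h₂, map_sub, pii, pij, pi₁]; norm_num)
  have gi₃ := h.string_one_mem (a := a) hi (m := m₄) 4 7
    (by simp only [h₄, h₃, h₂, map_sub, pii, pij, pi₁]; norm_num)
    (by norm_num) h₆
  -- The i-part of m₅ has variables at exponents 2 and 4, whose distance is not 2δ = 6, so the
  -- product of the two strings keeps its four terms.
  have gi₄ := h.string_pair_mem (a := a) hi (m := m₅) (m' := m₈) (m'' := m₇) (m''' := m₁₀) 2 4 5 7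
    (by simp only [h₅, h₄, h₃, h₂, map_sub, pii, pij, pi₁]; norm_num; abel)
    (by norm_num) (by norm_num) h₈ (by rw [h₇, h₆, h₅]; abel) (by rw [h₁₀, h₇, h₆, h₈, h₅]; abel)
  have gi₅ := h.fixed_mem (i := i) (m := m₉) (by simp only [h₉, h₆, h₄, h₃, h₂, map_sub, pii, pij, pi₁]; norm_num)
  have gi₆ := h.string_one_mem (a := a) hi (m := m₁₁) (m' := m₁₂) 2 5
    (by simp only [h₁₁, h₇, h₆, h₄, h₃, h₂, map_sub, pii, pij, pi₁]; norm_num)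
    (by norm_num) (by rw [h₁₂, h₁₀, h₁₁]; abel)
  have gi₇ := h.fixed_mem (i := i) (m := m₁₃) (by simp only [h₁₃, h₁₂, h₁₀, h₇, h₆, h₄, h₃, h₂, map_sub, pii, pij, pi₁]; norm_num; abel)
  have gi₈ := h.string_one_mem (a := a) hi (m := m₁₄) 6 9
    (by simp only [h₁₄, h₁₃, h₁₂, h₁₀, h₇, h₆, h₄, h₃, h₂, map_sub, pii, pij, pi₁]; norm_num; abel)
    (by norm_num) h₁₅
  have gj₁ := h.fixed_mem (i := j) (m := m₁) pj₁
  have gj₂ := h.string_three_mem (a := a) hj (m := m₂) 1 6 4 2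
    (by simp only [h₂, map_sub, pji, pj₁]; norm_num)
    (by norm_num) (by norm_num) (by norm_num) h₃ h₄ h₅
  have gj₃ := h.string_pair_mem (a := a) hj (m := m₆) (m' := m₇) (m'' := m₉) (m''' := m₁₁) 1 9 2 10
    (by simp only [h₆, h₄, h₃, h₂, map_sub, pji, pjj, pj₁]; norm_num; abel)
    (by norm_num) (by norm_num) h₇ h₉ h₁₁
  have gj₄ := h.fixed_mem (i := j) (m := m₈) (by simp only [h₈, h₅, h₄, h₃, h₂, map_sub, pji, pjj, pj₁]; norm_num; abel)
  have gj₅ := h.string_three_mem (a := a) hj (m := m₁₀) 5 10 8 6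
    (by simp only [h₁₀, h₇, h₆, h₄, h₃, h₂, map_sub, pji, pjj, pj₁]; norm_num; abel)
    (by norm_num) (by norm_num) (by norm_num) h₁₂ h₁₃ h₁₄
  have gj₆ := h.fixed_mem (i := j) (m := m₁₅) (by simp only [h₁₅, h₁₄, h₁₃, h₁₂, h₁₀, h₇, h₆, h₄, h₃, h₂, map_sub, pji, pjj, pj₁]; norm_num; abel)
  have e : (yDiag (D.Y i a) + (([m₂, m₃, m₄, m₅, m₆, m₇, m₈, m₉, m₁₀, m₁₁, m₁₂, m₁₃, m₁₄, m₁₅] : List (FreeMon I)).map yDiag).sum : D.PiRing) =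
      yDiag m₁ + yDiag m₂ + yDiag m₃ + yDiag m₄ + yDiag m₅ + yDiag m₆ + yDiag m₇ + yDiag m₈ + yDiag m₉ + yDiag m₁₀ + yDiag m₁₁ + yDiag m₁₂ + yDiag m₁₃ + yDiag m₁₄ + yDiag m₁₅ := by
    rw [h₁, zpow_zero, mul_one]
    simp only [List.map_cons, List.map_nil, List.sum_cons, List.sum_nil]
    abel
  refine ⟨[m₂, m₃, m₄, m₅, m₆, m₇, m₈, m₉, m₁₀, m₁₁, m₁₂, m₁₃, m₁₄, m₁₅], ?_, ?_⟩
  · rw [e]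
    refine Subring.mem_inf.2 ⟨?_, ?_⟩
    · convert (add_mem (add_mem (add_mem (add_mem (add_mem (add_mem (add_mem gi₁ gi₂) gi₃) gi₄) gi₅) gi₆) gi₇) gi₈) using 1
      abel
    · convert (add_mem (add_mem (add_mem (add_mem (add_mem gj₁ gj₂) gj₃) gj₄) gj₅) gj₆) using 1
      abel
  · simp only [List.forall_mem_cons, List.not_mem_nil, false_imp_iff, implies_true, and_true]
    exact ⟨⟨1, 0, by norm_num, w₂⟩, ⟨1, 1, by norm_num, w₃⟩, ⟨1, 2, by norm_num, w₄⟩, ⟨1, 3, by norm_num, w₅⟩, ⟨2, 2, by norm_num, w₆⟩, ⟨2, 3, by norm_num, w₇⟩, ⟨2, 3, by norm_num, w₈⟩, ⟨2, 3, by norm_num, w₉⟩, ⟨3, 3, by norm_num, w₁₀⟩, ⟨2, 4, by norm_num, w₁₁⟩, ⟨3, 4, by norm_num, w₁₂⟩, ⟨3, 5, by norm_num, w₁₃⟩, ⟨3, 6, by norm_num, w₁₄⟩, ⟨4, 6, by norm_num, w₁₅⟩⟩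

theorem hasInvariants {i j : I} (hij : i ≠ j) : h.HasInvariants i j := by
  rcases h.cartan i j hij with hc | hc | hc | hc | hc | hc
  · exact h.hasInvariants_A1_A1 hij hc.1 hc.2
  · exact h.hasInvariants_A2 hij hc.1 hc.2
  · exact h.hasInvariants_B2_long hij hc.1 hc.2
  · exact h.hasInvariants_B2_short hij hc.1 hc.2
  · exact h.hasInvariants_G2_long hij hc.1 hc.2
  · exact h.hasInvariants_G2_short hij hc.1 hc.2

end FiniteType

end QDatum

end

/-! ### From the Coxeter relations to Θ_w. -/

noncomputable section

namespace QDatum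

set_option linter.unusedSectionVars false

variable {I : Type*} [Fintype I] [DecidableEq I] {D : QDatum I}

/-! ### The action of the Weyl group on `Π` -/

/-- For involutions the braid relation and the relation (f i f j)^m = 1 are equivalent. The braid
form feeds Matsumoto's theorem; the power form is the one proved by rigidity. -/
theorem prod_altWord_eq_iff {G : Type*} [Group G] (f : I → G) (hf : ∀ k, f k * f k = 1) (i j : I)
    {m : ℕ} (hm : m = 2 ∨ m = 3 ∨ m = 4 ∨ m = 6) :
    ((altWord i j m).map f).prod = ((altWord j i m).map f).prod ↔ (f i * f j) ^ m = 1 := by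
  have hx : (f i)⁻¹ = f i := inv_eq_of_mul_eq_one_left (hf i)
  have hy : (f j)⁻¹ = f j := inv_eq_of_mul_eq_one_left (hf j)
  have hinv : f j * f i = (f i * f j)⁻¹ := by rw [mul_inv_rev, hx, hy]
  have key : ∀ k : ℕ, (f j * f i) ^ k = (f i * f j) ^ k ↔ (f i * f j) ^ (2 * k) = 1 := by
    intro k
    rw [hinv, inv_pow, inv_eq_iff_mul_eq_one, two_mul, pow_add]
  rcases hm with rfl | rfl | rfl | rfl
  · rw [← key 1]; simp [altWord_two]
  · rw [altWord_three, altWord_three, ← mul_inv_eq_one]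
    simp [pow_succ, mul_assoc, hx, hy]
  · rw [← key 2]; simp [altWord_four, pow_succ, mul_assoc]
  · rw [← key 3]; simp [altWord_six, pow_succ, mul_assoc]

namespace FiniteType

variable (h : D.FiniteType)
include h

theorem thetaHom_altWord {i j : I} (hij : i ≠ j) :
    ((altWord i j (D.coxeterOrder i j)).map h.thetaHom).prod =
      ((altWord j i (D.coxeterOrder i j)).map h.thetaHom).prod := by
  have hm : D.coxeterOrder i j = 2 ∨ D.coxeterOrder i j = 3 ∨ D.coxeterOrder i j = 4 ∨
      D.coxeterOrder i j = 6 := by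
    rcases h.coxeterOrder_cases hij with hc | hc | hc | hc | hc | hc <;> simp [hc.1]
  have h1 : (D.s i * D.s j) ^ D.coxeterOrder i j = 1 :=
    (prod_altWord_eq_iff D.s D.s_mul_self i j hm).1 (h.wordProd_altWord hij)
  have h2 := h.braid_of_hasInvariants (h.hasInvariants hij) (h.hasInvariants hij.symm) h1
  have h3 := (prod_altWord_eq_iff h.thetaInvol (fun k => Units.ext (h.thetaHom_mul_self k)) i j
    hm).2 (Units.ext h2)
  have h4 := congrArg (Units.coeHom (D.PiRing →+* D.PiRing)) h3
  rwa [map_list_prod, map_list_prod, List.map_map, List.map_map] at h4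

/-- The operator `Θ_w` as a ring homomorphism. -/
def ThetaHom (w : D.W) : D.PiRing →+* D.PiRing := h.wordHom (D.reducedWord w)

theorem ThetaHom_apply (w : D.W) (F : D.PiRing) : h.ThetaHom w F = D.Theta w F :=
  (h.Theta_apply w F).symm

/-- `ThetaHom` uses one chosen reduced word; the braid relations and Matsumoto's theorem make the
choice irrelevant. -/
theorem wordHom_eq_ThetaHom {l : List I} (hl : l.length = D.length (D.wordProd l)) :
    h.wordHom l = h.ThetaHom (D.wordProd l) := by
  obtain ⟨h1, h2⟩ := D.reducedWord_spec (D.wordProd l)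
  exact h.prod_map_eq_of_reduced h.thetaHom (fun _ _ => h.thetaHom_altWord) _ _ hl
    (by rw [h1, h2]) h1.symm

theorem ThetaHom_one : h.ThetaHom 1 = 1 := by
  have := h.wordHom_eq_ThetaHom (l := []) (by rw [wordProd_nil, length_one]; rfl)
  rw [wordProd_nil] at this
  rw [← this]; rfl

theorem ThetaHom_mul_s (w : D.W) (i : I) : h.ThetaHom (w * D.s i) = h.ThetaHom w * h.thetaHom i := by
  have key : ∀ w : D.W, D.IsQPos (D.act w (D.simpleRoot i)) →
      h.ThetaHom (w * D.s i) = h.ThetaHom w * h.thetaHom i := by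
    intro w hw
    obtain ⟨h1, h2⟩ := D.reducedWord_spec w
    have e : D.wordProd (D.reducedWord w ++ [i]) = w * D.s i := by
      rw [wordProd_append, wordProd_singleton, h1]
    have := h.wordHom_eq_ThetaHom (l := D.reducedWord w ++ [i])
      (by rw [e, h.length_mul_s_of_isQPos hw, List.length_append, h2]; rfl)
    rw [← e, ← this, wordHom, List.map_append, List.prod_append]
    simp [ThetaHom, wordHom]
  by_cases hw : D.IsQPos (D.act w (D.simpleRoot i))
  · exact key w hw
  · have h1 := key (w * D.s i) (by rwa [h.isQPos_act_mul_s_iff])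
    rw [mul_s_mul_s] at h1
    rw [h1, mul_assoc, h.thetaHom_mul_self, mul_one]

theorem ThetaHom_mul_wordProd (w : D.W) (l : List I) :
    h.ThetaHom (w * D.wordProd l) = h.ThetaHom w * h.wordHom l := by
  induction l generalizing w with
  | nil => rw [wordProd_nil, mul_one]; exact (mul_one _).symm
  | cons i l ih =>
    rw [wordProd_cons, ← mul_assoc, ih, h.ThetaHom_mul_s, mul_assoc]
    rfl

/-- By `stabilizer`, w and w' differ on the right by a word in the s_k with k ≠ i, and each such Θ_k
fixes Y_{i,a}. -/
theorem ThetaHom_Y_congr {w w' : D.W} {i j : I}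
    (e : D.act w (D.fundWt i) = D.act w' (D.fundWt j)) (a : ℂˣ) :
    i = j ∧ h.ThetaHom w (yDiag (D.Y i a)) = h.ThetaHom w' (yDiag (D.Y i a)) := by
  have e' : D.act (w'⁻¹ * w) (D.fundWt i) = D.fundWt j := by
    rw [act_mul, e, act_inv_act]
  obtain ⟨rfl, l, hl, hx⟩ := h.stabilizer e'
  refine ⟨rfl, ?_⟩
  have hw : w = w' * D.wordProd l := by rw [hx, mul_inv_cancel_left]
  rw [hw, h.ThetaHom_mul_wordProd]
  change h.ThetaHom w' (h.wordHom l _) = _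
  congr 1
  clear hw hx
  induction l with
  | nil => rfl
  | cons k l ih =>
    change h.thetaHom k (h.wordHom l _) = _
    rw [ih fun k hk => hl k (List.mem_cons_of_mem _ hk)]
    exact h.thetaHom_Y_of_ne (hl k List.mem_cons_self).symm a

end FiniteType

end QDatum

end

/-! ### Spectral shifts on Π and Π̄', and monomials in Π̄'. -/

noncomputable section

namespace QDatum

set_option linter.unusedSectionVars false

variable {I : Type*} [Fintype I] [DecidableEq I] {D : QDatum I}

/-! ### Homomorphisms induced by maps of monomials -/

section MapSer

variable {G G' : Type*} [AddCommGroup G] [AddCommGroup G'] {wt : G →+ Wt I} {wt' : G' →+ Wt I}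

/-- The ring homomorphism induced by an injective weight-preserving map of monomials. -/
def mapSer (θ : G →+ G') (hinj : Function.Injective θ) (hwt : ∀ x, wt' (θ x) = wt x) (v : D.W) :
    HahnSeries (D.Graded wt v) ℤ →+* HahnSeries (D.Graded wt' v) ℤ :=
  HahnSeries.embDomainRingHom
    ((D.gr wt' v).toAddMonoidHom.comp (θ.comp (D.gr wt v).symm.toAddMonoidHom))
    (fun _ _ e => (D.gr wt v).symm.injective (hinj ((D.gr wt' v).injective e)))
    (fun x y => by
      have e : ∀ z : D.Graded wt v, wt' ((D.gr wt' v).symm (((D.gr wt' v).toAddMonoidHom.comp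
          (θ.comp (D.gr wt v).symm.toAddMonoidHom)) z)) = wt ((D.gr wt v).symm z) :=
        fun z => hwt ((D.gr wt v).symm z)
      have e' : ((D.gr wt' v).toAddMonoidHom.comp (θ.comp (D.gr wt v).symm.toAddMonoidHom)) x =
          ((D.gr wt' v).toAddMonoidHom.comp (θ.comp (D.gr wt v).symm.toAddMonoidHom)) y ↔
            x = y :=
        ⟨fun e => (D.gr wt v).symm.injective (hinj ((D.gr wt' v).injective e)),
          fun e => by rw [e]⟩
      rw [graded_le_iff, graded_le_iff, e', e, e])

variable (θ : G →+ G') (hinj : Function.Injective θ) (hwt : ∀ x, wt' (θ x) = wt x) (v : D.W)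

theorem coeff_mapSer (f : HahnSeries (D.Graded wt v) ℤ) (x : G) :
    (mapSer θ hinj hwt v f).coeff (D.gr wt' v (θ x)) = f.coeff (D.gr wt v x) :=
  HahnSeries.embDomain_coeff (a := D.gr wt v x)

theorem exists_of_coeff_mapSer {f : HahnSeries (D.Graded wt v) ℤ} {y : D.Graded wt' v}
    (hy : (mapSer θ hinj hwt v f).coeff y ≠ 0) :
    ∃ x, y = D.gr wt' v (θ x) ∧ f.coeff (D.gr wt v x) ≠ 0 := by
  by_cases hr : ∃ x, y = D.gr wt' v (θ x)
  · obtain ⟨x, rfl⟩ := hr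
    rw [coeff_mapSer] at hy
    exact ⟨x, rfl, hy⟩
  · refine absurd (HahnSeries.embDomain_of_notMem_range ?_) hy
    rintro ⟨z, rfl⟩
    exact hr ⟨(D.gr wt v).symm z, rfl⟩

theorem mapSer_single (x : G) (r : ℤ) :
    mapSer θ hinj hwt v (HahnSeries.single (D.gr wt v x) r) =
      HahnSeries.single (D.gr wt' v (θ x)) r :=
  HahnSeries.embDomain_single

theorem levGe_mapSer {f : HahnSeries (D.Graded wt v) ℤ} {c : ℚ} (hf : LevGe c f) :
    LevGe c (mapSer θ hinj hwt v f) := by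
  intro y hy
  obtain ⟨x, rfl, hx⟩ := exists_of_coeff_mapSer θ hinj hwt v hy
  rw [lev_apply, vwt_gr, hwt]
  exact hf _ hx

theorem below_mapSer {f : HahnSeries (D.Graded wt v) ℤ} {l : Wt I} (hf : Below l f) :
    Below l (mapSer θ hinj hwt v f) := by
  intro y hy
  obtain ⟨x, rfl, hx⟩ := exists_of_coeff_mapSer θ hinj hwt v hy
  rw [vwt_gr, hwt]
  exact hf _ hx

end MapSer

/-! ### Shifts of monomials -/

/-- `τ_b` on monomials, as a homomorphism. -/
def shiftHom (b : ℂˣ) : FreeMon I →+ FreeMon I :=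
  Finsupp.mapDomain.addMonoidHom fun p : I × ℂˣ => (p.1, p.2 * b)

theorem shiftHom_apply (b : ℂˣ) (m : FreeMon I) : shiftHom b m = shift b m := rfl

theorem shift_add (b : ℂˣ) (m n : FreeMon I) : shift b (m + n) = shift b m + shift b n :=
  map_add (shiftHom b) m n

theorem shift_neg (b : ℂˣ) (m : FreeMon I) : shift b (-m) = -shift b m := map_neg (shiftHom b) m

theorem shift_sub (b : ℂˣ) (m n : FreeMon I) : shift b (m - n) = shift b m - shift b n :=
  map_sub (shiftHom b) m n

theorem shift_single (b : ℂˣ) (i : I) (a : ℂˣ) (n : ℤ) :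
    shift b (Finsupp.single (i, a) n) = Finsupp.single (i, a * b) n :=
  Finsupp.mapDomain_single

theorem shift_Y (b : ℂˣ) (i : I) (a : ℂˣ) : shift b (D.Y i a) = D.Y i (a * b) :=
  shift_single b i a 1

theorem shift_shift (b c : ℂˣ) (m : FreeMon I) : shift b (shift c m) = shift (c * b) m := by
  rw [shift, shift, shift, ← Finsupp.mapDomain_comp]
  congr 1
  funext p
  simp [mul_assoc]

theorem shift_one (m : FreeMon I) : shift 1 m = m := by
  rw [shift]
  simp only [mul_one]
  exact Finsupp.mapDomain_id

theorem shift_zero (b : ℂˣ) : shift b (0 : FreeMon I) = 0 := map_zero (shiftHom b)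

theorem shift_inv_shift (b : ℂˣ) (m : FreeMon I) : shift b⁻¹ (shift b m) = m := by
  rw [shift_shift, mul_inv_cancel, shift_one]

theorem shift_shift_inv (b : ℂˣ) (m : FreeMon I) : shift b (shift b⁻¹ m) = m := by
  rw [shift_shift, inv_mul_cancel, shift_one]

theorem shift_injective (b : ℂˣ) : Function.Injective (shift (I := I) b) :=
  Function.LeftInverse.injective (shift_inv_shift b)

theorem shift_apply (b : ℂˣ) (m : FreeMon I) (i : I) (a : ℂˣ) :
    shift b m (i, a * b) = m (i, a) := by
  have hinj : Function.Injective fun p : I × ℂˣ => (p.1, p.2 * b) := by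
    rintro ⟨i, a⟩ ⟨j, c⟩ e
    simpa using e
  exact Finsupp.mapDomain_apply hinj m (i, a)

theorem phi_shift (b : ℂˣ) (m : FreeMon I) : D.phi (shift b m) = D.phi m := by
  have e : D.phi.comp (shiftHom b) = D.phi := by
    refine Finsupp.addHom_ext fun p n => ?_
    change D.phi (shift b _) = _
    rw [shift_single]
    simp [phi]
  exact DFunLike.congr_fun e m

theorem yToPsi_shift (b : ℂˣ) (m : FreeMon I) :
    D.yToPsi (shift b m) = (shift b (D.yToPsi m).1, (D.yToPsi m).2) := by
  ext1
  · ext ⟨i, a⟩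
    obtain ⟨c, rfl⟩ : ∃ c, a = c * b := ⟨a * b⁻¹, by rw [inv_mul_cancel_right]⟩
    rw [shift_apply, fst_yToPsi, fst_yToPsi, mul_right_comm, shift_apply, mul_right_comm,
      shift_apply]
  · rw [snd_yToPsi, snd_yToPsi, phi_shift]

/-- A nonzero exponent would repeat along the infinite orbit a cⁿ, against finiteness of the
support. -/
theorem eq_zero_of_shift_eq {c : ℂˣ} (hc : ∀ n : ℕ, 0 < n → c ^ n ≠ 1) {m : FreeMon I}
    (hm : shift c m = m) : m = 0 := by
  by_contra hne
  obtain ⟨⟨i, a⟩, ha⟩ := Finsupp.support_nonempty_iff.2 hne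
  have hall : ∀ n : ℕ, m (i, a * c ^ n) = m (i, a) := by
    intro n
    induction n with
    | zero => simp
    | succ n ih =>
      rw [← ih, pow_succ, ← mul_assoc]
      conv_lhs => rw [← hm]
      exact shift_apply c m i _
  have hinj : Function.Injective fun n : ℕ => (i, a * c ^ n) := by
    intro n k e
    simp only [Prod.mk.injEq, mul_right_inj, true_and] at e
    wlog hnk : n ≤ k generalizing n k
    · exact (this e.symm (by omega)).symm
    obtain ⟨r, rfl⟩ := Nat.exists_eq_add_of_le hnk
    rw [pow_add] at e
    have := left_eq_mul.mp e
    by_contra hr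
    exact hc r (by omega) this
  refine Set.infinite_range_of_injective hinj (m.support.finite_toSet.subset ?_)
  rintro _ ⟨n, rfl⟩
  simp only [Finset.mem_coe, Finsupp.mem_support_iff, hall n]
  exact Finsupp.mem_support_iff.1 ha

/-! ### The shift automorphisms -/

/-- The shift `τ_b` on `Π`. -/
def tauY (b : ℂˣ) : D.PiRing →+* D.PiRing :=
  RingHom.pi fun v => (mapSer (shiftHom b) (shift_injective b) (phi_shift b) v).comp
    (Pi.evalRingHom _ v)

theorem tauY_yDiag (b : ℂˣ) (m : FreeMon I) : tauY b (yDiag m : D.PiRing) = yDiag (shift b m) :=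
  funext fun v => mapSer_single _ (shift_injective b) (phi_shift b) v m 1

theorem filt_tauY (b : ℂˣ) : Filt (1 : D.W) (tauY b) := by
  intro F u c hF
  rw [mul_one] at hF
  exact levGe_mapSer _ (shift_injective b) (phi_shift b) u hF

/-- The shift of monomials in the `Ψ_{i,a}` and `[λ]`. -/
def psiShift (b : ℂˣ) : FreeMon I × Wt I →+ FreeMon I × Wt I :=
  AddMonoidHom.prodMap (shiftHom b) (AddMonoidHom.id _)

theorem psiShift_injective (b : ℂˣ) : Function.Injective (psiShift (I := I) b) := by
  rintro ⟨m, l⟩ ⟨m', l'⟩ e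
  obtain ⟨e1, e2⟩ := Prod.mk.inj e
  exact Prod.ext (shift_injective b e1) e2

/-- The shift of series in the `Ψ_{i,a}` and `[λ]`. -/
def tauSer (b : ℂˣ) (v : D.W) : D.PsiSeries v →+* D.PsiSeries v :=
  mapSer (psiShift b) (psiShift_injective b) (fun _ => rfl) v

theorem coeff_tauSer (b : ℂˣ) (v : D.W) (f : D.PsiSeries v) (m : FreeMon I) (l : Wt I) :
    (tauSer b v f).coeff (D.pm v (shift b m) l) = f.coeff (D.pm v m l) :=
  coeff_mapSer (psiShift b) (psiShift_injective b) (fun _ => rfl) v f (m, l)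

theorem tauSer_mem (b : ℂˣ) (v : D.W) : ∀ f ∈ D.YbarSubring v, tauSer b v f ∈ D.YbarSubring v := by
  suffices D.YbarSubring v ≤ (D.YbarSubring v).comap (tauSer b v) from fun f hf => this hf
  refine Subring.closure_le.2 ?_
  rintro f (⟨m, rfl⟩ | hf)
  · refine Subring.subset_closure (Or.inl ⟨shift b m, ?_⟩)
    exact mapSer_single (psiShift b) (psiShift_injective b) (fun _ => rfl) v (m, 0) 1
  · refine Subring.subset_closure (Or.inr fun y hy => ?_)
    obtain ⟨x, rfl, hx⟩ := exists_of_coeff_mapSer (psiShift b) (psiShift_injective b)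
      (fun _ => rfl) v hy
    obtain ⟨m, l, e⟩ := hf _ hx
    have e' : x = ((D.yToPsi m).1, (D.yToPsi m).2 + l) := e
    refine ⟨shift b m, l, ?_⟩
    rw [yToPsi_shift, e']
    rfl

/-- The shift `τ_b` on `Π̄'`. -/
def tau (b : ℂˣ) : D.PiBar →+* D.PiBar :=
  RingHom.pi fun v => ((tauSer b v).restrict _ _ (tauSer_mem b v)).comp (Pi.evalRingHom _ v)

theorem coe_tau (b : ℂˣ) (F : D.PiBar) (v : D.W) :
    (tau b F v : D.PsiSeries v) = tauSer b v (F v) := rfl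

theorem coeff_tau (b : ℂˣ) (F : D.PiBar) (v : D.W) (m : FreeMon I) (l : Wt I) :
    (tau b F v : D.PsiSeries v).coeff (D.pm v (shift b m) l) =
      (F v : D.PsiSeries v).coeff (D.pm v m l) := coeff_tauSer b v _ m l

theorem PiBar.ext_coeff {F F' : D.PiBar}
    (e : ∀ v m l, (F v : D.PsiSeries v).coeff (D.pm v m l) =
      (F' v : D.PsiSeries v).coeff (D.pm v m l)) : F = F' :=
  funext fun v => Subtype.ext (HahnSeries.ext (funext fun x => e v x.1 x.2))

theorem isShift_iff {b : ℂˣ} {F F' : D.PiBar} : D.IsShift b F F' ↔ F' = tau b F := by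
  constructor
  · intro hs
    refine PiBar.ext_coeff fun v m l => ?_
    rw [← shift_shift_inv b m, hs, coeff_tau]
  · rintro rfl v m l
    exact coeff_tau b F v m l

theorem tau_tau (b c : ℂˣ) (F : D.PiBar) : tau b (tau c F) = tau (c * b) F := by
  refine PiBar.ext_coeff fun v m l => ?_
  obtain ⟨n, rfl⟩ : ∃ n, m = shift (c * b) n := ⟨_, (shift_shift_inv (c * b) m).symm⟩
  rw [coeff_tau, ← shift_shift, coeff_tau, coeff_tau]

theorem tau_one (F : D.PiBar) : tau 1 F = F := by
  refine PiBar.ext_coeff fun v m l => ?_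
  conv_lhs => rw [← shift_one m]
  rw [coeff_tau]

/-! ### Monomials in `Π̄'` -/

/-- The inclusion of `Π` into `Π̄'` as a ring homomorphism. -/
def inclHom : D.PiRing →+* D.PiBar :=
  RingHom.pi fun v => (D.inclComp v).comp (Pi.evalRingHom _ v)

theorem psi_add (m n : FreeMon I) : D.psi (m + n) = D.psi m * D.psi n := by
  refine funext fun v => Subtype.ext ?_
  change HahnSeries.single (D.pm v (m + n) 0) 1 =
    HahnSeries.single (D.pm v m 0) (1 : ℤ) * HahnSeries.single (D.pm v n 0) 1
  rw [HahnSeries.single_mul_single, mul_one]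
  congr 1

theorem psi_zero : D.psi 0 = 1 := rfl

theorem psi_mul_neg (m : FreeMon I) : D.psi m * D.psi (-m) = 1 := by
  rw [← psi_add, add_neg_cancel, psi_zero]

theorem br_add (l l' : Wt I) : D.br (l + l') = D.br l * D.br l' := by
  refine funext fun v => Subtype.ext ?_
  change HahnSeries.single (D.pm v 0 (l + l')) 1 =
    HahnSeries.single (D.pm v 0 l) (1 : ℤ) * HahnSeries.single (D.pm v 0 l') 1
  rw [HahnSeries.single_mul_single, mul_one]
  congr 1

theorem br_zero : D.br 0 = 1 := rfl

theorem br_mul_neg (l : Wt I) : D.br l * D.br (-l) = 1 := by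
  rw [← br_add, add_neg_cancel, br_zero]

theorem isUnit_br (l : Wt I) : IsUnit (D.br l) := IsUnit.of_mul_eq_one _ (br_mul_neg l)

theorem isUnit_psi (m : FreeMon I) : IsUnit (D.psi m) := IsUnit.of_mul_eq_one _ (psi_mul_neg m)

theorem tau_psi (b : ℂˣ) (m : FreeMon I) : tau b (D.psi m) = D.psi (shift b m) :=
  funext fun v => Subtype.ext
    (mapSer_single (psiShift b) (psiShift_injective b) (fun _ => rfl) v (m, 0) 1)

theorem tau_br (b : ℂˣ) (l : Wt I) : tau b (D.br l) = D.br l := by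
  refine funext fun v => Subtype.ext
    ((mapSer_single (psiShift b) (psiShift_injective b) (fun _ => rfl) v (0, l) 1).trans ?_)
  change HahnSeries.single (D.pm v (shift b 0) l) 1 = HahnSeries.single (D.pm v 0 l) 1
  rw [shift_zero]

theorem coe_inclHom (F : D.PiRing) (v : D.W) : (inclHom F v : D.PsiSeries v) =
    mapSer D.yToPsi D.yToPsi_injective D.snd_yToPsi v (F v) := rfl

theorem tau_inclHom (b : ℂˣ) (F : D.PiRing) : tau b (inclHom F) = inclHom (tauY b F) := by
  refine funext fun v => Subtype.ext (HahnSeries.ext (funext fun y => ?_))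
  rw [coe_tau, coe_inclHom, coe_inclHom]
  change _ = (mapSer D.yToPsi D.yToPsi_injective D.snd_yToPsi v
    (mapSer (shiftHom b) (shift_injective b) (phi_shift b) v (F v))).coeff y
  have key : ∀ m : FreeMon I, psiShift b (D.yToPsi m) = D.yToPsi (shiftHom b m) := fun m =>
    (yToPsi_shift b m).symm
  by_cases hy : ∃ m : FreeMon I,
      y = D.gr (AddMonoidHom.snd (FreeMon I) (Wt I)) v (D.yToPsi (shiftHom b m))
  · obtain ⟨m, rfl⟩ := hy
    refine (congrArg (fun z => (tauSer b v (mapSer D.yToPsi D.yToPsi_injective D.snd_yToPsi v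
      (F v))).coeff (D.gr (AddMonoidHom.snd (FreeMon I) (Wt I)) v z)) (key m).symm).trans ?_
    refine (coeff_mapSer (psiShift b) (psiShift_injective b) (fun _ => rfl) v _ _).trans ?_
    exact (coeff_mapSer _ _ _ v _ _).trans
      ((coeff_mapSer _ _ _ v _ _).trans (coeff_mapSer _ _ _ v _ _)).symm
  · have h1 : (tauSer b v (mapSer D.yToPsi D.yToPsi_injective D.snd_yToPsi v (F v))).coeff y = 0 := by
      by_contra hne
      obtain ⟨x, rfl, hx⟩ := exists_of_coeff_mapSer _ _ _ v hne
      obtain ⟨m, e, -⟩ := exists_of_coeff_mapSer _ _ _ v hx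
      have e' : x = D.yToPsi m := e
      exact hy ⟨m, by rw [e', key]⟩
    have h2 : (mapSer D.yToPsi D.yToPsi_injective D.snd_yToPsi v
        (mapSer (shiftHom b) (shift_injective b) (phi_shift b) v (F v))).coeff y = 0 := by
      by_contra hne
      obtain ⟨x, rfl, hx⟩ := exists_of_coeff_mapSer _ _ _ v hne
      obtain ⟨m, e, -⟩ := exists_of_coeff_mapSer _ _ _ v hx
      have e' : x = shiftHom b m := e
      exact hy ⟨m, by rw [e']⟩
    rw [h1, h2]

theorem inclHom_yDiag (m : FreeMon I) :
    inclHom (yDiag m : D.PiRing) = D.psi (D.yToPsi m).1 * D.br (D.phi m) := by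
  refine funext fun v => Subtype.ext ?_
  rw [coe_inclHom]
  refine (mapSer_single D.yToPsi D.yToPsi_injective D.snd_yToPsi v m 1).trans ?_
  change _ = HahnSeries.single (D.pm v (D.yToPsi m).1 0) (1 : ℤ) *
    HahnSeries.single (D.pm v 0 (D.phi m)) 1
  rw [HahnSeries.single_mul_single, mul_one, ← snd_yToPsi]
  have e : D.yToPsi m = ((D.yToPsi m).1, 0) + (0, (D.yToPsi m).2) := by simp
  exact congrArg (fun z => HahnSeries.single
    (D.gr (AddMonoidHom.snd (FreeMon I) (Wt I)) v z) (1 : ℤ)) e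

end QDatum

end

/-! ### Multiplicativity of ϖ, inverses of 1 - [-β], shift-invariant elements. -/

noncomputable section

namespace QDatum

set_option linter.unusedSectionVars false

variable {I : Type*} [Fintype I] [DecidableEq I] {D : QDatum I}

/-! ### The specialization `ϖ` -/

/-- Convergent formal sums of weights. -/
abbrev WtSeries (D : QDatum I) (v : D.W) : Type _ :=
  HahnSeries (D.Graded (AddMonoidHom.id (Wt I)) v) ℤ

/-- The monomial `[λ]` as a formal sum of weights. -/
def wtDiag (l : Wt I) : ∀ v : D.W, D.WtSeries v := fun v =>
  HahnSeries.single (D.gr (AddMonoidHom.id (Wt I)) v l) 1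

theorem wtDiag_add (l l' : Wt I) :
    (wtDiag (l + l') : ∀ v : D.W, D.WtSeries v) = wtDiag l * wtDiag l' := by
  funext v
  change _ = HahnSeries.single (D.gr (AddMonoidHom.id (Wt I)) v l) (1 : ℤ) *
    HahnSeries.single (D.gr (AddMonoidHom.id (Wt I)) v l') 1
  rw [HahnSeries.single_mul_single, mul_one]
  rfl

theorem wtDiag_zero : (wtDiag 0 : ∀ v : D.W, D.WtSeries v) = 1 := rfl

/-- The inclusion of formal sums of weights into `Π̄'`. -/
def brHom : (∀ v : D.W, D.WtSeries v) →+* D.PiBar :=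
  RingHom.pi fun v => ((mapSer (wt := AddMonoidHom.id (Wt I))
    (wt' := AddMonoidHom.snd (FreeMon I) (Wt I)) (AddMonoidHom.inr (FreeMon I) (Wt I))
    (fun _ _ e => (Prod.mk.inj e).2) (fun _ => rfl) v).codRestrict (D.YbarSubring v) (fun f => by
      refine Subring.subset_closure (Or.inr fun y hy => ?_)
      obtain ⟨l, rfl, -⟩ := exists_of_coeff_mapSer _ _ _ v hy
      refine ⟨0, l, ?_⟩
      rw [map_zero, Prod.snd_zero, zero_add]
      rfl)).comp (Pi.evalRingHom _ v)

theorem brHom_wtDiag (l : Wt I) : brHom (wtDiag l) = D.br l :=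
  funext fun v => Subtype.ext (mapSer_single (AddMonoidHom.inr (FreeMon I) (Wt I)) _ _ v l 1)

namespace FiniteType

variable (h : D.FiniteType)
include h

/-- Setting the Ψ_{i,a} to 1 preserves weights, so ϖ is a continuous extension of a multiplicative
map on monomials. This makes it a ring homomorphism. -/
theorem isKernel_varpi (v : D.W) :
    IsKernel (AddMonoidHom.snd (FreeMon I) (Wt I)) v
      (fun x : FreeMon I × Wt I => (wtDiag x.2 v : D.WtSeries v)) where
  zero := rfl
  add x y := congrFun (wtDiag_add x.2 y.2) v
  below _ := Below.single (D.wle_refl _)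

/-- The specialization `ϖ` as a ring homomorphism. -/
def varpiHom : D.PiBar →+* ∀ v : D.W, D.WtSeries v :=
  RingHom.pi fun v => (((h.isKernel_varpi v).extHom h).comp (D.YbarSubring v).subtype).comp
    (Pi.evalRingHom _ v)

theorem finite_weight (v : D.W) (f : D.PsiSeries v) (l : Wt I) :
    (Function.support fun m : FreeMon I => f.coeff (D.pm v m l)).Finite := by
  refine Set.Finite.of_finite_image (f := fun m => D.pm v m l) ?_
    (fun m _ m' _ e => (Prod.mk.inj e).1)
  refine ((h.conv_of_isPWO f.isPWO_support).2 (-D.ht (D.act v l))).subset ?_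
  rintro _ ⟨m, hm, rfl⟩
  exact ⟨hm, le_rfl⟩

theorem coeff_varpiHom (F : D.PiBar) (v : D.W) (l : Wt I) :
    (h.varpiHom F v).coeff (D.gr (AddMonoidHom.id (Wt I)) v l) = D.varpi v (F v) l := by
  classical
  refine ((h.isKernel_varpi v).coeff_ext h _ _).trans ?_
  rw [varpi]
  have e : ∀ x : FreeMon I × Wt I, (F v : D.PsiSeries v).coeff (D.gr _ v x) *
      (wtDiag x.2 v : D.WtSeries v).coeff (D.gr (AddMonoidHom.id (Wt I)) v l) =
      if x.2 = l then (F v : D.PsiSeries v).coeff (D.pm v x.1 l) else 0 := by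
    rintro ⟨m, l'⟩
    split_ifs with hl
    · simp only at hl
      subst hl
      rw [wtDiag, HahnSeries.coeff_single_same, mul_one]
      rfl
    · rw [wtDiag, HahnSeries.coeff_single_of_ne, mul_zero]
      exact fun e => hl e.symm
  refine (finsum_congr e).trans ?_
  rw [← finsum_mem_range (f := fun x : FreeMon I × Wt I =>
    (F v : D.PsiSeries v).coeff (D.pm v x.1 l)) (g := fun m : FreeMon I => (m, l))
    (fun m m' e => (Prod.mk.inj e).1), finsum_mem_def]
  refine finsum_congr fun x => ?_
  rw [Set.indicator_apply]
  refine if_congr ⟨fun e => ⟨x.1, Prod.ext rfl e.symm⟩, ?_⟩ rfl rfl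
  rintro ⟨m, rfl⟩
  rfl

theorem varpiEqOne_iff {F : D.PiBar} : D.VarpiEqOne F ↔ h.varpiHom F = 1 := by
  classical
  have e1 : ∀ (v : D.W) (l : Wt I), (1 : D.WtSeries v).coeff (D.gr (AddMonoidHom.id (Wt I)) v l) =
      (Pi.single 0 1 : Wt I → ℤ) l := by
    intro v l
    rw [HahnSeries.coeff_one, Pi.single_apply]
    exact if_congr Iff.rfl rfl rfl
  constructor
  · intro hF
    refine funext fun v => HahnSeries.ext (funext fun x => ?_)
    obtain ⟨l, rfl⟩ := (D.gr (AddMonoidHom.id (Wt I)) v).surjective x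
    rw [h.coeff_varpiHom, hF v]
    exact (e1 v l).symm
  · intro hF v
    funext l
    rw [← h.coeff_varpiHom, hF]
    exact e1 v l

theorem varpiHom_psi (m : FreeMon I) : h.varpiHom (D.psi m) = 1 := by
  refine funext fun v => ((h.isKernel_varpi v).ext_single h (m, 0) 1).trans ?_
  rw [one_smul]
  rfl

theorem varpiHom_br (l : Wt I) : h.varpiHom (D.br l) = wtDiag l := by
  refine funext fun v => ((h.isKernel_varpi v).ext_single h (0, l) 1).trans ?_
  rw [one_smul]

theorem varpiHom_tau (b : ℂˣ) (F : D.PiBar) : h.varpiHom (tau b F) = h.varpiHom F := by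
  refine funext fun v => HahnSeries.ext (funext fun x => ?_)
  obtain ⟨l, rfl⟩ := (D.gr (AddMonoidHom.id (Wt I)) v).surjective x
  rw [h.coeff_varpiHom, h.coeff_varpiHom, varpi, varpi]
  refine (finsum_comp_equiv (Equiv.mk (shift b) (shift b⁻¹) (shift_inv_shift b)
    (shift_shift_inv b))).symm.trans (finsum_congr fun m => ?_)
  exact coeff_tau b F v m l

/-! ### Invertible elements -/

/-- In the component v either v(b) > 0 and 1 - [-b] has leading term 1, or v(b) < 0 and 1 - [-b] =
-[-b](1 - [b]). The result also ensures that `Ring.inverse` in `invOneSub` is a true inverse. -/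
theorem isUnit_one_sub_br {b : Wt I} (hb : b ∈ D.roots) : IsUnit (1 - D.br (-b)) := by
  obtain ⟨w, i, rfl⟩ := hb
  set b := D.act w (D.simpleRoot i) with hb
  rw [← brHom_wtDiag, ← map_one brHom, ← map_sub]
  refine IsUnit.map brHom (Pi.isUnit_iff.2 fun v => ?_)
  have hv : D.act v b = D.act (v * w) (D.simpleRoot i) := by rw [hb, act_mul]
  have key : ∀ c : Wt I, D.IsQPos (D.act v c) → D.act v c ≠ 0 →
      IsUnit (1 - wtDiag (-c) v : D.WtSeries v) := by
    intro c hc hc0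
    rw [sub_eq_add_neg]
    refine h.isUnit_of_isOneAdd (h.isOneAdd_of_below hc hc0 (Below.neg (Below.single ?_)))
    rw [vwt_gr, ← act_neg]
    exact D.wle_refl _
  rw [Pi.sub_apply, Pi.one_apply]
  by_cases hp : D.IsQPos (D.act v b)
  · exact key b hp (by rw [hv]; exact h.act_simpleRoot_ne_zero _ _)
  · have h1 : IsUnit (wtDiag (-b) v : D.WtSeries v) := by
      refine IsUnit.of_mul_eq_one (wtDiag b v) ?_
      rw [← Pi.mul_apply, ← wtDiag_add, neg_add_cancel]
      rfl
    have h2 := key (-b) (by rw [act_neg, hv]; rw [hv] at hp; exact (h.isQPos_neg_iff _ _).2 hp)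
      (by rw [act_neg, hv]; exact neg_ne_zero.2 (h.act_simpleRoot_ne_zero _ _))
    have e : (1 - wtDiag (-b) v : D.WtSeries v) = -wtDiag (-b) v * (1 - wtDiag (- -b) v) := by
      have : (wtDiag (-b) v * wtDiag (- -b) v : D.WtSeries v) = 1 := by
        rw [← Pi.mul_apply, ← wtDiag_add, add_neg_cancel]; rfl
      linear_combination (-1 : D.WtSeries v) * this
    rw [e]
    exact h1.neg.mul h2

theorem one_sub_br_mul_invOneSub {b : Wt I} (hb : b ∈ D.roots) :
    (1 - D.br (-b)) * D.invOneSub b = 1 :=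
  Ring.mul_inverse_cancel _ (h.isUnit_one_sub_br hb)

theorem isUnit_invOneSub {b : Wt I} (hb : b ∈ D.roots) : IsUnit (D.invOneSub b) :=
  IsUnit.of_mul_eq_one _ ((mul_comm _ _).trans (h.one_sub_br_mul_invOneSub hb))

/-! ### Elements invariant under shifts -/

/-- An element of `Π̄'` which is invariant under a shift of infinite order and specializes to `1`
is equal to `1`. -/
theorem eq_one_of_tau_eq {c : ℂˣ} (hc : ∀ n : ℕ, 0 < n → c ^ n ≠ 1) {F : D.PiBar}
    (hF : tau c F = F) (hF' : h.varpiHom F = 1) : F = 1 := by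
  classical
  -- A monomial with nontrivial Ψ-part would occur together with all its shifts, infinitely many
  -- monomials of the same weight.
  have hz : ∀ v m l, (F v : D.PsiSeries v).coeff (D.pm v m l) ≠ 0 → m = 0 := by
    intro v m l hm
    by_contra hne
    have hall : ∀ n : ℕ, (F v : D.PsiSeries v).coeff (D.pm v (shift (c ^ n) m) l) ≠ 0 := by
      intro n
      induction n with
      | zero => rwa [pow_zero, shift_one]
      | succ n ih =>
        rw [pow_succ, ← shift_shift, ← hF, coeff_tau]
        exact ih
    have hinj : Function.Injective fun n : ℕ => shift (c ^ n) m := by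
      intro n k e
      simp only at e
      wlog hnk : n ≤ k generalizing n k
      · exact (this e.symm (by omega)).symm
      obtain ⟨r, rfl⟩ := Nat.exists_eq_add_of_le hnk
      rw [add_comm n r, pow_add, ← shift_shift] at e
      have e' := (shift_injective _ e).symm
      by_contra hr
      refine hne (eq_zero_of_shift_eq (c := c ^ r) (fun n hn => ?_) e')
      rw [← pow_mul]
      exact hc _ (Nat.mul_pos (by omega) hn)
    refine Set.infinite_range_of_injective hinj ((h.finite_weight v (F v) l).subset ?_)
    rintro _ ⟨n, rfl⟩
    exact hall n
  -- Only monomials [λ] remain, and on these ϖ loses no information.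
  refine PiBar.ext_coeff fun v m l => ?_
  change _ = (1 : D.PsiSeries v).coeff (D.pm v m l)
  by_cases hm : m = 0
  · subst hm
    have h1 : D.varpi v (F v) l = (F v : D.PsiSeries v).coeff (D.pm v 0 l) := by
      rw [varpi]
      exact finsum_eq_single _ 0 fun m hm => by
        by_contra hne
        exact hm (hz v m l hne)
    rw [← h1, h.varpiEqOne_iff.2 hF' v, HahnSeries.coeff_one, Pi.single_apply]
    refine if_congr ⟨fun e => by rw [e]; rfl, fun e => (Prod.mk.inj e).2⟩ rfl rfl
  · rw [HahnSeries.coeff_one, if_neg (show ¬ D.pm v m l = 0 from fun e => hm (Prod.mk.inj e).1)]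
    by_contra hne
    exact hm (hz v m l hne)

/-! ### Shifts and the Weyl group action -/

theorem shift_nbr (b : ℂˣ) (i : I) (a : ℂˣ) : shift b (D.nbr i a) = D.nbr i (a * b) := by
  rw [nbr, nbr, ← shiftHom_apply, map_sum]
  refine Finset.sum_congr rfl fun j _ => ?_
  rw [map_list_sum, List.map_map]
  congr 1
  refine List.map_congr_left fun t _ => ?_
  change shift b (D.Y j (a * t)) = _
  rw [shift_Y, mul_right_comm]

theorem shift_A (b : ℂˣ) (i : I) (a : ℂˣ) : shift b (D.A i a) = D.A i (a * b) := by
  rw [A_eq, A_eq, shift_sub, shift_add, shift_Y, shift_Y, h.shift_nbr, mul_right_comm a b,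
    mul_right_comm a b]

theorem shift_sigmaMonE (b : ℂˣ) (i : I) (a : ℂˣ) (k : ℕ) :
    shift b (D.sigmaMonE i a k) = D.sigmaMonE i (a * b) k := by
  rw [sigmaMonE, sigmaMonE, shift_neg, ← shiftHom_apply, map_sum]
  refine congrArg Neg.neg (Finset.sum_congr rfl fun j _ => ?_)
  rw [shiftHom_apply, h.shift_A, mul_right_comm]

theorem shift_sigmaMonS (b : ℂˣ) (i : I) (a : ℂˣ) (k : ℕ) :
    shift b (D.sigmaMonS i a k) = D.sigmaMonS i (a * b) k := by
  rw [sigmaMonS, sigmaMonS, ← shiftHom_apply, map_sum]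
  refine Finset.sum_congr rfl fun j _ => ?_
  rw [shiftHom_apply, h.shift_A, mul_right_comm]

theorem tauY_SigmaPi (b : ℂˣ) (i : I) (a : ℂˣ) :
    tauY b (D.SigmaPi i a) = D.SigmaPi i (a * b) := by
  classical
  refine funext fun u => HahnSeries.ext (funext fun x => ?_)
  obtain ⟨m, rfl⟩ : ∃ m, x = D.gr D.phi u (shift b m) :=
    ⟨shift b⁻¹ ((D.gr D.phi u).symm x), by rw [shift_shift_inv, AddEquiv.apply_symm_apply]⟩
  refine (coeff_mapSer (shiftHom b) (shift_injective b) (phi_shift b) u _ m).trans ?_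
  change (D.Sigma u i a).coeff _ = (D.Sigma u i (a * b)).coeff _
  by_cases hp : D.IsQPos (D.act u (D.simpleRoot i))
  · rw [h.coeff_Sigma_of_pos hp, h.coeff_Sigma_of_pos hp]
    refine if_congr (exists_congr fun k => ?_) rfl rfl
    rw [(D.gr D.phi u).injective.eq_iff, (D.gr D.phi u).injective.eq_iff, ← h.shift_sigmaMonE,
      (shift_injective b).eq_iff]
  · rw [h.coeff_Sigma_of_neg hp, h.coeff_Sigma_of_neg hp]
    refine if_congr (exists_congr fun k => ?_) rfl rfl
    rw [(D.gr D.phi u).injective.eq_iff, (D.gr D.phi u).injective.eq_iff, ← h.shift_sigmaMonS,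
      (shift_injective b).eq_iff]

/-- Both composites are filtered and agree on the variables, so rigidity applies with no lower
terms. -/
theorem tauY_thetaHom (b : ℂˣ) (i : I) (F : D.PiRing) :
    tauY b (h.thetaHom i F) = h.thetaHom i (tauY b F) := by
  funext u
  have h1 : Filt (D.s i) (tauY b * h.thetaHom i) := by
    have := (filt_tauY b).mul (h.filt_thetaHom i)
    rwa [one_mul] at this
  have h2 : Filt (D.s i) (h.thetaHom i * tauY b) := by
    have := (h.filt_thetaHom i).mul (filt_tauY b)
    rwa [mul_one] at this
  refine h.rigidity (u := u) h1 h2 (fun p : I × ℂˣ => D.Y p.1 p.2) (fun _ => []) D.closure_range_Y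
    (by simp) ?_ F
  rintro ⟨j, a⟩
  refine congrFun ?_ u
  simp only [List.map_nil, List.sum_nil, add_zero]
  change tauY b (h.thetaHom i (yDiag (D.Y j a))) = h.thetaHom i (tauY b (yDiag (D.Y j a)))
  rw [tauY_yDiag, shift_Y]
  by_cases hj : j = i
  · subst hj
    have e1 := congrArg (tauY b) (h.thetaHom_Y_mul j a)
    rw [map_mul, map_mul, h.tauY_SigmaPi, h.tauY_SigmaPi, tauY_yDiag, shift_sub, shift_Y,
      h.shift_A] at e1
    have e2 := h.thetaHom_Y_mul j (a * b)
    rw [mul_right_comm a b, mul_right_comm a b] at e2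
    exact (h.isUnit_SigmaPi j _).mul_right_cancel (e1.trans e2.symm)
  · rw [h.thetaHom_Y_of_ne hj, h.thetaHom_Y_of_ne hj, tauY_yDiag, shift_Y]

theorem tauY_ThetaHom (b : ℂˣ) (w : D.W) (F : D.PiRing) :
    tauY b (h.ThetaHom w F) = h.ThetaHom w (tauY b F) := by
  rw [ThetaHom]
  induction D.reducedWord w with
  | nil => rfl
  | cons i l ih =>
    change tauY b (h.thetaHom i (h.wordHom l F)) = h.thetaHom i (h.wordHom l (tauY b F))
    rw [h.tauY_thetaHom, ih]

/-- `Θ_w` followed by the inclusion into `Π̄'`. -/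
def thetaBar (w : D.W) : D.PiRing →+* D.PiBar := inclHom.comp (h.ThetaHom w)

theorem tau_thetaBar (b : ℂˣ) (w : D.W) (F : D.PiRing) :
    tau b (h.thetaBar w F) = h.thetaBar w (tauY b F) := by
  change tau b (inclHom (h.ThetaHom w F)) = inclHom (h.ThetaHom w (tauY b F))
  rw [tau_inclHom, h.tauY_ThetaHom]

theorem below_thetaHom {i : I} {F : D.PiRing} {u : D.W} {l : Wt I}
    (hF : Below l (F (u * D.s i))) : Below l (h.thetaHom i F u) :=
  (h.isKernel_thetaMon u i).ext_below h hF

theorem below_wordHom (t : List I) {F : D.PiRing} {u : D.W} {l : Wt I}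
    (hF : Below l (F (u * D.wordProd t))) : Below l (h.wordHom t F u) := by
  induction t generalizing u with
  | nil => rwa [wordProd_nil, mul_one] at hF
  | cons i t ih =>
    rw [wordProd_cons, ← mul_assoc] at hF
    exact h.below_thetaHom (ih hF)

theorem below_thetaBar {w : D.W} {F : D.PiRing} {u : D.W} {l : Wt I}
    (hF : Below l (F (u * w))) : Below l (h.thetaBar w F u : D.PsiSeries u) := by
  refine below_mapSer D.yToPsi D.yToPsi_injective D.snd_yToPsi u (h.below_wordHom _ ?_)
  rwa [(D.reducedWord_spec w).1]

end FiniteType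

end QDatum

end

/-! ### The difference equation for ΨQ: uniqueness and the neighbour product. -/

noncomputable section

namespace QDatum

set_option linter.unusedSectionVars false

variable {I : Type*} [Fintype I] [DecidableEq I] {D : QDatum I}

/-! ### Leading monomials in the component of the identity -/

theorem leadingEqOne_iff {F : D.PiBar} : D.LeadingEqOne F ↔ IsOneAdd (F 1 : D.PsiSeries 1) := Iff.rfl

theorem LeadingEqOne.mul {F F' : D.PiBar} (hF : D.LeadingEqOne F) (hF' : D.LeadingEqOne F') :
    D.LeadingEqOne (F * F') := IsOneAdd.mul hF hF'

theorem LeadingEqOne.one : D.LeadingEqOne 1 := IsOneAdd.one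

theorem FiniteType.leadingEqOne_of_mul_eq_one (h : D.FiniteType) {F F' : D.PiBar}
    (hF : D.LeadingEqOne F) (e : F * F' = 1) : D.LeadingEqOne F' :=
  h.isOneAdd_of_mul_eq_one hF (congrArg Subtype.val (congrFun e 1))

/-- The component of `F` at the identity is a monomial in the `Ψ_{i,a}` plus lower terms. -/
def HasPsiLead (F : D.PiBar) : Prop := ∃ m : FreeMon I, D.LeadingEqOne (D.psi (-m) * F)

theorem LeadingEqOne.hasPsiLead {F : D.PiBar} (hF : D.LeadingEqOne F) : HasPsiLead F :=
  ⟨0, by rwa [neg_zero, psi_zero, one_mul]⟩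

theorem HasPsiLead.mul {F F' : D.PiBar} (hF : HasPsiLead F) (hF' : HasPsiLead F') :
    HasPsiLead (F * F') := by
  obtain ⟨m, hm⟩ := hF
  obtain ⟨m', hm'⟩ := hF'
  refine ⟨m + m', ?_⟩
  rw [neg_add, psi_add, mul_mul_mul_comm]
  exact hm.mul hm'

theorem FiniteType.hasPsiLead_of_mul_eq_one (h : D.FiniteType) {F F' : D.PiBar}
    (hF : HasPsiLead F) (e : F * F' = 1) : HasPsiLead F' := by
  obtain ⟨m, hm⟩ := hF
  refine ⟨-m, h.leadingEqOne_of_mul_eq_one hm ?_⟩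
  rw [neg_neg, mul_mul_mul_comm, mul_comm (D.psi (-m)), psi_mul_neg, e, one_mul]

theorem HasPsiLead.list_prod {l : List D.PiBar} (hl : ∀ F ∈ l, HasPsiLead F) :
    HasPsiLead l.prod :=
  List.prod_induction HasPsiLead (fun _ _ => HasPsiLead.mul) LeadingEqOne.one.hasPsiLead hl

theorem HasPsiLead.prod {ι : Type*} {s : Finset ι} {F : ι → D.PiBar}
    (hF : ∀ k ∈ s, HasPsiLead (F k)) : HasPsiLead (∏ k ∈ s, F k) :=
  Finset.prod_induction F HasPsiLead (fun _ _ => HasPsiLead.mul) LeadingEqOne.one.hasPsiLead hF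

/-- Comparing the two normalizations, the monomial Ψ^{m-m'} occurs in a series with leading term 1.
It has weight 0, and the only monomial of weight 0 there is 1. -/
theorem psiLead_unique {F : D.PiBar} {m m' : FreeMon I}
    (hm : D.LeadingEqOne (D.psi (-m) * F)) (hm' : D.LeadingEqOne (D.psi (-m') * F)) : m = m' := by
  have e : D.psi (-m') * F = D.psi (m - m') * (D.psi (-m) * F) := by
    rw [← mul_assoc, ← psi_add]; congr 2; abel
  have hc : (((D.psi (-m') * F) 1 : D.Ybar 1) : D.PsiSeries 1).coeff (D.pm 1 (m - m') 0) = 1 := by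
    rw [e]
    change (HahnSeries.single (D.pm 1 (m - m') 0) (1 : ℤ) *
      (((D.psi (-m) * F) 1 : D.Ybar 1) : D.PsiSeries 1)).coeff _ = 1
    have := HahnSeries.coeff_single_mul_add (r := (1 : ℤ))
      (x := (((D.psi (-m) * F) 1 : D.Ybar 1) : D.PsiSeries 1)) (a := 0) (b := D.pm 1 (m - m') 0)
    rw [zero_add] at this
    rw [this, hm.1, one_mul]
  rcases hm'.2 (D.pm 1 (m - m') 0) (by rw [hc]; exact one_ne_zero) with h0 | h0
  · exact (sub_eq_zero.1 (Prod.mk.inj h0.symm).1)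
  · exact absurd h0.1 h0.2

theorem ringHom_inverse {R S : Type*} [CommRing R] [CommRing S] (f : R →+* S) {x : R}
    (hx : IsUnit x) : f (Ring.inverse x) = Ring.inverse (f x) := by
  have h1 : f x * f (Ring.inverse x) = 1 := by
    rw [← map_mul, Ring.mul_inverse_cancel _ hx, map_one]
  have h2 := Ring.inverse_mul_cancel _ (hx.map f)
  calc f (Ring.inverse x) = Ring.inverse (f x) * f x * f (Ring.inverse x) := by rw [h2, one_mul]
    _ = Ring.inverse (f x) := by rw [mul_assoc, h1, mul_one]

/-! ### The functions `Ψ_{w(ω_i),a} Q_{w(ω_i),a}` -/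

/-- The conditions which characterize `a ↦ Ψ_{w(ω_i),a} Q_{w(ω_i),a}`. -/
structure IsSol (h : D.FiniteType) (w : D.W) (i : I) (F : ℂˣ → D.PiBar) : Prop where
  tau_eq : ∀ a b, tau b (F a) = F (a * b)
  isUnit : ∀ a, IsUnit (F a)
  varpi_eq : ∀ a, h.varpiHom (F a) = 1
  lead : ∀ a, HasPsiLead (F a)
  eq : ∀ a, h.thetaBar w (yDiag (D.Y i a)) * F (a * D.qi i) =
    D.br (D.act w (D.fundWt i)) * F (a * (D.qi i)⁻¹)

theorem qi_sq_pow_ne_one (i : I) (n : ℕ) (hn : 0 < n) : (D.qi i ^ 2) ^ n ≠ 1 := by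
  rw [qi, ← pow_mul, ← pow_mul]
  exact D.q_pow_ne_one _ (Nat.mul_pos (D.d_pos i) (Nat.mul_pos two_pos hn))

namespace FiniteType

variable (h : D.FiniteType)
include h

variable {h}

/-- Θ_w(Y_{i,a}) cancels from the quotient F/F', which therefore takes the same value at aq_i and
aq_i⁻¹. It is invariant under the shift by q_i² and specializes to 1, so `eq_one_of_tau_eq` applies.
-/
theorem _root_.QDatum.IsSol.unique {w : D.W} {i : I} {F F' : ℂˣ → D.PiBar} (hF : IsSol h w i F)
    (hF' : IsSol h w i F') : F = F' := by
  have h1 : ∀ a, F (a * (D.qi i)⁻¹) * F' (a * D.qi i) = F (a * D.qi i) * F' (a * (D.qi i)⁻¹) := by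
    intro a
    refine (isUnit_br (D.act w (D.fundWt i))).mul_left_cancel ?_
    linear_combination F (a * D.qi i) * hF'.eq a - F' (a * D.qi i) * hF.eq a
  have hinv : ∀ a, F' a * Ring.inverse (F' a) = 1 := fun a =>
    Ring.mul_inverse_cancel _ (hF'.isUnit a)
  have h2 : ∀ a, F (a * (D.qi i)⁻¹) * Ring.inverse (F' (a * (D.qi i)⁻¹)) = 1 := by
    intro a
    refine h.eq_one_of_tau_eq (c := D.qi i ^ 2) (qi_sq_pow_ne_one i) ?_ ?_
    · rw [map_mul, ringHom_inverse _ (hF'.isUnit _), hF.tau_eq, hF'.tau_eq,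
        show a * (D.qi i)⁻¹ * (D.qi i) ^ 2 = a * D.qi i by group]
      linear_combination (-(Ring.inverse (F' (a * (D.qi i)⁻¹)) * Ring.inverse (F' (a * D.qi i)))) *
        h1 a - F (a * D.qi i) * Ring.inverse (F' (a * D.qi i)) * hinv (a * (D.qi i)⁻¹)
        + F (a * (D.qi i)⁻¹) * Ring.inverse (F' (a * (D.qi i)⁻¹)) * hinv (a * D.qi i)
    · rw [map_mul, ringHom_inverse _ (hF'.isUnit _), hF.varpi_eq, hF'.varpi_eq, Ring.inverse_one,
        one_mul]
  funext a
  have h3 := h2 (a * D.qi i)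
  rw [mul_inv_cancel_right] at h3
  linear_combination F' a * h3 - F a * hinv a

theorem _root_.QDatum.IsSol.congr {w w' : D.W} {i j : I} {F : ℂˣ → D.PiBar} (hF : IsSol h w i F)
    (e : D.act w (D.fundWt i) = D.act w' (D.fundWt j)) : i = j ∧ IsSol h w' j F := by
  obtain ⟨rfl, -⟩ := h.ThetaHom_Y_congr e 1
  refine ⟨rfl, hF.tau_eq, hF.isUnit, hF.varpi_eq, hF.lead, fun a => ?_⟩
  rw [← e, ← hF.eq]
  congr 1
  exact congrArg inclHom (h.ThetaHom_Y_congr e a).2.symm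

variable (h)

theorem isSol_one (i : I) :
    IsSol h 1 i fun a => D.psi (Finsupp.single (i, a) 1) where
  tau_eq a b := by rw [tau_psi, shift_single]
  isUnit a := isUnit_psi _
  varpi_eq a := h.varpiHom_psi _
  lead a := ⟨Finsupp.single (i, a) 1, by
    rw [mul_comm, psi_mul_neg]; exact LeadingEqOne.one⟩
  eq a := by
    change inclHom (h.ThetaHom 1 (yDiag (D.Y i a))) * _ = _
    rw [h.ThetaHom_one]
    change inclHom (yDiag (D.Y i a)) * _ = _
    rw [inclHom_yDiag, phi_Y, act_one, mul_right_comm, ← psi_add, mul_comm]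
    congr 2
    simp [yToPsi, Y]

/-! ### The recursion -/

/-- `Θ_w` sends the monomial `m` to `[w(m)] X' / X`. -/
def RatioEq (w : D.W) (m : FreeMon I) (X X' : D.PiBar) : Prop :=
  h.thetaBar w (yDiag m) * X = D.br (D.act w (D.phi m)) * X'

variable {h} in
theorem RatioEq.add {w : D.W} {m n : FreeMon I} {X X' Z Z' : D.PiBar} (hm : h.RatioEq w m X X')
    (hn : h.RatioEq w n Z Z') : h.RatioEq w (m + n) (X * Z) (X' * Z') := by
  unfold RatioEq at *
  rw [yDiag_add, map_mul, map_add, act_add, br_add, mul_mul_mul_comm, hm, hn, mul_mul_mul_comm]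

variable {h} in
theorem RatioEq.trans {w : D.W} {m n : FreeMon I} {X X' X'' : D.PiBar} (hm : h.RatioEq w m X X')
    (hn : h.RatioEq w n X' X'') : h.RatioEq w (m + n) X X'' := by
  unfold RatioEq at *
  rw [yDiag_add, map_mul, map_add, act_add, br_add]
  linear_combination h.thetaBar w (yDiag n) * hm + D.br (D.act w (D.phi m)) * hn

theorem RatioEq.zero (w : D.W) (X : D.PiBar) : h.RatioEq w 0 X X := by
  unfold RatioEq
  rw [yDiag_zero, map_one, map_zero, act_zero, br_zero]

theorem RatioEq.sum {ι : Type*} {w : D.W} {s : Finset ι} {m : ι → FreeMon I} {X X' : ι → D.PiBar}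
    (hm : ∀ k ∈ s, h.RatioEq w (m k) (X k) (X' k)) :
    h.RatioEq w (∑ k ∈ s, m k) (∏ k ∈ s, X k) (∏ k ∈ s, X' k) := by
  classical
  induction s using Finset.induction_on with
  | empty => exact RatioEq.zero h w 1
  | insert a s ha ih =>
    rw [Finset.sum_insert ha, Finset.prod_insert ha, Finset.prod_insert ha]
    exact (hm a (Finset.mem_insert_self a s)).add
      (ih fun k hk => hm k (Finset.mem_insert_of_mem hk))

/-- The product over the neighbours of `i` in the `QQ`-system. -/
def qqProd (D : QDatum I) {M : Type*} [CommMonoid M] (x : I → ℂˣ → M) (i : I) (a : ℂˣ) : M :=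
  ∏ j, ((D.shifts (D.C i j)).map fun t => x j (a * t)).prod

/-- The neighbours in A_i are governed by C_{ji} and steps q_j, the product in the QQ-system by
C_{ij} and steps q_i. Telescoping, or inserting common factors, converts one into the other. -/
theorem ratioEq_nbr {w : D.W} {x : I → ℂˣ → D.PiBar} (hx : ∀ j, IsSol h w j (x j)) (i : I)
    (c : ℂˣ) : h.RatioEq w (D.nbr i c) (qqProd D x i (c * D.qi i))
      (qqProd D x i (c * (D.qi i)⁻¹)) := by
  have hY : ∀ (j : I) (b b₁ b₂ : ℂˣ), b₁ = b * D.qi j → b₂ = b * (D.qi j)⁻¹ →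
      h.RatioEq w (D.Y j b) (x j b₁) (x j b₂) := by
    rintro j b _ _ rfl rfl
    have := (hx j).eq b
    rwa [← D.phi_Y j b] at this
  refine RatioEq.sum h fun j _ => ?_
  by_cases hij : i = j
  · subst hij
    rw [D.C_diag, shifts_two]
    exact RatioEq.zero h w 1
  rcases h.cartan i j hij with hc | hc | hc | hc | hc | hc
  · rw [hc.1, hc.2, shifts_zero]
    exact RatioEq.zero h w 1
  · have hd : D.qi i = D.qi j := by
      rw [qi, qi, h.d_ratio (n := 1) hc.1 (by simpa using hc.2), one_mul]
    rw [hc.1, hc.2, shifts_neg_one, hd]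
    simp only [List.map_cons, List.map_nil, List.sum_cons, List.sum_nil, List.prod_cons,
      List.prod_nil, mul_one, add_zero]
    exact hY j _ _ _ rfl rfl
  · have dj := h.d_eq_one j i (by simp [hc.2])
    have di := h.d_ratio (n := 2) hc.1 (by simpa using hc.2)
    have hj : D.qi j = D.q := by rw [qi, dj, pow_one]
    have hi : D.qi i = D.q ^ 2 := by rw [qi, di, dj]
    rw [hc.1, hc.2, shifts_neg_one, shifts_neg_two, hi]
    simp only [List.map_cons, List.map_nil, List.sum_cons, List.sum_nil, List.prod_cons,
      List.prod_nil, mul_one, add_zero]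
    -- Here q_i = q_j², and the two ratios telescope through x_j(c).
    rw [add_comm]
    exact (hY j _ _ c (by rw [hj, pow_two, mul_assoc]) (by rw [hj]; group)).trans
      (hY j _ _ _ (by rw [hj]; group) (by rw [hj]; group))
  · have di := h.d_eq_one i j (by simp [hc.1])
    have dj := h.d_ratio (n := 2) hc.2 (by simpa using hc.1)
    have hi : D.qi i = D.q := by rw [qi, di, pow_one]
    have hj : D.qi j = D.q ^ 2 := by rw [qi, dj, di]
    rw [hc.1, hc.2, shifts_neg_one, shifts_neg_two, hi]
    simp only [List.map_cons, List.map_nil, List.sum_cons, List.sum_nil, List.prod_cons,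
      List.prod_nil, mul_one, add_zero]
    -- Here q_j = q_i². The two shifts give x_j(c) above and below, so the single ratio for Y_{j,c}
    -- is enlarged by this common factor.
    have := (RatioEq.zero h w (x j c)).add
      (hY j c (c * D.q * D.q) (c * D.q⁻¹ * D.q⁻¹) (by rw [hj, pow_two, mul_assoc]) (by rw [hj]; group))
    rw [zero_add, mul_comm (x j c) (x j (c * D.q⁻¹ * D.q⁻¹))] at this
    rwa [mul_inv_cancel_right, inv_mul_cancel_right]
  · have dj := h.d_eq_one j i (by simp [hc.2])
    have di := h.d_ratio (n := 3) hc.1 (by simpa using hc.2)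
    have hj : D.qi j = D.q := by rw [qi, dj, pow_one]
    have hi : D.qi i = D.q ^ 3 := by rw [qi, di, dj]
    rw [hc.1, hc.2, shifts_neg_one, shifts_neg_three, hi]
    simp only [List.map_cons, List.map_nil, List.sum_cons, List.sum_nil, List.prod_cons,
      List.prod_nil, mul_one, add_zero]
    rw [add_comm, add_comm (D.Y j c)]
    exact ((hY j _ _ (c * D.q) (by rw [hj]; group) (by rw [hj]; group)).trans
      (hY j _ _ (c * D.q⁻¹) (by rw [hj]) (by rw [hj]))).trans
      (hY j _ _ _ (by rw [hj]; group) (by rw [hj]; group))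
  · have di := h.d_eq_one i j (by simp [hc.1])
    have dj := h.d_ratio (n := 3) hc.2 (by simpa using hc.1)
    have hi : D.qi i = D.q := by rw [qi, di, pow_one]
    have hj : D.qi j = D.q ^ 3 := by rw [qi, dj, di]
    rw [hc.1, hc.2, shifts_neg_one, shifts_neg_three, hi]
    simp only [List.map_cons, List.map_nil, List.sum_cons, List.sum_nil, List.prod_cons,
      List.prod_nil, mul_one, add_zero]
    have := (RatioEq.zero h w (x j (c * D.q⁻¹) * x j (c * D.q))).add
      (hY j c (c * D.q * D.q ^ 2) (c * D.q⁻¹ * (D.q ^ 2)⁻¹) (by rw [hj]; group)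
        (by rw [hj]; group))
    rw [zero_add] at this
    rw [show c * D.q * (D.q ^ 2)⁻¹ = c * D.q⁻¹ by group,
      show c * D.q⁻¹ * D.q ^ 2 = c * D.q by group, ← mul_assoc]
    rwa [mul_comm (x j (c * D.q⁻¹) * x j (c * D.q)) (x j (c * D.q⁻¹ * (D.q ^ 2)⁻¹))] at this

end FiniteType

end QDatum

end

/-! ### Solution by recursion, the unnormalized QQ-relation, and part (a). -/

noncomputable section

namespace QDatum

set_option linter.unusedSectionVars false

variable {I : Type*} [Fintype I] [DecidableEq I] {D : QDatum I}

namespace FiniteType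

variable (h : D.FiniteType)
include h

theorem varpiHom_thetaBar {w : D.W} {x : I → ℂˣ → D.PiBar} (hx : ∀ j, IsSol h w j (x j))
    (m : FreeMon I) : h.varpiHom (h.thetaBar w (yDiag m)) = wtDiag (D.act w (D.phi m)) := by
  have hneg : ∀ l : Wt I, (wtDiag l * wtDiag (-l) : ∀ v : D.W, D.WtSeries v) = 1 := fun l => by
    rw [← wtDiag_add, add_neg_cancel, wtDiag_zero]
  induction m using D.freeMon_induction with
  | hY i a =>
    have := congrArg h.varpiHom ((hx i).eq a)
    rwa [map_mul, map_mul, (hx i).varpi_eq, (hx i).varpi_eq, mul_one, mul_one, h.varpiHom_br,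
      ← D.phi_Y i a] at this
  | h0 => rw [yDiag_zero, map_one, map_one, map_zero, act_zero, wtDiag_zero]
  | hadd m n hm hn =>
    rw [yDiag_add, map_mul, map_mul, hm, hn, map_add, act_add, wtDiag_add]
  | hneg m hm =>
    have e := congrArg (fun F => h.varpiHom (h.thetaBar w F)) (yDiag_mul_neg (D := D) m)
    simp only [map_mul, map_one, hm] at e
    rw [map_neg, act_neg]
    linear_combination wtDiag (-D.act w (D.phi m)) * e
      - h.varpiHom (h.thetaBar w (yDiag (-m))) * hneg (D.act w (D.phi m))

/-- ϖ does not see spectral shifts, so the functional equation becomes s = 1 + [-w(α_i)] s. This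
explains the last factor of `stepSol`, which makes its specialization 1. -/
theorem varpiHom_thetaBar_SigmaPi {w : D.W} {x : I → ℂˣ → D.PiBar}
    (hx : ∀ j, IsSol h w j (x j)) (i : I) (a : ℂˣ) :
    h.varpiHom (h.thetaBar w (D.SigmaPi i a)) *
      (1 - wtDiag (-D.act w (D.simpleRoot i))) = 1 := by
  have e1 : h.varpiHom (h.thetaBar w (D.SigmaPi i (a * ((D.qi i) ^ 2)⁻¹))) =
      h.varpiHom (h.thetaBar w (D.SigmaPi i a)) := by
    rw [← h.tauY_SigmaPi, ← h.tau_thetaBar, h.varpiHom_tau]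
  have e2 := congrArg (fun F => h.varpiHom (h.thetaBar w F)) (h.SigmaPi_eq i a)
  simp only [map_add, map_mul, map_one, e1, h.varpiHom_thetaBar hx] at e2
  rw [map_neg, h.phi_A, act_neg] at e2
  linear_combination e2

/-- The component at e of Θ_w(Σ) comes from Σ^w, which for w(α_i) > 0 is the expansion in the A⁻¹.
-/
theorem leadingEqOne_thetaBar_SigmaPi {w : D.W} {i : I}
    (hp : D.IsQPos (D.act w (D.simpleRoot i))) (a : ℂˣ) :
    D.LeadingEqOne (h.thetaBar w (D.SigmaPi i a)) := by
  rw [h.SigmaPi_eq, map_add, map_one, leadingEqOne_iff]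
  refine h.isOneAdd_of_below hp (h.act_simpleRoot_ne_zero w i) (h.below_thetaBar ?_)
  rw [one_mul]
  have h1 := (below_yMonom w (-D.A i a)).mul
    (IsOneAdd.below h (h.isOneAdd_Sigma hp (a * ((D.qi i) ^ 2)⁻¹)))
  rwa [map_neg, h.phi_A, act_neg, add_zero] at h1

theorem leadingEqOne_one_sub_br {b : Wt I} (hb : D.IsQPos b) (hb0 : b ≠ 0) :
    D.LeadingEqOne (1 - D.br (-b)) := by
  rw [sub_eq_add_neg, leadingEqOne_iff]
  refine h.isOneAdd_of_below hb hb0 (Below.neg (Below.single ?_))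
  change D.wle (D.act 1 (-b)) (-b)
  rw [act_one]
  exact D.wle_refl _

/-- The recursive formula for `Ψ_{w(ω_i),a} Q_{w(ω_i),a}`. -/
def stepSol (w : D.W) (x : I → ℂˣ → D.PiBar) (i : I) (a : ℂˣ) : D.PiBar :=
  Ring.inverse (x i (a * ((D.qi i) ^ 2)⁻¹)) * qqProd D x i (a * (D.qi i)⁻¹)
    * h.thetaBar w (D.SigmaPi i (a * ((D.qi i) ^ 2)⁻¹)) * (1 - D.br (-D.act w (D.simpleRoot i)))

theorem stepSol_mul {w : D.W} {x : I → ℂˣ → D.PiBar} (hx : ∀ j, IsSol h w j (x j)) (i : I)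
    (a : ℂˣ) : h.stepSol w x i (a * D.qi i) * x i (a * (D.qi i)⁻¹) =
      qqProd D x i a * h.thetaBar w (D.SigmaPi i (a * (D.qi i)⁻¹))
        * (1 - D.br (-D.act w (D.simpleRoot i))) := by
  rw [stepSol, mul_inv_cancel_right, show a * D.qi i * ((D.qi i) ^ 2)⁻¹ = a * (D.qi i)⁻¹ by group]
  have := Ring.inverse_mul_cancel _ ((hx i).isUnit (a * (D.qi i)⁻¹))
  linear_combination (qqProd D x i a * h.thetaBar w (D.SigmaPi i (a * (D.qi i)⁻¹))
        * (1 - D.br (-D.act w (D.simpleRoot i)))) * this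

theorem map_qqProd {M N : Type*} [CommMonoid M] [CommMonoid N] (f : M →* N) (x : I → ℂˣ → M)
    (i : I) (a : ℂˣ) : f (qqProd D x i a) = qqProd D (fun j b => f (x j b)) i a := by
  rw [qqProd, qqProd, map_prod]
  refine Finset.prod_congr rfl fun j _ => ?_
  rw [map_list_prod, List.map_map]
  rfl

/-- In Θ_i(Y_{i,a}) the monomial Y_{i,a} A⁻¹ equals the neighbours divided by Y_{i,aq_i⁻²}: this
explains the neighbour product and the inverse of x_i in `stepSol`, while its factor Θ_w(Σ) yields
the quotient of series. Positivity of w(α_i) is what gives a leading Ψ-monomial. -/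
theorem isSol_stepSol {w : D.W} {x : I → ℂˣ → D.PiBar} (hx : ∀ j, IsSol h w j (x j)) {i : I}
    (hp : D.IsQPos (D.act w (D.simpleRoot i))) :
    IsSol h (w * D.s i) i (h.stepSol w x i) where
  tau_eq a b := by
    have e : tau b (qqProd D x i (a * (D.qi i)⁻¹)) = qqProd D x i (a * b * (D.qi i)⁻¹) := by
      refine (h.map_qqProd (tau b).toMonoidHom x i _).trans ?_
      refine Finset.prod_congr rfl fun j _ => congrArg List.prod (List.map_congr_left fun t _ => ?_)
      refine ((hx j).tau_eq _ b).trans ?_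
      rw [mul_right_comm _ t b, mul_right_comm a]
    rw [stepSol, stepSol, map_mul, map_mul, map_mul, ringHom_inverse _ ((hx i).isUnit _),
      (hx i).tau_eq, e, h.tau_thetaBar, h.tauY_SigmaPi, map_sub, map_one, tau_br,
      mul_right_comm a _ b]
  isUnit a := by
    refine (((IsUnit.ringInverse ((hx i).isUnit _)).mul ?_).mul
      ((h.isUnit_SigmaPi i _).map _)).mul (h.isUnit_one_sub_br ⟨w, i, rfl⟩)
    refine Finset.prod_induction _ IsUnit (fun _ _ => IsUnit.mul) isUnit_one fun j _ => ?_
    refine List.prod_induction IsUnit (fun _ _ => IsUnit.mul) isUnit_one fun F hF => ?_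
    obtain ⟨t, -, rfl⟩ := List.mem_map.1 hF
    exact (hx j).isUnit _
  varpi_eq a := by
    have e : h.varpiHom (qqProd D x i (a * (D.qi i)⁻¹)) = 1 := by
      refine (h.map_qqProd h.varpiHom.toMonoidHom x i _).trans ?_
      refine Finset.prod_eq_one fun j _ => List.prod_eq_one fun F hF => ?_
      obtain ⟨t, -, rfl⟩ := List.mem_map.1 hF
      exact (hx j).varpi_eq _
    rw [stepSol, map_mul, map_mul, map_mul, ringHom_inverse _ ((hx i).isUnit _),
      (hx i).varpi_eq, Ring.inverse_one, e, one_mul, one_mul, map_sub, map_one, h.varpiHom_br,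
      h.varpiHom_thetaBar_SigmaPi hx]
  lead a := by
    refine (((h.hasPsiLead_of_mul_eq_one ((hx i).lead _)
      (Ring.mul_inverse_cancel _ ((hx i).isUnit _))).mul ?_).mul
      (h.leadingEqOne_thetaBar_SigmaPi hp _).hasPsiLead).mul
      (h.leadingEqOne_one_sub_br hp (h.act_simpleRoot_ne_zero w i)).hasPsiLead
    refine HasPsiLead.prod fun j _ => HasPsiLead.list_prod fun F hF => ?_
    obtain ⟨t, -, rfl⟩ := List.mem_map.1 hF
    exact (hx j).lead _
  eq a := by
    set q := D.qi i with hq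
    have e1 : h.thetaBar (w * D.s i) (yDiag (D.Y i a)) =
        h.thetaBar w (h.thetaHom i (yDiag (D.Y i a))) := by
      change inclHom (h.ThetaHom (w * D.s i) _) = inclHom (h.ThetaHom w _)
      rw [h.ThetaHom_mul_s]; rfl
    have e2 := congrArg (h.thetaBar w) (h.thetaHom_Y_mul i a)
    rw [map_mul, map_mul, ← hq] at e2
    have e3 := h.Y_sub_A i (a * q⁻¹ * q⁻¹)
    rw [← hq, inv_mul_cancel_right, show a * q⁻¹ * q⁻¹ * q ^ 2 = a by group] at e3
    have e4 : D.Y i a - D.A i (a * q⁻¹) + D.Y i (a * q⁻¹ * q⁻¹) = D.nbr i (a * q⁻¹) := by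
      rw [sub_add_eq_add_sub, add_sub_assoc, e3, add_sub_cancel]
    have e5 : D.phi (D.nbr i (a * q⁻¹)) = D.fundWt i + D.act (D.s i) (D.fundWt i) := by
      rw [← e4, map_add, map_sub, phi_Y, phi_Y, h.phi_A, act_s_fundWt, add_comm]
    have e6 : h.thetaBar w (yDiag (D.Y i a - D.A i (a * q⁻¹))) *
        h.thetaBar w (yDiag (D.Y i (a * q⁻¹ * q⁻¹))) =
          h.thetaBar w (yDiag (D.nbr i (a * q⁻¹))) := by
      rw [← map_mul, ← yDiag_add, e4]
    have e7 := h.ratioEq_nbr hx i (a * q⁻¹)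
    rw [RatioEq, e5, act_add, br_add, ← hq, inv_mul_cancel_right, ← act_mul] at e7
    have e8 := (hx i).eq (a * q⁻¹ * q⁻¹)
    rw [← hq, inv_mul_cancel_right] at e8
    have e9 := h.stepSol_mul hx i a
    have e10 := h.stepSol_mul hx i (a * q⁻¹ * q⁻¹)
    rw [← hq, inv_mul_cancel_right] at e10
    rw [← hq] at e9
    rw [show a * (q ^ 3)⁻¹ = a * q⁻¹ * q⁻¹ * q⁻¹ by group] at e2
    rw [e1]
    -- These units clear all denominators, so that the claim becomes a polynomial consequence of
    -- `e2` and `e6` to `e10`.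
    refine (((isUnit_br (D.act w (D.fundWt i))).mul ((hx i).isUnit (a * q⁻¹))).mul
      ((hx i).isUnit (a * q⁻¹ * q⁻¹ * q⁻¹))).mul_right_cancel ?_
    set E := 1 - D.br (-D.act w (D.simpleRoot i))
    set B := D.br (D.act w (D.fundWt i))
    set B' := D.br (D.act (w * D.s i) (D.fundWt i))
    set T := h.thetaBar w (h.thetaHom i (yDiag (D.Y i a)))
    set S := h.thetaBar w (D.SigmaPi i (a * q⁻¹))
    set S' := h.thetaBar w (D.SigmaPi i (a * q⁻¹ * q⁻¹ * q⁻¹))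
    set z := h.thetaBar w (yDiag (D.Y i a - D.A i (a * q⁻¹)))
    set X := x i (a * q⁻¹)
    set X' := x i (a * q⁻¹ * q⁻¹ * q⁻¹)
    set R := qqProd D x i a
    linear_combination T * B * X' * e9 + R * E * B * X' * e2 - z * S' * R * E * e8
      + S' * R * E * X * e6 + S' * E * X * e7 - B' * B * X * e10

/-- By uniqueness F is `stepSol`. With R the neighbour product and β = [-w(α_i)], the first term on
the left is R(1 - β) Θ_w(Σ_{aq_i⁻¹}) and the second is R(1 - β) Θ_w(A⁻¹ Σ_{aq_i⁻³}). Their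
difference is R(1 - β) by the functional equation. -/
theorem qq_of_isSol {w : D.W} {x : I → ℂˣ → D.PiBar} (hx : ∀ j, IsSol h w j (x j)) {i : I}
    (hp : D.IsQPos (D.act w (D.simpleRoot i))) {F : ℂˣ → D.PiBar} (hF : IsSol h (w * D.s i) i F)
    (a : ℂˣ) :
    F (a * D.qi i) * x i (a * (D.qi i)⁻¹)
      - D.br (-D.act w (D.simpleRoot i)) * F (a * (D.qi i)⁻¹) * x i (a * D.qi i) =
      qqProd D x i a * (1 - D.br (-D.act w (D.simpleRoot i))) := by
  rw [hF.unique (h.isSol_stepSol hx hp)]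
  set q := D.qi i with hq
  have e3 := h.Y_sub_A i (a * q⁻¹ * q⁻¹)
  rw [← hq, inv_mul_cancel_right, show a * q⁻¹ * q⁻¹ * q ^ 2 = a by group] at e3
  have e4 : D.Y i a + -D.A i (a * q⁻¹) + D.Y i (a * q⁻¹ * q⁻¹) = D.nbr i (a * q⁻¹) := by
    rw [← sub_eq_add_neg, sub_add_eq_add_sub, add_sub_assoc, e3, add_sub_cancel]
  have e5 : D.phi (D.nbr i (a * q⁻¹)) = D.fundWt i + (D.fundWt i + -D.simpleRoot i) := by
    rw [← e4, map_add, map_add, map_neg, phi_Y, phi_Y, h.phi_A, add_comm]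
  have e6 : h.thetaBar w (yDiag (D.Y i a)) * h.thetaBar w (yDiag (-D.A i (a * q⁻¹))) *
      h.thetaBar w (yDiag (D.Y i (a * q⁻¹ * q⁻¹))) =
        h.thetaBar w (yDiag (D.nbr i (a * q⁻¹))) := by
    rw [← map_mul, ← yDiag_add, ← map_mul, ← yDiag_add, e4]
  have e7 := h.ratioEq_nbr hx i (a * q⁻¹)
  rw [RatioEq, e5, act_add, br_add, act_add, br_add, act_neg, ← hq, inv_mul_cancel_right] at e7
  have e8 := (hx i).eq (a * q⁻¹ * q⁻¹)
  rw [← hq, inv_mul_cancel_right] at e8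
  have e8' := (hx i).eq a
  rw [← hq] at e8'
  have e9 := h.stepSol_mul hx i a
  have e10 := h.stepSol_mul hx i (a * q⁻¹ * q⁻¹)
  rw [← hq, inv_mul_cancel_right] at e10
  rw [← hq] at e9
  have e11 := congrArg (h.thetaBar w) (h.SigmaPi_eq i (a * q⁻¹))
  rw [map_add, map_one, map_mul, ← hq,
    show a * q⁻¹ * (q ^ 2)⁻¹ = a * q⁻¹ * q⁻¹ * q⁻¹ by group] at e11
  have hB := isUnit_br (D := D) (D.act w (D.fundWt i))
  have hX := (hx i).isUnit (a * q⁻¹)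
  have hX' := (hx i).isUnit (a * q⁻¹ * q⁻¹ * q⁻¹)
  set β := D.br (-D.act w (D.simpleRoot i))
  set B := D.br (D.act w (D.fundWt i))
  set S := h.thetaBar w (D.SigmaPi i (a * q⁻¹))
  set S' := h.thetaBar w (D.SigmaPi i (a * q⁻¹ * q⁻¹ * q⁻¹))
  set z := h.thetaBar w (yDiag (-D.A i (a * q⁻¹)))
  set y := h.thetaBar w (yDiag (D.Y i a))
  set X := x i (a * q⁻¹)
  set X' := x i (a * q⁻¹ * q⁻¹ * q⁻¹)
  set X₀ := x i (a * q)
  set R := qqProd D x i a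
  set R' := qqProd D x i (a * q⁻¹ * q⁻¹)
  -- This expresses Θ_w(A⁻¹) as [-w(α_i)] times a ratio of values of the x_j.
  have e12 : z * R * X' = β * R' * X₀ := by
    refine ((hB.mul hX).mul hB).mul_right_cancel ?_
    linear_combination (-(z * R * X' * B)) * e8' - y * z * R * X₀ * e8 + R * X * X₀ * e6
      + X * X₀ * e7
  refine hX'.mul_right_cancel ?_
  linear_combination X' * e9 - β * X₀ * e10 + R * (1 - β) * X' * e11 + S' * (1 - β) * e12

/-! ### Existence and uniqueness of the families `Ψ` and `Q` -/

/-- Induction along right descents: passing from ws_i to w changes only the solution of index i,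
because s_i fixes the other fundamental weights. -/
theorem exists_isSol (w : D.W) : ∃ x : I → ℂˣ → D.PiBar, ∀ j, IsSol h w j (x j) := by
  induction hn : D.length w using Nat.strong_induction_on generalizing w with
  | _ n ih =>
    by_cases hw : w = 1
    · subst hw
      exact ⟨_, h.isSol_one⟩
    obtain ⟨i, hi⟩ := h.exists_descent hw
    have hlen := h.length_mul_s_of_not_isQPos hi
    obtain ⟨x, hx⟩ := ih _ (by omega) (w * D.s i) rfl
    have hp : D.IsQPos (D.act (w * D.s i) (D.simpleRoot i)) := by rwa [h.isQPos_act_mul_s_iff]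
    refine ⟨Function.update x i (h.stepSol (w * D.s i) x i), fun j => ?_⟩
    by_cases hj : j = i
    · subst hj
      rw [Function.update_self]
      have := h.isSol_stepSol hx hp
      rwa [mul_s_mul_s] at this
    · rw [Function.update_of_ne hj]
      exact ((hx j).congr (by rw [act_mul, act_s_fundWt_of_ne _ hj])).2

end FiniteType

theorem leadingEqOne_tau (b : ℂˣ) {F : D.PiBar} (hF : D.LeadingEqOne F) :
    D.LeadingEqOne (tau b F) := by
  constructor
  · have := coeff_tau b F 1 0 0
    rw [shift_zero] at this
    exact this.trans hF.1
  · intro y hy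
    obtain ⟨⟨m, l⟩, rfl, hx⟩ := exists_of_coeff_mapSer (psiShift b) (psiShift_injective b)
      (fun _ => rfl) 1 hy
    rcases hF.2 _ hx with h0 | h0
    · refine Or.inl ?_
      have : ((m, l) : FreeMon I × Wt I) = 0 := h0.symm
      rw [this, map_zero]
      rfl
    · exact Or.inr h0

namespace FiniteType

variable (h : D.FiniteType)
include h

theorem isSol_of_isPsiQFamily {Psi : D.ExtWt → ℂˣ → FreeMon I} {Q : D.ExtWt → ℂˣ → D.PiBar}
    (hF : D.IsPsiQFamily Psi Q) (w : D.W) (i : I) :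
    IsSol h w i fun a => D.psi (Psi (D.extWt w i) a) * Q (D.extWt w i) a where
  tau_eq a b := by
    rw [map_mul, tau_psi, hF.psi_equivariant _ a, hF.psi_equivariant _ (a * b), shift_shift,
      isShift_iff.1 (hF.q_equivariant _ a), isShift_iff.1 (hF.q_equivariant _ (a * b)), tau_tau]
  isUnit a := (isUnit_psi _).mul (hF.q_isUnit _ a)
  varpi_eq a := by
    rw [map_mul, h.varpiHom_psi, h.varpiEqOne_iff.1 (hF.q_varpi _ a), one_mul]
  lead a := ⟨Psi (D.extWt w i) a, by
    rw [← mul_assoc, mul_comm (D.psi _), psi_mul_neg, one_mul]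
    exact hF.q_leading _ a⟩
  eq a := by
    have := hF.theta_eq w i a
    rw [← h.ThetaHom_apply] at this
    exact this

/-- The product ΨQ is the unique solution attached to the weight. Its leading Ψ-monomial at e is Ψ,
and what remains after division is Q. -/
theorem existsUnique_isPsiQFamily :
    ∃! F : (D.ExtWt → ℂˣ → FreeMon I) × (D.ExtWt → ℂˣ → D.PiBar),
      D.IsPsiQFamily F.1 F.2 := by
  have hex : ∀ x : D.ExtWt, ∃ F : ℂˣ → D.PiBar, ∀ w i, D.extWt w i = x → IsSol h w i F := by
    rintro ⟨_, w, i, rfl⟩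
    obtain ⟨x, hx⟩ := h.exists_isSol w
    refine ⟨x i, fun w' i' e => ((hx i).congr ?_).2⟩
    exact (congrArg Subtype.val e).symm
  choose F hF using hex
  have hlead : ∀ x : D.ExtWt, HasPsiLead (F x 1) := by
    rintro ⟨_, w, i, rfl⟩
    exact (hF _ w i rfl).lead 1
  choose m hm using hlead
  have hsol : ∀ x : D.ExtWt, ∃ w i, IsSol h w i (F x) := by
    rintro ⟨_, w, i, rfl⟩
    exact ⟨w, i, hF _ w i rfl⟩
  -- The leading monomial is chosen at a = 1 and then shifted, which makes both families equivariant
  -- by construction.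
  have key : ∀ x a, D.psi (-shift a (m x)) * F x a = tau a (D.psi (-m x) * F x 1) := by
    intro x a
    obtain ⟨w, i, hx⟩ := hsol x
    rw [map_mul, tau_psi, shift_neg, hx.tau_eq, one_mul]
  refine ⟨(fun x a => shift a (m x), fun x a => D.psi (-shift a (m x)) * F x a), ?_, ?_⟩
  · refine ⟨fun x a => ?_, fun x a => isShift_iff.2 ?_, fun x a => ?_, fun x a => ?_,
      fun x a => h.varpiEqOne_iff.2 ?_, fun w i a => ?_⟩
    · simp only [shift_one]
    · simp only [key, tau_one]
    · obtain ⟨w, i, hx⟩ := hsol x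
      exact (isUnit_psi _).mul (hx.isUnit a)
    · simp only [key]
      exact leadingEqOne_tau a (hm x)
    · obtain ⟨w, i, hx⟩ := hsol x
      simp only [map_mul, h.varpiHom_psi, hx.varpi_eq, one_mul]
    · simp only [← mul_assoc _ (D.psi (-_)), psi_mul_neg, one_mul]
      have := (hF _ w i rfl).eq a
      rw [← h.ThetaHom_apply]
      exact this
  · rintro ⟨Psi, Q⟩ hPQ
    have h1 : ∀ x a, D.psi (Psi x a) * Q x a = F x a := by
      rintro ⟨_, w, i, rfl⟩ a
      exact congrFun ((h.isSol_of_isPsiQFamily hPQ w i).unique (hF _ w i rfl)) a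
    have h2 : ∀ x a, Psi x a = shift a (m x) := by
      intro x a
      refine psiLead_unique (F := F x a) ?_ ?_
      · rw [← h1, ← mul_assoc, mul_comm (D.psi _), psi_mul_neg, one_mul]
        exact hPQ.q_leading x a
      · rw [key]
        exact leadingEqOne_tau a (hm x)
    refine Prod.ext (funext fun x => funext fun a => h2 x a)
      (funext fun x => funext fun a => ?_)
    simp only
    rw [← h1, h2, ← mul_assoc, mul_comm (D.psi _), psi_mul_neg, one_mul]

end FiniteType

end QDatum

end

/-! ### Part (b): the product formula for χ. -/

noncomputable section

namespace QDatum

set_option linter.unusedSectionVars false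

variable {I : Type*} [Fintype I] [DecidableEq I] {D : QDatum I}

/-! ### The family `χ` -/

/-- The exponent of `(1 - [-β])^{-1}` in `χ_{w(ω_i)}`. -/
def chiExp (D : QDatum I) (w : D.W) (i : I) (b : Wt I) : ℕ := ⌊-D.rootCoord (D.act w⁻¹ b) i⌋₊

namespace FiniteType

variable (h : D.FiniteType)
include h

theorem mem_posRoots_iff {w : D.W} {i : I} :
    D.act w (D.simpleRoot i) ∈ D.posRoots ↔ D.IsQPos (D.act w (D.simpleRoot i)) :=
  ⟨fun hw => hw.2, fun hw => ⟨⟨w, i, rfl⟩, hw⟩⟩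

theorem finite_posRoots : D.posRoots.Finite := h.finite_roots.subset fun _ hx => hx.1

/-- The coordinate in question is (w(ω_i), β)/d_i, by invariance of the form. -/
theorem chiExp_congr {w w' : D.W} {i j : I} (e : D.act w (D.fundWt i) = D.act w' (D.fundWt j))
    (b : Wt I) : D.chiExp w i b = D.chiExp w' j b := by
  obtain ⟨rfl, -⟩ := h.ThetaHom_Y_congr e 1
  have key : ∀ w : D.W, (D.d i : ℚ) * D.rootCoord (D.act w⁻¹ b) i =
      D.form (D.act w (D.fundWt i)) b := by
    intro w
    rw [← form_fundWt_left, ← h.form_act w, act_act_inv]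
  have hd : (D.d i : ℚ) ≠ 0 := by exact_mod_cast (D.d_pos i).ne'
  have : D.rootCoord (D.act w⁻¹ b) i = D.rootCoord (D.act w'⁻¹ b) i :=
    mul_left_cancel₀ hd (by rw [key, key, e])
  rw [chiExp, chiExp, this]

/-- The explicit product formula for `χ_{w(ω_i)}`. -/
def chiProd (w : D.W) (i : I) : D.PiBar :=
  ∏ b ∈ h.finite_posRoots.toFinset, D.invOneSub b ^ D.chiExp w i b

/-- Let γ = w⁻¹(b). `Nat.floor` truncates negative values to 0, so a positive γ contributes nothing,
except through s_i(γ) < 0, which forces γ = α_i. If γ is negative, so is s_i(γ); no truncation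
occurs, and the identity is linear in the coordinates of γ. -/
theorem chiExp_add {w : D.W} {i : I} (hp : D.IsQPos (D.act w (D.simpleRoot i))) {b : Wt I}
    (hb : b ∈ D.posRoots) :
    D.chiExp (w * D.s i) i b + D.chiExp w i b =
      (if b = D.act w (D.simpleRoot i) then 1 else 0)
        + ∑ j with j ≠ i, D.chiExp w j b * (-D.C i j).toNat := by
  obtain ⟨⟨u, k, rfl⟩, hb⟩ := hb
  have hg : D.act w⁻¹ (D.act u (D.simpleRoot k)) = D.act (w⁻¹ * u) (D.simpleRoot k) :=
    (D.act_mul _ _ _).symm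
  have hg' : D.act (w * D.s i)⁻¹ (D.act u (D.simpleRoot k)) =
      D.act (D.s i) (D.act (w⁻¹ * u) (D.simpleRoot k)) := by
    rw [mul_inv_rev, s_inv, act_mul, hg]
  have hiff : D.act u (D.simpleRoot k) = D.act w (D.simpleRoot i) ↔
      D.act (w⁻¹ * u) (D.simpleRoot k) = D.simpleRoot i := by
    rw [← hg]
    constructor
    · intro e
      rw [e, act_inv_act]
    · intro e
      rw [← e, act_act_inv]
  rw [if_congr hiff rfl rfl]
  simp only [chiExp, hg, hg']
  have hss : ∀ x : Wt I, D.act (D.s i) (D.act (D.s i) x) = x := fun x => by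
    rw [← act_mul, s_mul_self, act_one]
  have hαi : D.IsQPos (D.simpleRoot i) := isQPos_simpleRoot D i
  by_cases hγ : D.IsQPos (D.act (w⁻¹ * u) (D.simpleRoot k))
  · have h0 : ∀ j, ⌊-D.rootCoord (D.act (w⁻¹ * u) (D.simpleRoot k)) j⌋₊ = 0 := fun j => by
      rw [Nat.floor_eq_zero]
      have := h.rootCoord_nonneg hγ j
      linarith
    simp only [h0, zero_mul, Finset.sum_const_zero, add_zero]
    split_ifs with he
    · rw [he, act_s_simpleRoot, rootCoord_neg, h.rootCoord_simpleRoot]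
      simp
    · rw [Nat.floor_eq_zero]
      have hpos : D.IsQPos (D.act (D.s i) (D.act (w⁻¹ * u) (D.simpleRoot k))) := by
        by_contra hn
        exact he (h.eq_simpleRoot_of_neg hγ hn)
      have := h.rootCoord_nonneg hpos i
      linarith
  · have he : D.act (w⁻¹ * u) (D.simpleRoot k) ≠ D.simpleRoot i := fun e => hγ (e ▸ hαi)
    have hneg := (h.isQPos_neg_iff _ _).2 hγ
    -- s_i(γ) > 0 would force γ = -α_i, that is b = -w(α_i), impossible as both b and w(α_i) are
    -- positive.
    have hneg' : D.IsQPos (-D.act (D.s i) (D.act (w⁻¹ * u) (D.simpleRoot k))) := by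
      rw [← act_mul, h.isQPos_neg_iff]
      intro hs
      have e1 := h.eq_simpleRoot_of_neg (k := i) hs (by rwa [act_mul, hss])
      have e2 : D.act u (D.simpleRoot k) = -D.act w (D.simpleRoot i) := by
        rw [← D.act_act_inv w (D.act u (D.simpleRoot k)), hg,
          ← hss (D.act (w⁻¹ * u) (D.simpleRoot k)), ← D.act_mul (D.s i) (w⁻¹ * u), e1,
          act_s_simpleRoot, act_neg]
      rw [e2] at hb
      exact (h.isQPos_neg_iff w i).1 hb hp
    rw [if_neg he, zero_add]
    have hfl : ∀ x : Wt I, D.IsQPos (-x) → ∀ j, ((⌊-D.rootCoord x j⌋₊ : ℕ) : ℚ) =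
        -D.rootCoord x j := by
      intro x hx j
      obtain ⟨n, hn⟩ := (h.isQPos_iff _).1 hx
      have := congrFun hn j
      rw [rootCoord_neg] at this
      change -D.rootCoord x j = n j at this
      rw [this, Nat.floor_natCast]
    set γ := D.act (w⁻¹ * u) (D.simpleRoot k) with hγdef
    have hC : ∀ j, j ≠ i → (((-D.C i j).toNat : ℕ) : ℚ) = -D.C i j := by
      intro j hj
      have : (0 : ℤ) ≤ -D.C i j := by
        rcases h.cartan i j hj.symm with hc | hc | hc | hc | hc | hc <;> rw [hc.1] <;> norm_num
      have h2 : (((-D.C i j).toNat : ℕ) : ℤ) = -D.C i j := Int.toNat_of_nonneg this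
      have h3 := congrArg (Int.cast : ℤ → ℚ) h2
      push_cast at h3
      exact_mod_cast h3
    -- With c the coordinates of γ, its pairing with α_i^∨ is 2c_i + ∑_{j≠i} C_{ij} c_j. Subtracting
    -- it from c_i gives the i-th coordinate of s_i(γ).
    have hsum := h.mulVec_rootCoord γ i
    rw [← Finset.add_sum_erase _ _ (Finset.mem_univ i), D.C_diag,
      ← Finset.filter_ne' Finset.univ i] at hsum
    have hgoal : (((⌊-D.rootCoord (D.act (D.s i) γ) i⌋₊ + ⌊-D.rootCoord γ i⌋₊ : ℕ)) : ℚ) =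
        ((∑ j with j ≠ i, ⌊-D.rootCoord γ j⌋₊ * (-D.C i j).toNat : ℕ) : ℚ) := by
      push_cast
      rw [hfl _ hneg', hfl _ hneg, h.rootCoord_act_s, if_pos rfl, ← hsum]
      have : ∑ j with j ≠ i, ((⌊-D.rootCoord γ j⌋₊ : ℕ) : ℚ) * (((-D.C i j).toNat : ℕ) : ℚ) =
          ∑ j with j ≠ i, (D.C i j : ℚ) * D.rootCoord γ j :=
        Finset.sum_congr rfl fun j hj => by
          rw [hfl _ hneg, hC j (Finset.mem_filter.1 hj).2]; ring
      rw [this]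
      push_cast
      ring
    exact_mod_cast hgoal

theorem chiProd_mul {w : D.W} {i : I} (hp : D.IsQPos (D.act w (D.simpleRoot i))) :
    h.chiProd (w * D.s i) i * h.chiProd w i =
      D.invOneSub (D.act w (D.simpleRoot i))
        * ∏ j with j ≠ i, h.chiProd w j ^ (-D.C i j).toNat := by
  have e1 : D.invOneSub (D.act w (D.simpleRoot i)) =
      ∏ b ∈ h.finite_posRoots.toFinset,
        D.invOneSub b ^ (if b = D.act w (D.simpleRoot i) then 1 else 0) := by
    rw [Finset.prod_eq_single (D.act w (D.simpleRoot i))]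
    · rw [if_pos rfl, pow_one]
    · intro b _ hb
      rw [if_neg hb, pow_zero]
    · intro hn
      exact absurd (h.finite_posRoots.mem_toFinset.2 (h.mem_posRoots_iff.2 hp)) hn
  simp only [chiProd]
  rw [e1, Finset.prod_congr rfl fun j _ => (Finset.prod_pow _ _ _).symm, Finset.prod_comm,
    ← Finset.prod_mul_distrib, ← Finset.prod_mul_distrib]
  refine Finset.prod_congr rfl fun b hb => ?_
  rw [← pow_add, h.chiExp_add hp (h.finite_posRoots.mem_toFinset.1 hb), pow_add,
    ← Finset.prod_pow_eq_pow_sum]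
  simp only [pow_mul]

theorem isChiFamily_mul {chi : D.ExtWt → D.PiBar} (hc : D.IsChiFamily chi) {w : D.W} {i : I}
    (hp : D.IsQPos (D.act w (D.simpleRoot i))) :
    chi (D.extWt (w * D.s i) i) * chi (D.extWt w i) =
      D.invOneSub (D.act w (D.simpleRoot i))
        * ∏ j with j ≠ i, chi (D.extWt w j) ^ (-D.C i j).toNat :=
  hc.chi_mul w i (h.length_mul_s_of_isQPos hp)

theorem extWt_mul_s_of_ne (w : D.W) {i j : I} (hj : j ≠ i) :
    D.extWt (w * D.s i) j = D.extWt w j :=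
  Subtype.ext (by change D.act _ _ = D.act _ _; rw [act_mul, act_s_fundWt_of_ne _ hj])

/-- The recursion determines χ at ws_i only if χ at w(ω_i) can be cancelled, so invertibility is
carried along in the induction. -/
theorem isChiFamily_unique {chi chi' : D.ExtWt → D.PiBar} (hc : D.IsChiFamily chi)
    (hc' : D.IsChiFamily chi') (w : D.W) (i : I) :
    chi (D.extWt w i) = chi' (D.extWt w i) ∧ IsUnit (chi (D.extWt w i)) := by
  induction hn : D.length w using Nat.strong_induction_on generalizing w i with
  | _ n ih =>
    by_cases hw : w = 1
    · subst hw
      rw [hc.chi_fund, hc'.chi_fund]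
      exact ⟨rfl, isUnit_one⟩
    obtain ⟨k, hk⟩ := h.exists_descent hw
    have hlen := h.length_mul_s_of_not_isQPos hk
    have ih' := fun i => ih _ (by omega) (w * D.s k) i rfl
    by_cases hik : i = k
    · subst hik
      have hp : D.IsQPos (D.act (w * D.s i) (D.simpleRoot i)) := by rwa [h.isQPos_act_mul_s_iff]
      have e1 := h.isChiFamily_mul hc hp
      have e2 := h.isChiFamily_mul hc' hp
      rw [mul_s_mul_s] at e1 e2
      have e3 : ∏ j with j ≠ i, chi (D.extWt (w * D.s i) j) ^ (-D.C i j).toNat =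
          ∏ j with j ≠ i, chi' (D.extWt (w * D.s i) j) ^ (-D.C i j).toNat :=
        Finset.prod_congr rfl fun j _ => by rw [(ih' j).1]
      rw [← e3, ← e1, ← (ih' i).1] at e2
      refine ⟨((ih' i).2.mul_right_cancel e2).symm, isUnit_of_mul_isUnit_left (y :=
        chi (D.extWt (w * D.s i) i)) ?_⟩
      rw [e1]
      refine (h.isUnit_invOneSub ⟨_, i, rfl⟩).mul ?_
      exact Finset.prod_induction _ IsUnit (fun _ _ => IsUnit.mul) isUnit_one
        fun j _ => (ih' j).2.pow _
    · rw [← h.extWt_mul_s_of_ne w hik]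
      exact ih' i

theorem chiExp_one (i : I) {b : Wt I} (hb : b ∈ D.posRoots) : D.chiExp 1 i b = 0 := by
  rw [chiExp, inv_one, act_one, Nat.floor_eq_zero]
  have := h.rootCoord_nonneg hb.2 i
  linarith

theorem existsUnique_isChiFamily : ∃! chi : D.ExtWt → D.PiBar, D.IsChiFamily chi := by
  have hex : ∀ x : D.ExtWt, ∃ F : D.PiBar, ∀ w i, D.extWt w i = x → h.chiProd w i = F := by
    rintro ⟨_, w, i, rfl⟩
    refine ⟨h.chiProd w i, fun w' i' e => Finset.prod_congr rfl fun b _ => ?_⟩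
    rw [h.chiExp_congr (congrArg Subtype.val e)]
  choose chi hchi using hex
  have hchi' : ∀ w i, chi (D.extWt w i) = h.chiProd w i := fun w i => (hchi _ w i rfl).symm
  have hfam : D.IsChiFamily chi := by
    refine ⟨?_, fun i => ?_, fun w i hl => ?_⟩
    · rintro ⟨_, w, i, rfl⟩
      change chi (D.extWt w i) ∈ _
      rw [hchi']
      refine prod_mem fun b hb => pow_mem (?_ : D.invOneSub b ∈ _) _
      exact Subring.subset_closure ⟨b, (h.finite_posRoots.mem_toFinset.1 hb).1, rfl⟩
    · rw [hchi']
      refine Finset.prod_eq_one fun b hb => ?_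
      rw [h.chiExp_one i (h.finite_posRoots.mem_toFinset.1 hb), pow_zero]
    · simp only [hchi']
      exact h.chiProd_mul (h.length_mul_s_eq_iff.1 hl)
  refine ⟨chi, hfam, fun chi' hc' => funext ?_⟩
  rintro ⟨_, w, i, rfl⟩
  exact (h.isChiFamily_unique hc' hfam w i).1

end FiniteType

end QDatum

end

/-! ### Part (c): normalization by χ and both signs of w(α_i). -/

noncomputable section

namespace QDatum

set_option linter.unusedSectionVars false

variable {I : Type*} [Fintype I] [DecidableEq I] {D : QDatum I}

/-! ### The extended `QQ`-system -/

theorem prod_shifts {M : Type*} [CommMonoid M] (x : I → ℂˣ → M) (i : I) (a : ℂˣ) :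
    (∏ j with D.C i j = -1, x j a)
      * (∏ j with D.C i j = -2, x j (a * D.q) * x j (a * D.q⁻¹))
      * (∏ j with D.C i j = -3, x j (a * D.q ^ 2) * x j a * x j (a * (D.q ^ 2)⁻¹)) =
    FiniteType.qqProd D x i a := by
  rw [FiniteType.qqProd, Finset.prod_filter, Finset.prod_filter, Finset.prod_filter,
    ← Finset.prod_mul_distrib, ← Finset.prod_mul_distrib]
  refine Finset.prod_congr rfl fun j _ => ?_
  by_cases h1 : D.C i j = -1
  · simp [h1, shifts_neg_one]
  by_cases h2 : D.C i j = -2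
  · simp [h2, shifts_neg_two, mul_comm]
  by_cases h3 : D.C i j = -3
  · simp only [h3, shifts_neg_three]
    simp [mul_comm]
  · simp [h1, h2, h3, shifts]

namespace FiniteType

variable (h : D.FiniteType)
include h

/-- The number of factors of index j is -C_{ij}, so constants leave the product with exactly the
exponents of the recursion for χ. -/
theorem qqProd_mul {M : Type*} [CommMonoid M] (c : I → M) (x : I → ℂˣ → M) (i : I) (a : ℂˣ) :
    qqProd D (fun j b => c j * x j b) i a =
      (∏ j with j ≠ i, c j ^ (-D.C i j).toNat) * qqProd D x i a := by
  have e : ∏ j with j ≠ i, c j ^ (-D.C i j).toNat = ∏ j, c j ^ (D.shifts (D.C i j)).length := by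
    rw [Finset.prod_filter]
    refine Finset.prod_congr rfl fun j _ => ?_
    split_ifs with hj
    · congr 1
      have := h.length_shifts hj.symm
      omega
    · rw [not_not.1 hj, D.C_diag, shifts_two, List.length_nil, pow_zero]
  rw [e, qqProd, qqProd, ← Finset.prod_mul_distrib]
  refine Finset.prod_congr rfl fun j _ => ?_
  rw [List.prod_map_mul, List.map_const', List.prod_replicate]

variable {Psi : D.ExtWt → ℂˣ → FreeMon I} {Q : D.ExtWt → ℂˣ → D.PiBar} {chi : D.ExtWt → D.PiBar}

/-- The factor (1 - [-w(α_i)])⁻¹ in the recursion for χ cancels the factor 1 - [-w(α_i)] in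
`qq_of_isSol`. -/
theorem qq_of_isQPos (hPQ : D.IsPsiQFamily Psi Q) (hchi : D.IsChiFamily chi) {w : D.W} {i : I}
    (hp : D.IsQPos (D.act w (D.simpleRoot i))) (a : ℂˣ) :
    D.calQ Psi Q chi (D.extWt (w * D.s i) i) (a * D.qi i)
        * D.calQ Psi Q chi (D.extWt w i) (a * (D.qi i)⁻¹)
      - D.br (-D.act w (D.simpleRoot i))
        * D.calQ Psi Q chi (D.extWt (w * D.s i) i) (a * (D.qi i)⁻¹)
        * D.calQ Psi Q chi (D.extWt w i) (a * D.qi i)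
    = qqProd D (fun j => D.calQ Psi Q chi (D.extWt w j)) i a := by
  have e1 := h.qq_of_isSol (fun j => h.isSol_of_isPsiQFamily hPQ w j) hp
    (h.isSol_of_isPsiQFamily hPQ (w * D.s i) i) a
  have e2 := h.isChiFamily_mul hchi hp
  have e3 := h.one_sub_br_mul_invOneSub (b := D.act w (D.simpleRoot i)) ⟨w, i, rfl⟩
  have e4 := h.qqProd_mul (fun j => chi (D.extWt w j))
    (fun j b => D.psi (Psi (D.extWt w j) b) * Q (D.extWt w j) b) i a
  change _ = qqProd D (fun j b => chi (D.extWt w j)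
    * (D.psi (Psi (D.extWt w j) b) * Q (D.extWt w j) b)) i a
  rw [e4]
  simp only [calQ]
  linear_combination chi (D.extWt (w * D.s i) i) * chi (D.extWt w i) * e1
    + qqProd D (fun j b => D.psi (Psi (D.extWt w j) b) * Q (D.extWt w j) b) i a
      * (1 - D.br (-D.act w (D.simpleRoot i))) * e2
    + (∏ j with j ≠ i, chi (D.extWt w j) ^ (-D.C i j).toNat)
      * qqProd D (fun j b => D.psi (Psi (D.extWt w j) b) * Q (D.extWt w j) b) i a * e3

theorem qqProd_congr {M : Type*} [CommMonoid M] {x y : I → ℂˣ → M} {i : I}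
    (hxy : ∀ j, j ≠ i → x j = y j) (a : ℂˣ) : qqProd D x i a = qqProd D y i a := by
  refine Finset.prod_congr rfl fun j _ => ?_
  by_cases hj : j = i
  · rw [hj, D.C_diag, shifts_two]; rfl
  · rw [hxy j hj]

/-- If w(α_i) < 0, the relation at ws_i is available. Multiplying it by -[-w(α_i)] exchanges the
roles of its two left-hand terms and produces the sign and the factor of `brPlusNeg`. -/
theorem extended_qq (hPQ : D.IsPsiQFamily Psi Q) (hchi : D.IsChiFamily chi) (i : I) (w : D.W)
    (a : ℂˣ) :
    D.calQ Psi Q chi (D.extWt (w * D.s i) i) (a * D.qi i)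
        * D.calQ Psi Q chi (D.extWt w i) (a * (D.qi i)⁻¹)
      - D.br (-D.act w (D.simpleRoot i))
        * D.calQ Psi Q chi (D.extWt (w * D.s i) i) (a * (D.qi i)⁻¹)
        * D.calQ Psi Q chi (D.extWt w i) (a * D.qi i)
    = D.brPlusNeg (D.act w (D.simpleRoot i))
      * qqProd D (fun j => D.calQ Psi Q chi (D.extWt w j)) i a := by
  by_cases hp : D.IsQPos (D.act w (D.simpleRoot i))
  · rw [brPlusNeg, if_pos (h.mem_posRoots_iff.2 hp), one_mul]
    exact h.qq_of_isQPos hPQ hchi hp a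
  · rw [brPlusNeg, if_neg (mt h.mem_posRoots_iff.1 hp)]
    have hp' : D.IsQPos (D.act (w * D.s i) (D.simpleRoot i)) := by rwa [h.isQPos_act_mul_s_iff]
    have e1 := h.qq_of_isQPos hPQ hchi hp' a
    rw [mul_s_mul_s, h.qqProd_congr (y := fun j => D.calQ Psi Q chi (D.extWt w j))
      (fun j hj => by rw [h.extWt_mul_s_of_ne w hj]), act_mul, act_s_simpleRoot, act_neg,
      neg_neg] at e1
    have e2 := br_mul_neg (D := D) (D.act w (D.simpleRoot i))
    linear_combination (-D.br (-D.act w (D.simpleRoot i))) * e1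
      - (D.calQ Psi Q chi (D.extWt (w * D.s i) i) (a * D.qi i)
        * D.calQ Psi Q chi (D.extWt w i) (a * (D.qi i)⁻¹)) * e2

end FiniteType

end QDatum

end

/-! ### Verification of the combinatorial hypotheses for an irreducible root system. -/

noncomputable section

namespace QDatum

set_option linter.unusedSectionVars false

/-! ### The datum of an irreducible root system -/

section RootPairing

variable {ι R M N : Type*} [Finite ι] [DecidableEq ι] [Field R] [CharZero R]
  [AddCommGroup M] [Module R M] [AddCommGroup N] [Module R N]
  {P : RootPairing ι R M N} [P.IsCrystallographic] {b : P.Base}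

/-- The coordinates of the root with index `k` in the basis of fundamental weights. -/
def rootWt (b : P.Base) (k : ι) : Wt b.support := fun j => P.pairingIn ℤ k j

theorem intCast_rootWt (k : ι) (j : b.support) :
    ((rootWt b k j : ℤ) : R) = P.coroot' j (P.root k) := by
  rw [P.root_coroot'_eq_pairing, ← P.algebraMap_pairingIn ℤ]
  rfl

theorem exists_rootWt_eq_sum (k : ι) :
    (∃ n : b.support → ℕ, rootWt b k = ∑ j, n j • rootWt b j) ∨
      ∃ n : b.support → ℕ, rootWt b k = -∑ j, n j • rootWt b j := by
  obtain ⟨f, -, hf⟩ := b.exists_root_eq_sum_nat_or_neg k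
  rw [← Finset.sum_coe_sort] at hf
  refine hf.imp (fun e => ⟨fun j => f j, ?_⟩) fun e => ⟨fun j => f j, ?_⟩ <;>
  · ext l
    apply Int.cast_injective (α := R)
    rw [intCast_rootWt, e]
    simp [Finset.sum_apply, intCast_rootWt, -RootPairing.root_coroot'_eq_pairing]

variable {D : QDatum b.support} (hD : ∀ i j : b.support, D.C i j = P.pairingIn ℤ j i)
include hD

theorem simpleRoot_eq_rootWt (i : b.support) : D.simpleRoot i = rootWt b i :=
  funext fun j => hD j i

/-- The reflections defined by the matrix permute the coordinate vectors of the roots as those of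
the root pairing do, so Weyl images of simple roots are coordinate vectors of roots. -/
theorem refl_rootWt (i : b.support) (k : ι) :
    D.refl i (rootWt b k) = rootWt b (P.reflectionPerm i k) := by
  ext j
  apply Int.cast_injective (α := R)
  rw [intCast_rootWt, P.root_reflectionPerm, P.reflection_apply_root, map_sub, map_smul,
    ← intCast_rootWt, ← intCast_rootWt, ← P.algebraMap_pairingIn ℤ]
  change (((rootWt b k - rootWt b k i • D.simpleRoot i) j : ℤ) : R) = _
  rw [simpleRoot_eq_rootWt hD]
  simp [rootWt]

theorem act_rootWt_mem_range (w : D.W) (k : ι) : D.act w (rootWt b k) ∈ Set.range (rootWt b) := by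
  obtain ⟨w, hw⟩ := w
  change w (rootWt b k) ∈ _
  induction hw using Subgroup.closure_induction_left generalizing k with
  | one => exact ⟨k, rfl⟩
  | mul_left x hx y hy ih =>
    obtain ⟨i, rfl⟩ := hx
    obtain ⟨l, hl⟩ := ih k
    exact ⟨P.reflectionPerm i l, by
      rw [← refl_rootWt hD, hl]; rfl⟩
  | inv_mul_cancel x hx y hy ih =>
    obtain ⟨i, rfl⟩ := hx
    obtain ⟨l, hl⟩ := ih k
    have e : (D.refl i)⁻¹ = D.refl i := LinearEquiv.ext fun _ => rfl
    exact ⟨P.reflectionPerm i l, by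
      rw [← refl_rootWt hD, hl, e]; rfl⟩

theorem det_C_ne_zero [P.IsRootSystem] : D.C.det ≠ 0 := by
  have e : D.C = b.cartanMatrix.transpose := Matrix.ext hD
  rw [e, Matrix.det_transpose]
  exact Matrix.nondegenerate_iff_det_ne_zero.1 b.cartanMatrix_nondegenerate

variable [P.IsReduced]

theorem C_mem (i j : b.support) (hij : i ≠ j) :
    (D.C i j = 0 ∧ D.C j i = 0) ∨ (D.C i j = -1 ∧ D.C j i = -1) ∨
    (D.C i j = -1 ∧ D.C j i = -2) ∨ (D.C i j = -2 ∧ D.C j i = -1) ∨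
    (D.C i j = -1 ∧ D.C j i = -3) ∨ (D.C i j = -3 ∧ D.C j i = -1) := by
  have hij' : (i : ι) ≠ j := fun e => hij (Subtype.ext e)
  have h1 := P.pairingIn_pairingIn_mem_set_of_isCrystal_of_isRed' j i
    (fun e => hij' (P.root.injective e.symm)) (b.root_ne_neg_of_ne j.2 i.2 hij'.symm)
  have h2 := b.pairingIn_le_zero_of_ne hij' i.2 j.2
  rw [hD, hD]
  simp only [Set.mem_insert_iff, Set.mem_singleton_iff, Prod.mk.injEq] at h1
  omega

variable [P.IsIrreducible]

/-- Along each edge of the Dynkin diagram the d_i and the squared lengths of the simple roots have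
the same ratio. The diagram is connected, so they are proportional. -/
theorem d_mul_form (B : P.InvariantForm) (i j : b.support) :
    (D.d i : R) * B.form (P.root j) (P.root j) = D.d j * B.form (P.root i) (P.root i) := by
  refine b.induction_on_cartanMatrix
    (fun k => (D.d i : R) * B.form (P.root k) (P.root k) = D.d k * B.form (P.root i) (P.root i))
    (i := i) rfl fun k l hk hkl => ?_
  have h1 : D.C k l ≠ 0 := by rw [hD]; exact hkl
  have h2 := D.d_symm k l
  have h3 : D.C l k ≠ 0 := by
    intro h0
    rw [h0, mul_zero] at h2
    exact (mul_ne_zero (by exact_mod_cast (D.d_pos k).ne') h1) h2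
  have h4 : (D.C k l : R) * B.form (P.root k) (P.root k) =
      D.C l k * B.form (P.root l) (P.root l) := by
    have := B.pairing_mul_eq_pairing_mul_swap k l
    rw [← P.algebraMap_pairingIn ℤ, ← P.algebraMap_pairingIn ℤ, ← hD, ← hD] at this
    exact this
  have h2' : (D.d k : R) * D.C k l = D.d l * D.C l k := by exact_mod_cast h2
  have h3' : (D.C l k : R) ≠ 0 := by exact_mod_cast h3
  refine mul_left_cancel₀ h3' ?_
  linear_combination (-(D.d i : R)) * h4 + (D.C k l : R) * hk
    + B.form (P.root i) (P.root i) * h2'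

/-- Here d_j is 2 or 3 times d_i, so i and j have different root lengths. An irreducible system has
only two lengths, hence every d_k equals d_i or d_j; thus d_i divides all of them, and coprimality
gives 1. -/
theorem d_eq_one_of_C (i j : b.support) (hC : D.C i j = -2 ∨ D.C i j = -3) : D.d i = 1 := by
  have := Fintype.ofFinite ι
  let B := (P.posRootForm ℤ).toInvariantForm
  have hij : i ≠ j := by
    rintro rfl
    have := D.C_diag i
    omega
  obtain ⟨n, hn, hdj⟩ : ∃ n : ℕ, 1 < n ∧ D.d j = n * D.d i := by
    have h1 := C_mem hD i j hij
    have h2 := D.d_symm i j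
    rcases hC with hC | hC
    · have h3 : D.C j i = -1 := by omega
      rw [hC, h3] at h2
      exact ⟨2, by norm_num, by omega⟩
    · have h3 : D.C j i = -1 := by omega
      rw [hC, h3] at h2
      exact ⟨3, by norm_num, by omega⟩
  have hdi := D.d_pos i
  have hdiR : (D.d i : R) ≠ 0 := by exact_mod_cast hdi.ne'
  have hne : B.form (P.root i) (P.root i) ≠ B.form (P.root j) (P.root j) := by
    intro e
    have h1 := d_mul_form hD B i j
    rw [e] at h1
    have h2 : D.d i = D.d j := by exact_mod_cast mul_right_cancel₀ (B.ne_zero j) h1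
    have : D.d i < n * D.d i := by nlinarith
    omega
  rw [← Nat.dvd_one, ← D.d_coprime]
  refine Finset.dvd_gcd fun k _ => ?_
  rcases B.apply_eq_or_of_apply_ne hne k with e | e
  · have h1 := d_mul_form hD B i k
    rw [e] at h1
    have h2 : D.d i = D.d k := by exact_mod_cast mul_right_cancel₀ (B.ne_zero i) h1
    rw [h2]
  · have h1 := d_mul_form hD B j k
    rw [e] at h1
    have h2 : D.d j = D.d k := by exact_mod_cast mul_right_cancel₀ (B.ne_zero j) h1
    rw [← h2, hdj]
    exact dvd_mul_left _ _

theorem finiteType [P.IsRootSystem] : D.FiniteType where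
  det_ne_zero := det_C_ne_zero hD
  pos_or_neg w i := by
    obtain ⟨k, hk⟩ := act_rootWt_mem_range hD w i
    simp only [simpleRoot_eq_rootWt hD]
    rw [← hk]
    exact exists_rootWt_eq_sum k
  cartan := C_mem hD
  d_eq_one := d_eq_one_of_C hD
  finite_roots := by
    refine (Set.finite_range (rootWt b)).subset ?_
    rintro _ ⟨w, i, rfl⟩
    rw [simpleRoot_eq_rootWt hD]
    exact act_rootWt_mem_range hD w i

end RootPairing

end QDatum

end

theorem theorem5p3
    {ι R M N : Type*} [Finite ι] [DecidableEq ι] [Field R] [CharZero R]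
    [AddCommGroup M] [Module R M] [AddCommGroup N] [Module R N]
    (P : RootPairing ι R M N) [P.IsRootSystem] [P.IsCrystallographic] [P.IsReduced]
    [P.IsIrreducible] (b : P.Base)
    (D : QDatum b.support) (hD : ∀ i j : b.support, D.C i j = P.pairingIn ℤ j i) :
    (∃! F : (D.ExtWt → ℂˣ → FreeMon b.support) × (D.ExtWt → ℂˣ → D.PiBar),
      D.IsPsiQFamily F.1 F.2) ∧
    (∃! chi : D.ExtWt → D.PiBar, D.IsChiFamily chi) ∧
    ∀ (Psi : D.ExtWt → ℂˣ → FreeMon b.support) (Q : D.ExtWt → ℂˣ → D.PiBar)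
      (chi : D.ExtWt → D.PiBar),
      D.IsPsiQFamily Psi Q → D.IsChiFamily chi →
      ∀ (i : b.support) (w : D.W) (a : ℂˣ),
        D.calQ Psi Q chi (D.extWt (w * D.s i) i) (a * D.qi i)
            * D.calQ Psi Q chi (D.extWt w i) (a * (D.qi i)⁻¹)
          - D.br (-D.act w (D.simpleRoot i))
            * D.calQ Psi Q chi (D.extWt (w * D.s i) i) (a * (D.qi i)⁻¹)
            * D.calQ Psi Q chi (D.extWt w i) (a * D.qi i)
        = D.brPlusNeg (D.act w (D.simpleRoot i))
          * (∏ j with D.C i j = -1, D.calQ Psi Q chi (D.extWt w j) a)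
          * (∏ j with D.C i j = -2,
              D.calQ Psi Q chi (D.extWt w j) (a * D.q)
                * D.calQ Psi Q chi (D.extWt w j) (a * D.q⁻¹))
          * (∏ j with D.C i j = -3,
              D.calQ Psi Q chi (D.extWt w j) (a * D.q ^ 2)
                * D.calQ Psi Q chi (D.extWt w j) a
                * D.calQ Psi Q chi (D.extWt w j) (a * (D.q ^ 2)⁻¹)) := by
  have h := QDatum.finiteType hD
  refine ⟨h.existsUnique_isPsiQFamily, h.existsUnique_isChiFamily,
    fun Psi Q chi hPQ hchi i w a => ?_⟩
  rw [h.extended_qq hPQ hchi i w a,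
    ← QDatum.prod_shifts (fun j => D.calQ Psi Q chi (D.extWt w j)) i a]
  simp only [mul_assoc]
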